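/- **Setting.** There are absolute constants $C>0$ and $p\in\mathbb N$ for which the following holds. Let $n\ge 1$, $\mathbf A\in\mathbb R^{n\times d}$ with $\mathbf A^\top\mathbf A\succ0$, $b\in\mathbb R^n$, $c\in\mathbb R^d$, and $$f(x)=c^\top x+\|\mathbf Ax-b\|_4^4 ,\qquad x\in\mathbb R^d .$$ Put $\mathbf B=\mathbf A^\top\mathbf A$, $L=24$, $\|v\|_{\mathbf B}=\sqrt{v^\top\mathbf Bv}$, $\|v\|_{\mathbf B^{-1}}=\sqrt{v^\top\mathbf B^{-1}v}$; $\|\cdot\|$ is the spectral norm of matrices. **Claim.** $f$ has a minimizer $x^*$. For every starting point $x_0\in\mathbb R^d$ and every $\varepsilon>0$ there is an initialization $(\rho^-,\tilde\varepsilon,N,K,M,J,S)$ with $0<\rho^-<\frac12$, $2L\mathcal P\rho^-\le\varepsilon$, $0<\tilde\varepsilon<\frac12$, $N,K,M,J\in\mathbb N$ and $S\ge1$ for which $\mathsf{FastQuartic}$, run $S$ times in succession (the first run starts at $x_0$, each later one at the output of the run before it), outputs a point $\hat x$ with $$f(\hat x)-f(x^*)\le\varepsilon ,$$ and makes in total at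 most $$C\,n^{1/5}\,\log^{p}\!\left(2+\mathcal Z/\varepsilon\right)$$ calls to a gradient oracle (which returns $\nabla f(x)$ for a given $x$) and to a linear system solver (which returns the solution of a given $d\times d$ system). Every system that is solved has a matrix of the form $\mathbf A^\top\mathbf D\mathbf A$ with $\mathbf D$ diagonal and positive, so it is sparse if $\mathbf A^\top \mathbf A$ is. **The parameter $\mathcal Z$.** Let $\mathcal K=\{x:\|x-x_0\|_{\mathbf B}^2\le4\|x_0-x^*\|_{\mathbf B}^2\}$, $\mathcal L=\{x:f(x)\le\max_{\mathcal K}f\}$, and $$\mathcal P=\max_{x,y\in\mathcal L}\|x-y\|_{\mathbf B}^2,\quad \mathcal G=\max_{x\in\mathcal L}\|\nabla f(x)\|_{\mathbf B^{-1}}^2,\quad \mathcal Q=\frac{6\mathcal P^{1/2}}{L^{1/4}}+\frac5{L^{1/2}} .$$ Let $\Omega_x(y)$ be the third-order Taylor polynomial of $f$ at $x$, evaluated at $y$, plus $\frac L4\|y-x\|_{\mathbf B}^4$, and $T(x)=\operatorname{argmin}_y\Omega_x(y)$. Put $$\mathcal A=1+\max_{z\in\mathcal L}\Big[\tfrac1{\sqrt2}(T(z)-z)^\top\nabla^2f(z)(T(z)-z)+\tfrac{\sqrt2L}{4}\|T(z)-z\|_{\mathbf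 B}^4\Big],$$ $$\mathcal W=\max_{x,y\in\mathcal L}\big\|\nabla f(x)+L\|x-y\|_{\mathbf B}^2\mathbf B(x-y)\big\|_{\mathbf B^{-1}}\Big(\|\mathbf B^{-1/2}\|^2\,\|\mathbf H(x,y)\|\,\|\mathbf B^{-1}\|+L\|x-T(y)\|_{\mathbf B}^2\Big),$$ where $\mathbf H(x,y)=\nabla^2\Omega_y(T(y))+\frac12\nabla^3\Omega_y(T(y))[x-T(y)]$, and $$\mathcal H=\max_{x,z\in\mathcal L}\Big[\|\nabla^4f(x)[z-x]^2\|+2L\|\mathbf B(z-x)(z-x)^\top\mathbf B\|+L\|z-x\|_{\mathbf B}^2\|\mathbf B\|\Big],$$ $$\mathcal R=\frac{4\mathcal P^{1/2}\lambda_{\max}(\mathbf B^{1/2})\,(2\mathcal H+L\lambda_{\min}(\mathbf B)\mathcal P)}{L\lambda_{\min}(\mathbf B)},\qquad \mathcal V=\frac{6\mathcal W\mathcal P}{L^{1/4}} .$$ Then $\mathcal Z=\max\{\mathcal A,\mathcal G,\mathcal P,\mathcal Q,\mathcal R,\mathcal V,\mathcal W,L\}$; it depends only on $\mathbf A,b,c,x_0$.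 **$\mathsf{FastQuartic}$** (one run, from its own starting point $x_0$; the quantities $\mathcal P,\mathcal G,\mathcal Q$ below are those of this starting point). Let $A_0=0$, $\psi_0(x)=\frac12\|x-x_0\|_{\mathbf B}^2$ and $\tilde\varepsilon_{fs}=\min\{\frac{3L^2\mathcal P\rho^-}{32\mathcal G},\frac12\}$. For numbers $A\geq 0$, $\rho>0$ let $a(A,\rho)=\frac{1+\sqrt{1+4LA\rho}}{2L\rho}$, and with $a=a(A,\rho)$, $\tau=a/(A+a)$ let $y(x,v,A,\rho)=(1-\tau)x+\tau v$. For $k=0,\dots,N$: 1. $v_k=\operatorname{argmin}\psi_k$, $y^-=y(x_k,v_k,A_k,\rho^-)$, $x^-=\mathsf{ApproxAuxMin}(y^-)$. 2. If $\rho^->(1+\tilde\varepsilon_{fs})\|x^--y^-\|_{\mathbf B}^2$ or $\rho^->\|x^--y^-\|_{\mathbf B}^2-\mathcal Q\tilde\varepsilon^{1/4}$, return $x^-$. 3. Otherwise obtain $x_{k+1}$ and $a_{k+1}$ from $\mathsf{RhoSearch}$, put $A_{k+1}=A_k+a_{k+1}$ and $\psi_{k+1}(x)=\psi_k(x)+a_{k+1}[f(x_{k+1})+\langle\nabla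 f(x_{k+1}),x-x_{k+1}\rangle]$. If no return occurred, return $x_{N+1}$. **$\mathsf{RhoSearch}$.** Let $\tilde\delta=6(\tilde\varepsilon/L)^{1/4}\mathcal P^{1/2}+(12\tilde\varepsilon/L)^{1/2}$ and start with the interval $[\rho_{\mathrm{lo}},\rho_{\mathrm{hi}}]=[\rho^-,\mathcal P]$. At most $M$ times: let $\hat\rho$ be the midpoint, $\hat a=a(A_k,\hat\rho)$, $\hat y=y(x_k,v_k,A_k,\hat\rho)$, $\hat x=\mathsf{ApproxAuxMin}(\hat y)$, $\hat\zeta=\|\hat x-\hat y\|_{\mathbf B}^2$; if $\hat\rho>\hat\zeta+\tilde\delta$ set $\rho_{\mathrm{hi}}=\hat\rho$, else if $\hat\rho<\hat\zeta-\tilde\delta$ set $\rho_{\mathrm{lo}}=\hat\rho$, else stop. Return the last $\hat x,\hat a$ (or $x_k,0$ if $M=0$). **$\mathsf{ApproxAuxMin}(y)$.** Let $\Gamma(h)=\Omega_y(y+h)-f(y)$, $D(h)=\frac12h^\top\nabla^2f(y)h+\frac L4\|h\|_{\mathbf B}^4$, $\sigma=1+\frac1{\sqrt2}$. Starting from $h_0=0$,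 for $t=0,\dots,K-1$ let $h_{t+1}$ be the approximation, described next, to $$\operatorname*{argmin}_h\ \langle\nabla\Gamma(h_t),h-h_t\rangle+\sigma\big(D(h)-D(h_t)-\langle\nabla D(h_t),h-h_t\rangle\big).$$ Return $y+h_K$. The approximation: with $g=\sigma^{-1}\nabla\Gamma(h_t)-\nabla D(h_t)$, perform $J$ steps of bisection on the sign of the derivative of $w(\lambda)=\frac{\lambda^2}2+\frac12g^\top(\sqrt{2L}\lambda\mathbf B+\nabla^2f(y))^{-1}g$, starting from the interval $[0,\,1+\|g\|_{\mathbf B^{-1}}^2/\sqrt{2L}]$; let $\lambda$ be the upper end of the final interval and $h_{t+1}=-(\sqrt{2L}\lambda\mathbf B+\nabla^2f(y))^{-1}g$. Here $\nabla\Gamma(h_t)$ and $\nabla D(h_t)$ are computed from the four gradients $\nabla f(y)$, $\nabla f(y\pm h_t)$, $\nabla f(y+2h_t)$, and the counted solver calls are those for $v_k$ and $\|g\|_{\mathbf B^{-1}}$ (matrix $\mathbf B$) and for each bisection step and $h_{t+1}$ (matrix $\sqrt{2L}\lambda\mathbf B+\nabla^2f(y)$). -/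

import Mathlib

open Matrix

namespace FastQuartic

/-! ### Programs with two oracles and exact call counts -/

/-- The space `ℝ^d` with its Euclidean norm. -/
abbrev Vec (d : ℕ) := EuclideanSpace ℝ (Fin d)

/-- `d × d` real matrices, regarded as operators on `ℝ^d`. -/
abbrev Op (d : ℕ) := Vec d →L[ℝ] Vec d

/-- The outcome of a computation that may call a gradient oracle and a linear system solver:
the computed value, the number of gradient calls that were made, and the list of the matrices of
all the linear systems that were handed to the solver (one entry per call). -/
structure Run (d : ℕ) (α : Type) where
  val : α
  gradCalls : ℕ
  systems : List (Op d)

/-- The number of calls to the linear system solver. -/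
def Run.solverCalls {d : ℕ} {α : Type} (r : Run d α) : ℕ := r.systems.length

/-- Sequential composition; calls accumulate. -/
instance Run.instMonad (d : ℕ) : Monad (Run d) where
  pure a := ⟨a, 0, []⟩
  bind r k :=
    ⟨(k r.val).val, r.gradCalls + (k r.val).gradCalls, r.systems ++ (k r.val).systems⟩

noncomputable section

/-- One call to the gradient oracle of `f`. -/
def gradOracle {d : ℕ} (f : Vec d → ℝ) (x : Vec d) : Run d (Vec d) :=
  ⟨gradient f x, 1, []⟩

/-- One call to the linear system solver: the solution `z` of `M z = r`. -/
def linSolve {d : ℕ} (M : Op d) (r : Vec d) : Run d (Vec d) :=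
  ⟨M.inverse r, 0, [M]⟩

/-! ### Derivatives, norms, minimizers -/

/-- `∇²f(x)` as an operator. -/
def hess {d : ℕ} (f : Vec d → ℝ) (x : Vec d) : Op d := fderiv ℝ (gradient f) x

/-- `∇³f(x)[h]` as an operator. -/
def third {d : ℕ} (f : Vec d → ℝ) (x h : Vec d) : Op d := fderiv ℝ (hess f) x h

/-- `∇⁴f(x)[h, k]` as an operator. -/
def fourth {d : ℕ} (f : Vec d → ℝ) (x h k : Vec d) : Op d :=
  fderiv ℝ (fun z => third f z h) x k

/-- A global minimizer of `g` (an arbitrary point if there is none). -/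
def argmin {d : ℕ} (g : Vec d → ℝ) : Vec d :=
  Classical.epsilon fun x => ∀ y, g x ≤ g y

/-- The data of an instance: a function `f`, a symmetric positive definite `B` and a constant `L`
for which `f` is `L`-smooth of degree three with respect to `‖·‖_B`. -/
structure Instance (d : ℕ) where
  f : Vec d → ℝ
  B : Op d
  L : ℝ

namespace Instance

variable {d : ℕ} (S : Instance d)

/-- `‖v‖_B = √(vᵀ B v)`. -/
def normB (v : Vec d) : ℝ := √(inner ℝ v (S.B v))

/-- `‖v‖_{B⁻¹} = √(vᵀ B⁻¹ v)`. -/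
def normBinv (v : Vec d) : ℝ := √(inner ℝ v (S.B.inverse v))

/-- The minimizer `x*` of `f`. -/
def xstar : Vec d := argmin S.f

/-! ### Problem-dependent quantities -/

/-- `K = {x : ‖x - x₀‖_B² ≤ 4 ‖x₀ - x*‖_B²}`. -/
def setK (x₀ : Vec d) : Set (Vec d) :=
  {x | S.normB (x - x₀) ^ 2 ≤ 4 * S.normB (x₀ - S.xstar) ^ 2}

/-- The maximum of `f` over `K`. -/
def maxF (x₀ : Vec d) : ℝ := sSup (S.f '' S.setK x₀)

/-- The level set `{x : f(x) ≤ max_K f}`. -/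
def setL (x₀ : Vec d) : Set (Vec d) := {x | S.f x ≤ S.maxF x₀}

/-- `P = max_{x, y ∈ L} ‖x - y‖_B²`. -/
def parP (x₀ : Vec d) : ℝ :=
  sSup (Set.image2 (fun x y => S.normB (x - y) ^ 2) (S.setL x₀) (S.setL x₀))

/-- `G = max_{x ∈ L} ‖∇f(x)‖_{B⁻¹}²`. -/
def parG (x₀ : Vec d) : ℝ :=
  sSup ((fun x => S.normBinv (gradient S.f x) ^ 2) '' S.setL x₀)

/-- `Q = 6 P^{1/2} / L^{1/4} + 5 / L^{1/2}`. -/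
def parQ (x₀ : Vec d) : ℝ :=
  6 * √(S.parP x₀) / S.L ^ (1 / 4 : ℝ) + 5 / √S.L

/-- The third order Taylor polynomial `Φ_x(y)` of `f` at `x`. -/
def taylor (x y : Vec d) : ℝ :=
  S.f x + inner ℝ (gradient S.f x) (y - x)
    + 1 / 2 * inner ℝ (hess S.f x (y - x)) (y - x)
    + 1 / 6 * inner ℝ (third S.f x (y - x) (y - x)) (y - x)

/-- The model `Ω_x(y) = Φ_x(y) + (L / 4) ‖y - x‖_B⁴`. -/
def model (x y : Vec d) : ℝ := S.taylor x y + S.L / 4 * S.normB (y - x) ^ 4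

/-- `T(x)`, the minimizer of the model `Ω_x`. -/
def modelMin (x : Vec d) : Vec d := argmin (S.model x)

/-- `A = 1 + max_{z ∈ L} [ (1/√2) (T(z)-z)ᵀ ∇²f(z) (T(z)-z) + (√2 L/4) ‖T(z)-z‖_B⁴ ]`. -/
def parA (x₀ : Vec d) : ℝ :=
  1 + sSup ((fun z =>
      1 / √2 * inner ℝ (S.modelMin z - z) (hess S.f z (S.modelMin z - z))
        + √2 * S.L / 4 * S.normB (S.modelMin z - z) ^ 4) '' S.setL x₀)

/-- `Z(x, y) = ‖∇f(x) + L ‖x - y‖_B² B (x - y)‖_{B⁻¹}`. -/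
def fnZ (x y : Vec d) : ℝ :=
  S.normBinv (gradient S.f x + (S.L * S.normB (x - y) ^ 2) • S.B (x - y))

/-- `W(x, y) = ‖B^{-1/2}‖² ‖H(x, y)‖ ‖B⁻¹‖ + L ‖x - T(y)‖_B²`, where
`H(x, y) = ∇²Ω_y(T(y)) + (1/2) ∇³Ω_y(T(y))[x - T(y)]`; note `‖B^{-1/2}‖² = ‖B⁻¹‖`. -/
def fnW (x y : Vec d) : ℝ :=
  ‖S.B.inverse‖
      * ‖hess (S.model y) (S.modelMin y)
          + (1 / 2 : ℝ) • third (S.model y) (S.modelMin y) (x - S.modelMin y)‖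
      * ‖S.B.inverse‖
    + S.L * S.normB (x - S.modelMin y) ^ 2

/-- `max_{x, y ∈ L} Z(x, y) W(x, y)`. -/
def parW (x₀ : Vec d) : ℝ :=
  sSup (Set.image2 (fun x y => S.fnZ x y * S.fnW x y) (S.setL x₀) (S.setL x₀))

/-- `max_{x, z ∈ L} ‖∇⁴f(x)[z-x]²‖ + 2 L ‖B (z-x)(z-x)ᵀ B‖ + L ‖z-x‖_B² ‖B‖`;
the rank one matrix `u uᵀ` has norm `‖u‖²`. -/
def parH (x₀ : Vec d) : ℝ :=
  sSup (Set.image2 (fun x z =>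
      ‖fourth S.f x (z - x) (z - x)‖ + 2 * S.L * ‖S.B (z - x)‖ ^ 2
        + S.L * S.normB (z - x) ^ 2 * ‖S.B‖) (S.setL x₀) (S.setL x₀))

/-- The smallest eigenvalue of `B`. -/
def lamMin : ℝ := ‖S.B.inverse‖⁻¹

/-- `4 P^{1/2} λ_max(B^{1/2}) (2 H + L λ_min(B) P) / (L λ_min(B))`. -/
def parR (x₀ : Vec d) : ℝ :=
  4 * √(S.parP x₀) * √‖S.B‖ * (2 * S.parH x₀ + S.L * S.lamMin * S.parP x₀)
    / (S.L * S.lamMin)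

/-- `max_{x, y ∈ L} 6 Z(x, y) W(x, y) P / L^{1/4}`. -/
def parV (x₀ : Vec d) : ℝ := 6 * S.parW x₀ * S.parP x₀ / S.L ^ (1 / 4 : ℝ)

/-- The problem-dependent parameter: the maximum of the quantities above. -/
def parZ (x₀ : Vec d) : ℝ :=
  max (S.parA x₀) (max (S.parG x₀) (max (S.parP x₀) (max (S.parQ x₀)
    (max (S.parR x₀) (max (S.parV x₀) (max (S.parW x₀) S.L))))))

end Instance

/-! ### The algorithm -/

/-- The inputs that an initialization has to choose. -/
structure Init where
  /-- the lower end of the search interval -/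
  rhoInit : ℝ
  /-- the accuracy parameter of `ApproxAuxMin` -/
  epsAam : ℝ
  /-- `FastQuartic` performs the iterations `k = 0, …, numIter` -/
  numIter : ℕ
  /-- number of iterations of `ApproxAuxMin` -/
  numAux : ℕ
  /-- number of iterations of `RhoSearch` -/
  numRho : ℕ
  /-- number of steps of the one-dimensional minimization inside `ApproxAuxMin` -/
  numDual : ℕ
  /-- number of times `FastQuartic` is run, each run starting at the output of the previous one -/
  numRuns : ℕ

namespace Instance

variable {d : ℕ} (S : Instance d)

/-- The matrix `√(2L) t B + ∇²f(y)`. -/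
def dualMatrix (y : Vec d) (t : ℝ) : Op d := (√(2 * S.L) * t) • S.B + hess S.f y

/-- Bisection for the minimizer over `t > 0` of the strictly convex function
`w(t) = t²/2 + (1/2) gᵀ (√(2L) t B + ∇²f(y))⁻¹ g`, whose derivative is
`w'(t) = t - (√(2L)/2) ‖(√(2L) t B + ∇²f(y))⁻¹ g‖_B²`. Each step makes one solver call.
The upper end of the final bracket is returned. -/
def dualSearch (y g : Vec d) : ℕ → ℝ → ℝ → Run d ℝ
  | 0, _, hi => pure hi
  | j + 1, lo, hi => do
      let m := (lo + hi) / 2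
      let s ← linSolve (S.dualMatrix y m) g
      if 0 ≤ m - √(2 * S.L) / 2 * S.normB s ^ 2 then
        dualSearch y g j lo m
      else
        dualSearch y g j m hi

/-- One step of the relative gradient method for
`Γ_y(h) = ⟨∇f(y), h⟩ + (1/2) ∇²f(y)[h]² + (1/6) ∇³f(y)[h]³ + (L/4) ‖h‖_B⁴`, i.e.
`h ↦ argmin_u ⟨∇Γ_y(h), u - h⟩ + σ (D(u) - D(h) - ⟨∇D(h), u - h⟩)`, with
`D(u) = (1/2) uᵀ ∇²f(y) u + (L/4) ‖u‖_B⁴` and `σ = 1 + 1/√2`.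

As `f` is a quartic polynomial, `q = (1/6) ∇⁴f(y)[h]³` is a third difference of gradients, and
`∇f(y) + ∇²f(y) h + (1/2) ∇³f(y)[h]² = ∇f(y + h) - q`. The minimizer `u` solves
`∇²f(y) u + L ‖u‖_B² B u = -g`, with `g = σ⁻¹ ∇Γ_y(h) - ∇D(h)`; it is
`u = -(√(2L) t B + ∇²f(y))⁻¹ g` for the minimizer `t` of the function `w` of `dualSearch`, which
lies below `1 + ‖g‖_{B⁻¹}² / √(2L)`. -/
def auxStep (J : ℕ) (y h : Vec d) : Run d (Vec d) := do
  let p₀ ← gradOracle S.f y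
  let p₁ ← gradOracle S.f (y + h)
  let pm ← gradOracle S.f (y - h)
  let p₂ ← gradOracle S.f (y + (2 : ℝ) • h)
  let q := (1 / 6 : ℝ) • (p₂ - (3 : ℝ) • p₁ + (3 : ℝ) • p₀ - pm)
  let hessh := (1 / 2 : ℝ) • (p₁ - pm) - q
  let quart := (S.L * S.normB h ^ 2) • S.B h
  let ct := p₁ - q + quart
  let g := (1 + 1 / √2)⁻¹ • ct - (hessh + quart)
  let e ← linSolve S.B g
  let t ← S.dualSearch y g J 0 (1 + inner ℝ g e / √(2 * S.L))
  let s ← linSolve (S.dualMatrix y t) g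
  pure (-s)

/-- `h_K`, starting from `h₀ = 0`. -/
def auxIter (J : ℕ) (y : Vec d) : ℕ → Run d (Vec d)
  | 0 => pure 0
  | K + 1 => do
      let h ← auxIter J y K
      S.auxStep J y h

/-- `ApproxAuxMin(y)`: an approximate minimizer of the model `Ω_y`. -/
def approxAuxMin (i : Init) (y : Vec d) : Run d (Vec d) := do
  let h ← S.auxIter i.numDual y i.numAux
  pure (y + h)

/-- `a = (1 + √(1 + 4 L A ρ)) / (2 L ρ)`, the positive root of `a² = (A + a) / (L ρ)`. -/
def stepSize (A ρ : ℝ) : ℝ := (1 + √(1 + 4 * S.L * A * ρ)) / (2 * S.L * ρ)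

/-- `(1 - τ) x + τ v` with `τ = a / (A + a)`. -/
def mixPoint (A a : ℝ) (x v : Vec d) : Vec d :=
  (1 - a / (A + a)) • x + (a / (A + a)) • v

/-- `δ = 6 (ε_aam / L)^{1/4} P^{1/2} + (12 ε_aam / L)^{1/2}`. -/
def tolRho (i : Init) (x₀ : Vec d) : ℝ :=
  6 * (i.epsAam / S.L) ^ (1 / 4 : ℝ) * √(S.parP x₀) + √(12 * i.epsAam / S.L)

/-- The loop of `RhoSearch` with bracket `[lo, hi]`; the last argument holds the most recent
`x̂_{k+1}, â_{k+1}`. It returns `ρ_k, x_{k+1}, a_{k+1}`. -/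
def rhoSearch (i : Init) (x₀ x v : Vec d) (A : ℝ) :
    ℕ → ℝ → ℝ → Vec d × ℝ → Run d (ℝ × Vec d × ℝ)
  | 0, lo, _, last => pure (lo, last)
  | M + 1, lo, hi, _ => do
      let ρ := (lo + hi) / 2
      let a := S.stepSize A ρ
      let y := mixPoint A a x v
      let xh ← S.approxAuxMin i y
      if S.normB (xh - y) ^ 2 + S.tolRho i x₀ < ρ then
        rhoSearch i x₀ x v A M lo ρ (xh, a)
      else if ρ < S.normB (xh - y) ^ 2 - S.tolRho i x₀ then
        rhoSearch i x₀ x v A M ρ hi (xh, a)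
      else
        pure (ρ, xh, a)

/-- `ε_fs = min {3 L² P ρ_init / (32 G), 1/2}`. -/
def epsFs (i : Init) (x₀ : Vec d) : ℝ :=
  min (3 * S.L ^ 2 * S.parP x₀ * i.rhoInit / (32 * S.parG x₀)) (1 / 2)

/-- The main loop, with the given number of iterations left. Its state is `x_k`, `A_k` and
`s_k = ∑_{j=1}^k a_j ∇f(x_j)`. The estimate function
`ψ_k(x) = (1/2) ‖x - x₀‖_B² + ∑_{j=1}^k a_j (f(x_j) + ⟨∇f(x_j), x - x_j⟩)` has the minimizer
`v_k = x₀ - B⁻¹ s_k`. -/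
def mainLoop (i : Init) (x₀ : Vec d) : ℕ → Vec d → ℝ → Vec d → Run d (Vec d)
  | 0, x, _, _ => pure x
  | k + 1, x, A, s => do
      let z ← linSolve S.B s
      let v := x₀ - z
      let y := mixPoint A (S.stepSize A i.rhoInit) x v
      let xm ← S.approxAuxMin i y
      if (1 + S.epsFs i x₀) * S.normB (xm - y) ^ 2 < i.rhoInit then
        pure xm
      else if S.normB (xm - y) ^ 2 - S.parQ x₀ * i.epsAam ^ (1 / 4 : ℝ) < i.rhoInit then
        pure xm
      else
        let out ← S.rhoSearch i x₀ x v A i.numRho i.rhoInit (S.parP x₀) (x, 0)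
        let x' := out.2.1
        let a := out.2.2
        let g ← gradOracle S.f x'
        mainLoop i x₀ k x' (A + a) (s + a • g)

/-- One run of `FastQuartic` from `x₀`, with `A₀ = 0`. -/
def fastQuartic (i : Init) (x₀ : Vec d) : Run d (Vec d) :=
  S.mainLoop i x₀ (i.numIter + 1) x₀ 0 0

/-- Successive runs of `FastQuartic`, each started at the output of the previous one. -/
def restarted (i : Init) : ℕ → Vec d → Run d (Vec d)
  | 0, x => pure x
  | r + 1, x => do
      let x' ← S.fastQuartic i x
      restarted i r x'

/-- `FastQuartic` with the initialization `i` and the starting point `x₀`. -/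
def solve (i : Init) (x₀ : Vec d) : Run d (Vec d) := S.restarted i i.numRuns x₀

end Instance

/-- Requirements on the initialization: at least one run, `0 < ρ_init < 1/2`,
`ρ_init ≤ ε / (2 L P)` and `0 < ε_aam < 1/2`. -/
def Init.Valid {d : ℕ} (i : Init) (S : Instance d) (x₀ : Vec d) (ε : ℝ) : Prop :=
  1 ≤ i.numRuns ∧ 0 < i.rhoInit ∧ i.rhoInit < 1 / 2 ∧
    2 * S.L * S.parP x₀ * i.rhoInit ≤ ε ∧ 0 < i.epsAam ∧ i.epsAam < 1 / 2

/-! ### Regression in the fourth power norm -/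

/-- `f(x) = cᵀ x + ‖A x - b‖₄⁴`. -/
def regression {n d : ℕ} (A : Matrix (Fin n) (Fin d) ℝ) (b : Fin n → ℝ) (c : Fin d → ℝ)
    (x : Vec d) : ℝ :=
  ∑ j, c j * x j + ∑ k, |(A *ᵥ x.ofLp) k - b k| ^ 4

/-- The operator `Aᵀ diag(w) A`. -/
def weightedGram {n d : ℕ} (A : Matrix (Fin n) (Fin d) ℝ) (w : Fin n → ℝ) : Op d :=
  toEuclideanCLM (𝕜 := ℝ) (Aᵀ * diagonal w * A)

/-- The regression problem as an instance: `B = Aᵀ A`, and `L = 24` since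
`∇⁴f(x)[h]⁴ = 24 ‖A h‖₄⁴ ≤ 24 ‖h‖_B⁴`. -/
def regressionInstance {n d : ℕ} (A : Matrix (Fin n) (Fin d) ℝ) (b : Fin n → ℝ)
    (c : Fin d → ℝ) : Instance d where
  f := regression A b c
  B := toEuclideanCLM (𝕜 := ℝ) (Aᵀ * A)
  L := 24

end

end FastQuartic

/-! In the coordinate `u = A h` the norm `‖h‖_B` is Euclidean and `f` restricted to any line is a
quartic polynomial, so every estimate becomes an inequality between finite sums. All scales are
powers of one number `X = 2 + Z/ε`; numerical constants are absorbed by `X ≥ 2`, and the exponents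
are generous because only logarithms of `X` enter the count.

Auxiliary problem. The model at `y` is a linear form plus the convex function `D` plus a cubic `C`.
The Bregman remainder of `C` is at most `1/√2` times that of `D` (`abs_bregC_le`), so the model is
smooth and strongly convex relative to `D`, with constants `1 ± 1/√2`. A relative gradient step
therefore contracts the Bregman distance to the minimizer (`bregD_step`), also when the inner
bisection is inexact (`auxStep_spec`). With `K` and `J` of order `log X` the computed point is
within `X⁻⁶⁰` of the minimizer (`norm_auxIter_sub_le`).

Accelerated step. Near the minimizer of the model, `∇f(x')` is close to `-24 ‖u‖² B (x' - y)`. If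
`ρ` is close to `‖u‖²`, this is an inexact proximal step of strength `24 ρ` (`proximal_auxApprox`),
and the usual potential decreases by an extra `8 A_{k+1} ρ²` (`lyapunov_step`). Hence `∑ A_{k+1}
ρ_k² ≤ D₀²/16`, where `D₀ = ‖x₀ - x*‖_B`. As `√A_k` grows by at least `1/(2√(24ρ))` per step,
Hölder's inequality forces `A_k ≥ k⁵/(18432 D₀²)` (`Growth.step`, `Growth.pow_five_le`). A suitable
`ρ` is found by bisection: the minimizer of the model is Hölder continuous in its centre, so a
bracket with the right signs at its ends cannot be short (`rho_gap`). If instead `‖u‖² ≤ 2ρ⁻`, then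
the gradient is so small that the returned point has gap at most `1/X` (`gap_le_of_short`).

Restarts. A full run gives a gap at most `D₀²/(2A)`, while quartic growth gives a gap at least `‖x -
x*‖_B⁴/(3n)`. So order `n^{1/5}` iterations divide the distance to `x*` by three
(`fastQuartic_spec`); the level sets are then nested, and the same `X` serves every run. Order `log
X` runs suffice (`exists_restarted_le`).

The parameter. If the initial gap exceeds `ε`, then the entries `G`, `V` and `L` of `Z` already
bound the diameter, the gradients and the Hessians on the level set by powers of `X`
(`RunBounds.of_gap`). If it does not, an initialization that returns `x₀` at once is enough. An
iteration costs order `log³ X` calls, and the number of runs contributes the fourth logarithm. -/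

namespace FastQuartic

noncomputable section

section

/-! ### The image `A h` and the norm `‖h‖_B = ‖A h‖` -/

variable {n d : ℕ}

/-- The map `h ↦ A h`. -/
def img (A : Matrix (Fin n) (Fin d) ℝ) : Vec d →L[ℝ] Vec n :=
  LinearMap.toContinuousLinearMap (Matrix.toEuclideanLin A)

theorem img_apply (A : Matrix (Fin n) (Fin d) ℝ) (x : Vec d) (k : Fin n) :
    img A x k = (A *ᵥ x.ofLp) k := rfl

/-- The residual `A x - b`. -/
def res (A : Matrix (Fin n) (Fin d) ℝ) (b : Fin n → ℝ) (x : Vec d) : Vec n :=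
  img A x - WithLp.toLp 2 b

theorem res_apply (A : Matrix (Fin n) (Fin d) ℝ) (b : Fin n → ℝ) (x : Vec d) (k : Fin n) :
    res A b x k = img A x k - b k := rfl

theorem res_add (A : Matrix (Fin n) (Fin d) ℝ) (b : Fin n → ℝ) (x h : Vec d) (k : Fin n) :
    res A b (x + h) k = res A b x k + img A h k := by
  simp [res_apply]; ring

theorem inner_eq_sum {m : ℕ} (u v : Vec m) : inner ℝ u v = ∑ k, u k * v k := by
  simp [PiLp.inner_apply, mul_comm]

theorem norm_sq_eq_sum {m : ℕ} (u : Vec m) : ‖u‖ ^ 2 = ∑ k, u k ^ 2 := by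
  rw [EuclideanSpace.norm_sq_eq]; simp

theorem inner_weightedGram (A : Matrix (Fin n) (Fin d) ℝ) (w : Fin n → ℝ) (h z : Vec d) :
    inner ℝ (weightedGram A w h) z = ∑ k, w k * img A h k * img A z k := by
  have h1 : ∀ j, weightedGram A w h j = ((Aᵀ * diagonal w * A) *ᵥ h.ofLp) j := fun j => rfl
  rw [inner_eq_sum]
  simp only [h1]
  have : ∑ k, ((Aᵀ * diagonal w * A) *ᵥ h.ofLp) k * z k
      = ((Aᵀ * diagonal w * A) *ᵥ h.ofLp) ⬝ᵥ z.ofLp := rfl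
  rw [this, ← Matrix.mulVec_mulVec, ← Matrix.mulVec_mulVec, dotProduct_comm,
    Matrix.dotProduct_mulVec, Matrix.vecMul_transpose, dotProduct]
  refine Finset.sum_congr rfl fun k _ => ?_
  rw [Matrix.mulVec_diagonal, img_apply, img_apply]; ring

theorem weightedGram_one (A : Matrix (Fin n) (Fin d) ℝ) :
    weightedGram A (fun _ => 1) = toEuclideanCLM (𝕜 := ℝ) (Aᵀ * A) := by
  unfold weightedGram
  congr 1
  simp

theorem inner_gram (A : Matrix (Fin n) (Fin d) ℝ) (h z : Vec d) :
    inner ℝ (toEuclideanCLM (𝕜 := ℝ) (Aᵀ * A) h) z = inner ℝ (img A h) (img A z) := by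
  rw [← weightedGram_one, inner_weightedGram, inner_eq_sum]; simp

theorem img_injective {A : Matrix (Fin n) (Fin d) ℝ} (hA : (Aᵀ * A).PosDef) :
    Function.Injective (img A) := by
  rw [injective_iff_map_eq_zero]
  intro x hx
  by_contra hne
  have hx0 : x.ofLp ≠ 0 := fun h => hne (by ext j; exact congrFun h j)
  have h2 := hA.dotProduct_mulVec_pos hx0
  have h3 := inner_gram A x x
  rw [hx, inner_zero_left, inner_eq_sum] at h3
  have : star x.ofLp ⬝ᵥ (Aᵀ * A) *ᵥ x.ofLp
      = ∑ k, (toEuclideanCLM (𝕜 := ℝ) (Aᵀ * A) x) k * x k := by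
    rw [dotProduct]
    exact Finset.sum_congr rfl fun k _ => by rw [mul_comm]; rfl
  rw [this, h3] at h2
  exact lt_irrefl _ h2

/-- A continuous endomorphism of `ℝ^d` that is injective is inverted by its `inverse`. -/
theorem apply_inverse_of_injective {M : Op d} (hM : Function.Injective M) (g : Vec d) :
    M (M.inverse g) = g := by
  let e : Vec d ≃L[ℝ] Vec d :=
    (LinearEquiv.ofInjectiveEndo (M : Vec d →ₗ[ℝ] Vec d) hM).toContinuousLinearEquiv
  have he : (e : Vec d →L[ℝ] Vec d) = M := by ext x; rfl
  rw [← he, ContinuousLinearMap.inverse_equiv]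
  exact e.apply_symm_apply g

theorem weightedGram_injective {A : Matrix (Fin n) (Fin d) ℝ} (hA : (Aᵀ * A).PosDef)
    {w : Fin n → ℝ} (hw : ∀ k, 0 < w k) : Function.Injective (weightedGram A w) := by
  rw [injective_iff_map_eq_zero]
  intro x hx
  have h1 := inner_weightedGram A w x x
  rw [hx, inner_zero_left] at h1
  have h2 : ∀ k ∈ Finset.univ, w k * img A x k * img A x k = 0 :=
    (Finset.sum_eq_zero_iff_of_nonneg fun k _ => by
      rw [mul_assoc]; exact mul_nonneg (hw k).le (mul_self_nonneg _)).1 h1.symm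
  have h3 : img A x = 0 := by
    ext k
    have := h2 k (Finset.mem_univ k)
    have hk := (hw k).ne'
    simpa [hk] using this
  exact img_injective hA (by simpa using h3)

/-- The weak form of a linear system with matrix `Aᵀ diag(w) A`. -/
theorem inner_linSolve {A : Matrix (Fin n) (Fin d) ℝ} (hA : (Aᵀ * A).PosDef)
    {w : Fin n → ℝ} (hw : ∀ k, 0 < w k) (g z : Vec d) :
    ∑ k, w k * img A ((weightedGram A w).inverse g) k * img A z k = inner ℝ g z := by
  rw [← inner_weightedGram, apply_inverse_of_injective (weightedGram_injective hA hw)]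

section normB

variable (A : Matrix (Fin n) (Fin d) ℝ) (b : Fin n → ℝ) (c : Fin d → ℝ)

theorem normB_eq (v : Vec d) : (regressionInstance A b c).normB v = ‖img A v‖ := by
  change √(inner ℝ v (toEuclideanCLM (𝕜 := ℝ) (Aᵀ * A) v)) = _
  rw [real_inner_comm, inner_gram, real_inner_self_eq_norm_sq, Real.sqrt_sq (norm_nonneg _)]

variable {A}

theorem inner_img_gramInv (hA : (Aᵀ * A).PosDef) (g z : Vec d) :
    inner ℝ (img A ((regressionInstance A b c).B.inverse g)) (img A z) = inner ℝ g z := by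
  have := inner_linSolve hA (w := fun _ => 1) (fun _ => one_pos) g z
  rw [weightedGram_one] at this
  rw [← this, inner_eq_sum]
  simp [regressionInstance]

theorem normBinv_eq (hA : (Aᵀ * A).PosDef) (g : Vec d) :
    (regressionInstance A b c).normBinv g
      = ‖img A ((regressionInstance A b c).B.inverse g)‖ := by
  unfold Instance.normBinv
  rw [← inner_img_gramInv b c hA, real_inner_self_eq_norm_sq, Real.sqrt_sq (norm_nonneg _)]

theorem abs_inner_le_normBinv (hA : (Aᵀ * A).PosDef) (g z : Vec d) :
    |inner ℝ g z| ≤ (regressionInstance A b c).normBinv g * ‖img A z‖ := by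
  rw [← inner_img_gramInv b c hA, normBinv_eq b c hA]
  exact abs_real_inner_le_norm _ _

/-- Testing at `z = B⁻¹ g` turns the left side into the square of the dual norm. It converts weak
estimates, valid against every `z`, into bounds on `‖g‖_{B⁻¹}`. -/
theorem normBinv_le (hA : (Aᵀ * A).PosDef) {g : Vec d} {C : ℝ} (hC : 0 ≤ C)
    (h : ∀ z, inner ℝ g z ≤ C * ‖img A z‖) : (regressionInstance A b c).normBinv g ≤ C := by
  have h1 := h ((regressionInstance A b c).B.inverse g)
  rw [← inner_img_gramInv b c hA, real_inner_self_eq_norm_sq, ← normBinv_eq b c hA, sq] at h1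
  by_contra hlt
  push Not at hlt
  have : 0 < (regressionInstance A b c).normBinv g := lt_of_le_of_lt hC hlt
  exact absurd (le_of_mul_le_mul_right h1 this) (not_le.2 hlt)

end normB

/-! ### Elementary inequalities for sums -/

theorem sq_apply_le_norm_sq (u : Vec n) (k : Fin n) : u k ^ 2 ≤ ‖u‖ ^ 2 := by
  rw [norm_sq_eq_sum]
  exact Finset.single_le_sum (f := fun k => u k ^ 2) (fun i _ => sq_nonneg _) (Finset.mem_univ k)

theorem sum_sq_mul_sq_le (u w : Vec n) : ∑ k, u k ^ 2 * w k ^ 2 ≤ ‖u‖ ^ 2 * ‖w‖ ^ 2 := by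
  rw [norm_sq_eq_sum w, Finset.mul_sum]
  exact Finset.sum_le_sum fun k _ =>
    mul_le_mul_of_nonneg_right (sq_apply_le_norm_sq u k) (sq_nonneg _)

/-- Cauchy–Schwarz for a weighted form with a bounded quadratic form. -/
theorem sum_mul_abs_le {q : Fin n → ℝ} (hq : ∀ k, 0 ≤ q k) {C : ℝ} (hC : 0 ≤ C) {u w : Vec n}
    (hu : ∑ k, q k * u k ^ 2 ≤ C * ‖u‖ ^ 2) (hw : ∑ k, q k * w k ^ 2 ≤ C * ‖w‖ ^ 2) :
    ∑ k, q k * (|u k| * |w k|) ≤ C * ‖u‖ * ‖w‖ := by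
  refine abs_le_of_sq_le_sq' ?_ (by positivity) |>.2
  have h1 := Finset.sum_mul_sq_le_sq_mul_sq Finset.univ
    (fun k => √(q k) * |u k|) (fun k => √(q k) * |w k|)
  have e1 : ∀ k, √(q k) * |u k| * (√(q k) * |w k|) = q k * (|u k| * |w k|) := fun k => by
    have := Real.mul_self_sqrt (hq k)
    linear_combination |u k| * |w k| * this
  have e2 : ∀ v : Vec n, ∀ k, (√(q k) * |v k|) ^ 2 = q k * v k ^ 2 := fun v k => by
    rw [mul_pow, Real.sq_sqrt (hq k), sq_abs]
  simp only [e1, e2] at h1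
  calc _ ≤ _ := h1
    _ ≤ (C * ‖u‖ ^ 2) * (C * ‖w‖ ^ 2) :=
        mul_le_mul hu hw (Finset.sum_nonneg fun k _ => mul_nonneg (hq k) (sq_nonneg _))
          (by positivity)
    _ = _ := by ring

theorem sum_sq_mul_abs_le (v u w : Vec n) :
    ∑ k, v k ^ 2 * (|u k| * |w k|) ≤ ‖v‖ ^ 2 * ‖u‖ * ‖w‖ :=
  sum_mul_abs_le (fun _ => sq_nonneg _) (sq_nonneg _) (sum_sq_mul_sq_le v u)
    (sum_sq_mul_sq_le v w)

theorem sum_pow_four_le (u : Vec n) : ∑ k, u k ^ 4 ≤ ‖u‖ ^ 4 := by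
  have := sum_sq_mul_sq_le u u
  calc ∑ k, u k ^ 4 = ∑ k, u k ^ 2 * u k ^ 2 := by congr 1; ext k; ring
    _ ≤ _ := this
    _ = _ := by ring

/-- Cauchy–Schwarz over the `n` coordinates. This comparison of the Euclidean and fourth power norms
is where the dimension `n` enters the analysis, and so the source of `n^{1/5}`. -/
theorem norm_pow_four_le (u : Vec n) : ‖u‖ ^ 4 ≤ n * ∑ k, u k ^ 4 := by
  have h := sq_sum_le_card_mul_sum_sq (s := Finset.univ) (f := fun k => u k ^ 2)
  rw [← norm_sq_eq_sum] at h
  calc ‖u‖ ^ 4 = (‖u‖ ^ 2) ^ 2 := by ring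
    _ ≤ _ := h
    _ = _ := by simp only [Finset.card_univ, Fintype.card_fin, ← pow_mul]

theorem abs_sum_pow_three_mul_le (u w : Vec n) : |∑ k, u k ^ 3 * w k| ≤ ‖u‖ ^ 3 * ‖w‖ := by
  refine (Finset.abs_sum_le_sum_abs _ _).trans ?_
  calc ∑ k, |u k ^ 3 * w k| = ∑ k, u k ^ 2 * (|u k| * |w k|) := by
        congr 1; ext k; rw [abs_mul, abs_pow, ← sq_abs (u k)]; ring
    _ ≤ _ := sum_sq_mul_abs_le u u w
    _ = _ := by ring

end

section

/-! ### The model in the coordinates `u = A h` -/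

variable {n d : ℕ}

/-- `D` in the coordinate `u`, where `r` is the residual at the centre. -/
def auxD (r u : Vec n) : ℝ := ∑ k, 6 * r k ^ 2 * u k ^ 2 + 6 * ‖u‖ ^ 4

/-- The directional derivative of `auxD`. -/
def auxD' (r u w : Vec n) : ℝ :=
  ∑ k, 12 * r k ^ 2 * u k * w k + 24 * ‖u‖ ^ 2 * inner ℝ u w

/-- The cubic term of the model. -/
def auxC (r u : Vec n) : ℝ := ∑ k, 4 * r k * u k ^ 3

/-- The directional derivative of `auxC`. -/
def auxC' (r u w : Vec n) : ℝ := ∑ k, 12 * r k * u k ^ 2 * w k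

/-- The Bregman divergence of `auxD`. -/
def bregD (r v u : Vec n) : ℝ := auxD r v - auxD r u - auxD' r u (v - u)

theorem auxD'_add (r u w z : Vec n) : auxD' r u (w + z) = auxD' r u w + auxD' r u z := by
  simp only [auxD', PiLp.add_apply, mul_add, Finset.sum_add_distrib, inner_add_right]; ring

theorem auxD'_neg (r u w : Vec n) : auxD' r u (-w) = -auxD' r u w := by
  simp only [auxD', PiLp.neg_apply, mul_neg, Finset.sum_neg_distrib, inner_neg_right]; ring

theorem auxC'_add (r u w z : Vec n) : auxC' r u (w + z) = auxC' r u w + auxC' r u z := by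
  simp only [auxC', PiLp.add_apply, mul_add, Finset.sum_add_distrib]

theorem norm_add_pow_four (u w : Vec n) :
    ‖u + w‖ ^ 4 = ‖u‖ ^ 4 + 4 * ‖u‖ ^ 2 * inner ℝ u w
      + (2 * ‖u‖ ^ 2 * ‖w‖ ^ 2 + 4 * inner ℝ u w ^ 2 + 4 * inner ℝ u w * ‖w‖ ^ 2 + ‖w‖ ^ 4) := by
  have h := norm_add_sq_real u w
  calc ‖u + w‖ ^ 4 = (‖u + w‖ ^ 2) ^ 2 := by ring
    _ = _ := by rw [h]; ring

theorem bregD_add (r u w : Vec n) :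
    bregD r (u + w) u = ∑ k, 6 * r k ^ 2 * w k ^ 2
      + 6 * (2 * ‖u‖ ^ 2 * ‖w‖ ^ 2 + 4 * inner ℝ u w ^ 2 + 4 * inner ℝ u w * ‖w‖ ^ 2
        + ‖w‖ ^ 4) := by
  have h : ∑ k, 6 * r k ^ 2 * (u + w) k ^ 2 = ∑ k, 6 * r k ^ 2 * u k ^ 2
      + ∑ k, 12 * r k ^ 2 * u k * w k + ∑ k, 6 * r k ^ 2 * w k ^ 2 := by
    rw [← Finset.sum_add_distrib, ← Finset.sum_add_distrib]
    refine Finset.sum_congr rfl fun k _ => ?_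
    rw [PiLp.add_apply]; ring
  rw [bregD, auxD, auxD, auxD', h, norm_add_pow_four, add_sub_cancel_left]
  ring

theorem inner_sq_le (u w : Vec n) : inner ℝ u w ^ 2 ≤ ‖u‖ ^ 2 * ‖w‖ ^ 2 := by
  rw [← mul_pow, ← sq_abs]
  exact pow_le_pow_left₀ (abs_nonneg _) (abs_real_inner_le_norm u w) 2

/-- With `p = ⟨u, w⟩` and `W = ‖w‖²`, Cauchy–Schwarz replaces `12 ‖u‖² W` by `12 p²`, and `36 p² +
24 p W + 6 W² = 4 (3p + W)² + 2 W²`. -/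
theorem two_mul_norm_pow_four_le_bregD (r u w : Vec n) :
    2 * ‖w‖ ^ 4 ≤ bregD r (u + w) u := by
  rw [bregD_add]
  have h0 : 0 ≤ ∑ k, 6 * r k ^ 2 * w k ^ 2 := Finset.sum_nonneg fun k _ => by positivity
  nlinarith [inner_sq_le u w, sq_nonneg (3 * inner ℝ u w + ‖w‖ ^ 2)]

/-- This makes the model smooth and strongly convex relative to `D`. Each coordinate of the cubic
remainder is split by the arithmetic-geometric mean inequality into `r² w²`, which the Hessian part
of `D` absorbs, and terms free of `r`, which the quartic part absorbs. -/
theorem abs_bregC_le {s : ℝ} (hs0 : 0 < s) (hs : 2 * s ^ 2 = 1) (r u w : Vec n) :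
    |auxC r (u + w) - auxC r u - auxC' r u w| ≤ s * bregD r (u + w) u := by
  have e : auxC r (u + w) - auxC r u - auxC' r u w
      = ∑ k, 4 * r k * w k ^ 2 * (3 * u k + w k) := by
    simp only [auxC, auxC', ← Finset.sum_sub_distrib, PiLp.add_apply]
    exact Finset.sum_congr rfl fun k _ => by ring
  have h1 : ∀ k, |4 * r k * w k ^ 2 * (3 * u k + w k)|
      ≤ s * (6 * r k ^ 2 * w k ^ 2) + s * (4 * (u k ^ 2 * w k ^ 2))
        + s * (8 * ((u + (1 / 2 : ℝ) • w) k ^ 2 * w k ^ 2)) := by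
    intro k
    have hk : (u + (1 / 2 : ℝ) • w) k = u k + w k / 2 := by simp; ring
    rw [hk]
    set a := r k
    set p := u k
    set q := w k
    have a1 : |4 * a * q ^ 2 * (3 * p + q)|
        ≤ q ^ 2 * (4 * |a| * |p|) + q ^ 2 * (8 * |a| * |p + q / 2|) := by
      have : 4 * a * q ^ 2 * (3 * p + q) = q ^ 2 * (4 * a * p) + q ^ 2 * (8 * a * (p + q / 2)) := by
        ring
      rw [this]
      refine (abs_add_le _ _).trans (le_of_eq ?_)
      simp [abs_mul]
    -- The weights in `a2` and `a3` make the coefficients of `a²` add up to `6 s`, exactly the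
    -- Hessian part of `bregD`; `2 s² = 1` turns both differences into squares.
    have a2 : 4 * |a| * |p| ≤ s * (2 * a ^ 2 + 4 * p ^ 2) := by
      have : s * (2 * a ^ 2 + 4 * p ^ 2) - 4 * |a| * |p|
          = 2 * s * (|a| - 2 * s * |p|) ^ 2 := by
        rw [← sq_abs a, ← sq_abs p]; linear_combination (4 * |a| * |p| - 4 * s * |p| ^ 2) * hs
      nlinarith [mul_nonneg hs0.le (sq_nonneg (|a| - 2 * s * |p|))]
    have a3 : 8 * |a| * |p + q / 2| ≤ s * (4 * a ^ 2 + 8 * (p + q / 2) ^ 2) := by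
      have : s * (4 * a ^ 2 + 8 * (p + q / 2) ^ 2) - 8 * |a| * |p + q / 2|
          = 4 * s * (|a| - 2 * s * |p + q / 2|) ^ 2 := by
        rw [← sq_abs a, ← sq_abs (p + q / 2)]
        linear_combination (8 * |a| * |p + q / 2| - 8 * s * |p + q / 2| ^ 2) * hs
      nlinarith [mul_nonneg hs0.le (sq_nonneg (|a| - 2 * s * |p + q / 2|))]
    have := mul_le_mul_of_nonneg_left a2 (sq_nonneg q)
    have := mul_le_mul_of_nonneg_left a3 (sq_nonneg q)
    linarith
  have h2 := sum_sq_mul_sq_le u w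
  have h3 := sum_sq_mul_sq_le (u + (1 / 2 : ℝ) • w) w
  have h4 : ‖u + (1 / 2 : ℝ) • w‖ ^ 2 = ‖u‖ ^ 2 + inner ℝ u w + ‖w‖ ^ 2 / 4 := by
    rw [norm_add_sq_real, inner_smul_right, norm_smul, Real.norm_of_nonneg (by norm_num)]; ring
  rw [e, bregD_add]
  calc _ ≤ ∑ k, |4 * r k * w k ^ 2 * (3 * u k + w k)| := Finset.abs_sum_le_sum_abs _ _
    _ ≤ _ := Finset.sum_le_sum fun k _ => h1 k
    _ = s * (∑ k, 6 * r k ^ 2 * w k ^ 2 + 4 * ∑ k, u k ^ 2 * w k ^ 2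
        + 8 * ∑ k, (u + (1 / 2 : ℝ) • w) k ^ 2 * w k ^ 2) := by
      simp only [Finset.sum_add_distrib, Finset.mul_sum, mul_add]
    _ ≤ _ := by
      refine mul_le_mul_of_nonneg_left ?_ hs0.le
      rw [h4] at h3
      nlinarith [sq_nonneg (3 * inner ℝ u w + ‖w‖ ^ 2), sq_nonneg (inner ℝ u w)]

/-- Bound for the difference of the derivatives of the model at two points. -/
theorem abs_auxD'_add_auxC'_sub_le {r : Vec n} {κ : ℝ} (hκ : 0 ≤ κ)
    {u v w : Vec n} (hu : ∑ k, 12 * r k ^ 2 * (u - v) k ^ 2 ≤ κ * ‖u - v‖ ^ 2)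
    (hw : ∑ k, 12 * r k ^ 2 * w k ^ 2 ≤ κ * ‖w‖ ^ 2) :
    |auxD' r u w + auxC' r u w - (auxD' r v w + auxC' r v w)|
      ≤ (2 * κ + 36 * (‖u‖ + ‖v‖) ^ 2) * ‖u - v‖ * ‖w‖ := by
  have e : auxD' r u w + auxC' r u w - (auxD' r v w + auxC' r v w)
      = ∑ k, (12 * r k ^ 2 * (u - v) k * w k + 12 * r k * (u + v) k * (u - v) k * w k)
        + 24 * (‖u‖ ^ 2 * inner ℝ (u - v) w + (‖u‖ ^ 2 - ‖v‖ ^ 2) * inner ℝ v w) := by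
    have : ∑ k, (12 * r k ^ 2 * (u - v) k * w k + 12 * r k * (u + v) k * (u - v) k * w k)
        = ∑ k, 12 * r k ^ 2 * u k * w k + ∑ k, 12 * r k * u k ^ 2 * w k
          - (∑ k, 12 * r k ^ 2 * v k * w k + ∑ k, 12 * r k * v k ^ 2 * w k) := by
      rw [← Finset.sum_add_distrib, ← Finset.sum_add_distrib, ← Finset.sum_sub_distrib]
      exact Finset.sum_congr rfl fun k _ => by simp only [PiLp.sub_apply, PiLp.add_apply]; ring
    rw [this]
    simp only [auxD', auxC', inner_sub_left]
    ring
  have h1 : |∑ k, (12 * r k ^ 2 * (u - v) k * w k + 12 * r k * (u + v) k * (u - v) k * w k)|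
      ≤ 2 * (κ * ‖u - v‖ * ‖w‖) + 3 * (‖u + v‖ ^ 2 * ‖u - v‖ * ‖w‖) := by
    have a := sum_mul_abs_le (q := fun k => 12 * r k ^ 2) (fun k => by positivity) hκ hu hw
    have b := sum_sq_mul_abs_le (u + v) (u - v) w
    calc _ ≤ ∑ k, |12 * r k ^ 2 * (u - v) k * w k + 12 * r k * (u + v) k * (u - v) k * w k| :=
          Finset.abs_sum_le_sum_abs _ _
      _ ≤ ∑ k, (2 * (12 * r k ^ 2 * (|(u - v) k| * |w k|))
            + 3 * ((u + v) k ^ 2 * (|(u - v) k| * |w k|))) := by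
          refine Finset.sum_le_sum fun k _ => ?_
          rw [← add_mul, ← add_mul, mul_assoc, abs_mul, abs_mul]
          have : |12 * r k ^ 2 + 12 * r k * (u + v) k| ≤ 24 * r k ^ 2 + 3 * (u + v) k ^ 2 := by
            rw [abs_le]
            constructor <;>
              nlinarith [sq_nonneg (2 * r k + (u + v) k), sq_nonneg (2 * r k - (u + v) k),
                sq_nonneg (r k)]
          have := mul_le_mul_of_nonneg_right this
            (mul_nonneg (abs_nonneg ((u - v) k)) (abs_nonneg (w k)))
          linarith
      _ ≤ _ := by
          rw [Finset.sum_add_distrib, ← Finset.mul_sum, ← Finset.mul_sum]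
          linarith
  have h2 := abs_real_inner_le_norm (u - v) w
  have h3 := abs_real_inner_le_norm v w
  have h4 : |‖u‖ ^ 2 - ‖v‖ ^ 2| ≤ (‖u‖ + ‖v‖) * ‖u - v‖ := by
    have : ‖u‖ ^ 2 - ‖v‖ ^ 2 = (‖u‖ + ‖v‖) * (‖u‖ - ‖v‖) := by ring
    rw [this, abs_mul, abs_of_nonneg (by positivity : 0 ≤ ‖u‖ + ‖v‖)]
    exact mul_le_mul_of_nonneg_left (abs_norm_sub_norm_le u v) (by positivity)
  have h5 : |24 * (‖u‖ ^ 2 * inner ℝ (u - v) w + (‖u‖ ^ 2 - ‖v‖ ^ 2) * inner ℝ v w)|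
      ≤ 24 * (‖u‖ ^ 2 * (‖u - v‖ * ‖w‖) + ((‖u‖ + ‖v‖) * ‖u - v‖) * (‖v‖ * ‖w‖)) := by
    rw [abs_mul, abs_of_pos (by norm_num : (0 : ℝ) < 24)]
    refine mul_le_mul_of_nonneg_left ((abs_add_le _ _).trans (add_le_add ?_ ?_)) (by norm_num)
    · rw [abs_mul, abs_of_nonneg (sq_nonneg ‖u‖)]
      exact mul_le_mul_of_nonneg_left h2 (sq_nonneg _)
    · rw [abs_mul]
      exact mul_le_mul h4 h3 (abs_nonneg _) (by positivity)
  have h6 : ‖u + v‖ ^ 2 ≤ (‖u‖ + ‖v‖) ^ 2 :=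
    pow_le_pow_left₀ (norm_nonneg _) (norm_add_le u v) 2
  have h7 : 0 ≤ ‖u - v‖ * ‖w‖ := by positivity
  have h8 := mul_le_mul_of_nonneg_right h6 h7
  have h9 : 0 ≤ ‖u‖ * ‖v‖ * (‖u - v‖ * ‖w‖) := by positivity
  have h10 : 0 ≤ ‖v‖ ^ 2 * (‖u - v‖ * ‖w‖) := by positivity
  have h11 : 0 ≤ ‖u‖ ^ 2 * (‖u - v‖ * ‖w‖) := by positivity
  rw [e]
  refine (abs_add_le _ _).trans ?_
  nlinarith [h1, h5, h8, h9, h10, h11]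

/-- Here `u` is the current iterate, `v` the computed next one and `z` the minimizer; `lv`, `lz` are
the linear parts of the model at `v`, `z`. In the three-point identity for `D`, relative smoothness
bounds the model at `v` at the cost of one divergence of `v` from `u`, which cancels after division
by `1 + s`. Relative strong convexity at `z` leaves the contraction, and `θ` measures the failure of
the optimality condition for `v`. -/
theorem bregD_step {s : ℝ} (hs0 : 0 < s) (hs : 2 * s ^ 2 = 1) (r u v z : Vec n) {lv lz θ : ℝ}
    (hmin : lz + auxD r z + auxC r z ≤ lv + auxD r v + auxC r v)
    (hstep : |auxD' r v (z - v) + (1 + s)⁻¹ * (lz - lv + auxD' r u (z - v) + auxC' r u (z - v))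
      - auxD' r u (z - v)| ≤ θ * ‖z - v‖) :
    bregD r z v ≤ 0.83 * bregD r z u + θ * ‖z - v‖ := by
  have hV := abs_bregC_le hs0 hs r u (v - u)
  have hZ := abs_bregC_le hs0 hs r u (z - u)
  have hV0 := two_mul_norm_pow_four_le_bregD r u (v - u)
  have hZ0 := two_mul_norm_pow_four_le_bregD r u (z - u)
  have e1 : z - u = (z - v) + (v - u) := by abel
  simp only [add_sub_cancel] at hV hZ hV0 hZ0
  rw [abs_le] at hV hZ hstep
  set σi := (1 + s)⁻¹ with hσ
  have hσs : σi * (1 + s) = 1 := inv_mul_cancel₀ (by positivity)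
  have hσ0 : 0 < σi := by positivity
  -- The exact factor is `2 s / (1 + s)`, about `0.8284` for `s = 1/√2`.
  have hq : 1 - σi * (1 - s) ≤ 0.83 := by
    have hs1 : s ≤ 0.7072 := by nlinarith
    have : σi * (1 - s) = 2 * σi - 1 := by linear_combination -hσs
    nlinarith
  have hD : auxD' r u (z - u) = auxD' r u (z - v) + auxD' r u (v - u) := by
    rw [e1, auxD'_add]
  have hC : auxC' r u (z - u) = auxC' r u (z - v) + auxC' r u (v - u) := by
    rw [e1, auxC'_add]
  have hZ0' : 0 ≤ bregD r z u := le_trans (by positivity) hZ0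
  have key : σi * (lz - lv + auxD' r u (z - v) + auxC' r u (z - v))
      ≤ σi * (1 + s) * bregD r v u - σi * (1 - s) * bregD r z u := by
    have : lz - lv + auxD' r u (z - v) + auxC' r u (z - v)
        ≤ (1 + s) * bregD r v u - (1 - s) * bregD r z u := by
      have b1 : bregD r z u = auxD r z - auxD r u - auxD' r u (z - u) := rfl
      have b2 : bregD r v u = auxD r v - auxD r u - auxD' r u (v - u) := rfl
      linarith [hV.2, hZ.1]
    calc _ ≤ σi * ((1 + s) * bregD r v u - (1 - s) * bregD r z u) :=
          mul_le_mul_of_nonneg_left this hσ0.le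
      _ = _ := by ring
  have b : bregD r z v = bregD r z u - bregD r v u + auxD' r u (z - v) - auxD' r v (z - v) := by
    unfold bregD; linarith
  rw [hσs] at key
  have := mul_le_mul_of_nonneg_right hq hZ0'
  linarith [hstep.1]

/-- The error `θ ‖z - v‖` is absorbed on the left: `t ≤ 1 + t⁴`, and the divergence dominates `2 ‖z
- v‖⁴`. Dividing by `1 - θ/2 ≥ 0.95` raises the factor `0.83` to at most `0.9`. -/
theorem bregD_step' {s : ℝ} (hs0 : 0 < s) (hs : 2 * s ^ 2 = 1) (r u v z : Vec n) {lv lz θ : ℝ}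
    (hθ0 : 0 ≤ θ) (hθ : θ ≤ 1 / 10)
    (hmin : lz + auxD r z + auxC r z ≤ lv + auxD r v + auxC r v)
    (hstep : |auxD' r v (z - v) + (1 + s)⁻¹ * (lz - lv + auxD' r u (z - v) + auxC' r u (z - v))
      - auxD' r u (z - v)| ≤ θ * ‖z - v‖) :
    bregD r z v ≤ 0.9 * bregD r z u + 2 * θ := by
  have h := bregD_step hs0 hs r u v z hmin hstep
  have h1 := two_mul_norm_pow_four_le_bregD r v (z - v)
  have h2 := two_mul_norm_pow_four_le_bregD r u (z - u)
  simp only [add_sub_cancel] at h1 h2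
  have h2' : 0 ≤ bregD r z u := le_trans (by positivity) h2
  have h1' : 0 ≤ bregD r z v := le_trans (by positivity) h1
  have h3 : ‖z - v‖ ≤ 1 + ‖z - v‖ ^ 4 := by
    nlinarith [sq_nonneg (‖z - v‖ ^ 2 - 1 / 2), sq_nonneg (‖z - v‖ - 1 / 2)]
  have h4 : θ * ‖z - v‖ ≤ θ * (1 + bregD r z v / 2) :=
    mul_le_mul_of_nonneg_left (by linarith) hθ0
  nlinarith

end

section

/-! ### Derivatives of the objective -/

variable {n d : ℕ}

theorem contDiff_gradient {f : Vec d → ℝ} (hf : ContDiff ℝ (⊤ : ℕ∞) f) :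
    ContDiff ℝ (⊤ : ℕ∞) (gradient f) := by
  unfold gradient
  exact (InnerProductSpace.toDual ℝ (Vec d)).symm.contDiff.comp
    (hf.fderiv_right (by simp))

theorem contDiff_hess {f : Vec d → ℝ} (hf : ContDiff ℝ (⊤ : ℕ∞) f) :
    ContDiff ℝ (⊤ : ℕ∞) (hess f) :=
  (contDiff_gradient hf).fderiv_right (by simp)

/-- Gradient, Hessian and third derivative are all identified by pairing with test vectors and
differentiating a one-variable polynomial at `0`; uniqueness of derivatives does the rest. -/
theorem hasDerivAt_line {E F : Type*} [NormedAddCommGroup E] [NormedSpace ℝ E]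
    [NormedAddCommGroup F] [NormedSpace ℝ F] {G : E → F} {x : E} (hG : DifferentiableAt ℝ G x)
    (h : E) : HasDerivAt (fun t : ℝ => G (x + t • h)) (fderiv ℝ G x h) 0 := by
  have h1 : HasDerivAt (fun t : ℝ => x + t • h) h 0 := by
    simpa using ((hasDerivAt_id (0 : ℝ)).smul_const h).const_add x
  have h2 : HasFDerivAt G (fderiv ℝ G x) (x + (0 : ℝ) • h) := by simpa using hG.hasFDerivAt
  exact h2.comp_hasDerivAt (0 : ℝ) h1

theorem hasDerivAt_sum_pow {ι : Type*} [Fintype ι] (a p u : ι → ℝ) (m : ℕ) :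
    HasDerivAt (fun t : ℝ => ∑ k, a k * (p k + t * u k) ^ m)
      (∑ k, a k * (m * p k ^ (m - 1) * u k)) 0 := by
  refine HasDerivAt.fun_sum fun k _ => HasDerivAt.const_mul _ ?_
  have h1 : HasDerivAt (fun t : ℝ => p k + t * u k) (u k) 0 := by
    simpa using ((hasDerivAt_id (0 : ℝ)).mul_const (u k)).const_add (p k)
  simpa using h1.fun_pow m

variable (A : Matrix (Fin n) (Fin d) ℝ) (b : Fin n → ℝ) (c : Fin d → ℝ)

theorem regression_eq (x : Vec d) :
    regression A b c x = ∑ j, c j * x j + ∑ k, res A b x k ^ 4 := by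
  unfold regression
  congr 1
  refine Finset.sum_congr rfl fun k _ => ?_
  rw [res_apply, img_apply, Even.pow_abs (by decide)]

theorem contDiff_regression : ContDiff ℝ (⊤ : ℕ∞) (regression A b c) := by
  have : regression A b c = fun x => ∑ j, c j * x j + ∑ k, res A b x k ^ 4 :=
    funext (regression_eq A b c)
  rw [this]
  have h1 : ∀ k, ContDiff ℝ (⊤ : ℕ∞) fun x : Vec d => res A b x k := fun k =>
    ((EuclideanSpace.proj (𝕜 := ℝ) k).contDiff.comp (img A).contDiff).sub contDiff_const
  have h2 : ∀ j, ContDiff ℝ (⊤ : ℕ∞) fun x : Vec d => x j := fun j =>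
    (EuclideanSpace.proj (𝕜 := ℝ) j).contDiff
  exact (ContDiff.sum fun j _ => contDiff_const.mul (h2 j)).add
    (ContDiff.sum fun k _ => (h1 k).pow 4)

theorem res_add_smul (x h : Vec d) (t : ℝ) (k : Fin n) :
    res A b (x + t • h) k = res A b x k + t * img A h k := by
  rw [res_add]; simp

theorem inner_gradient (x z : Vec d) :
    inner ℝ (gradient (regression A b c) x) z
      = ∑ j, c j * z j + ∑ k, 4 * res A b x k ^ 3 * img A z k := by
  have hd : DifferentiableAt ℝ (regression A b c) x :=
    (contDiff_regression A b c).differentiable (by simp) x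
  have h1 := hasDerivAt_line hd z
  rw [show inner ℝ (gradient (regression A b c) x) z = fderiv ℝ (regression A b c) x z by
    unfold gradient; rw [InnerProductSpace.toDual_symm_apply]]
  refine h1.unique ?_
  have h2 := (hasDerivAt_sum_pow c x z 1).add
    (hasDerivAt_sum_pow (fun _ => 1) (res A b x) (img A z) 4)
  refine (h2.congr_deriv ?_).congr_of_eventuallyEq (Filter.Eventually.of_forall fun t => ?_)
  · simp
  · change regression A b c (x + t • z) = _
    rw [regression_eq]
    simp [res_add_smul]

theorem inner_hess (x h z : Vec d) :
    inner ℝ (hess (regression A b c) x h) z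
      = ∑ k, 12 * res A b x k ^ 2 * img A h k * img A z k := by
  have hd : DifferentiableAt ℝ (gradient (regression A b c)) x :=
    (contDiff_gradient (contDiff_regression A b c)).differentiable (by simp) x
  have h1 := (hasDerivAt_line hd h).inner ℝ (hasDerivAt_const (0 : ℝ) z)
  simp only [inner_zero_right, zero_add] at h1
  refine h1.unique ?_
  have h2 := (hasDerivAt_sum_pow (fun k => 4 * img A z k) (res A b x) (img A h) 3).const_add
    (∑ j, c j * z j)
  refine (h2.congr_deriv ?_).congr_of_eventuallyEq (Filter.Eventually.of_forall fun t => ?_)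
  · refine Finset.sum_congr rfl fun k _ => ?_
    push_cast; ring
  · change inner ℝ (gradient (regression A b c) (x + t • h)) z = _
    rw [inner_gradient]
    congr 1
    refine Finset.sum_congr rfl fun k _ => ?_
    rw [res_add_smul]; ring

theorem hess_eq_weightedGram (x : Vec d) :
    hess (regression A b c) x = weightedGram A fun k => 12 * res A b x k ^ 2 := by
  ext1 h
  refine ext_inner_right ℝ fun z => ?_
  rw [inner_hess, inner_weightedGram]

theorem inner_third (x h y z : Vec d) :
    inner ℝ (third (regression A b c) x h y) z
      = ∑ k, 24 * res A b x k * img A h k * img A y k * img A z k := by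
  have hd : DifferentiableAt ℝ (hess (regression A b c)) x :=
    (contDiff_hess (contDiff_regression A b c)).differentiable (by simp) x
  have h1 := ((hasDerivAt_line hd h).clm_apply (hasDerivAt_const (0 : ℝ) y)).inner ℝ
    (hasDerivAt_const (0 : ℝ) z)
  simp only [inner_zero_right, zero_add, map_zero, add_zero] at h1
  refine h1.unique ?_
  have h2 := hasDerivAt_sum_pow (fun k => 12 * img A y k * img A z k) (res A b x) (img A h) 2
  refine (h2.congr_deriv ?_).congr_of_eventuallyEq (Filter.Eventually.of_forall fun t => ?_)
  · refine Finset.sum_congr rfl fun k _ => ?_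
    push_cast; ring
  · change inner ℝ (hess (regression A b c) (x + t • h) y) z = _
    rw [inner_hess]
    refine Finset.sum_congr rfl fun k _ => ?_
    rw [res_add_smul]; ring

theorem regression_add (x h : Vec d) :
    regression A b c (x + h) = regression A b c x + inner ℝ (gradient (regression A b c) x) h
      + ∑ k, (6 * res A b x k ^ 2 * img A h k ^ 2 + 4 * res A b x k * img A h k ^ 3
        + img A h k ^ 4) := by
  rw [regression_eq, regression_eq, inner_gradient]
  have h1 : ∑ j, c j * (x + h) j = ∑ j, c j * x j + ∑ j, c j * h j := by
    rw [← Finset.sum_add_distrib]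
    exact Finset.sum_congr rfl fun k _ => by simp; ring
  have h2 : ∑ k, res A b (x + h) k ^ 4 = ∑ k, res A b x k ^ 4
      + ∑ k, 4 * res A b x k ^ 3 * img A h k
      + ∑ k, (6 * res A b x k ^ 2 * img A h k ^ 2 + 4 * res A b x k * img A h k ^ 3
        + img A h k ^ 4) := by
    rw [← Finset.sum_add_distrib, ← Finset.sum_add_distrib]
    exact Finset.sum_congr rfl fun k _ => by rw [res_add]; ring
  rw [h1, h2]; ring

/-- Completing the square in each coordinate gives `6r²u² + 4ru³ + u⁴ = u⁴/3 + (2/3)(u(3r + u))²`.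
This is uniform convexity of degree four, with a constant independent of the residual. -/
theorem regression_add_ge (x h : Vec d) :
    regression A b c x + inner ℝ (gradient (regression A b c) x) h
      + 1 / 3 * ∑ k, img A h k ^ 4 ≤ regression A b c (x + h) := by
  rw [regression_add, Finset.mul_sum]
  gcongr with k
  have : 6 * res A b x k ^ 2 * img A h k ^ 2 + 4 * res A b x k * img A h k ^ 3 + img A h k ^ 4
      = 1 / 3 * img A h k ^ 4
        + 2 / 3 * (img A h k * (3 * res A b x k + img A h k)) ^ 2 := by ring
  rw [this]
  exact le_add_of_nonneg_right (by positivity)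

theorem inner_gradient_le (x y : Vec d) :
    regression A b c x + inner ℝ (gradient (regression A b c) x) (y - x)
      ≤ regression A b c y := by
  have h := regression_add_ge A b c x (y - x)
  rw [add_sub_cancel] at h
  have : 0 ≤ ∑ k, img A (y - x) k ^ 4 := Finset.sum_nonneg fun k _ => by positivity
  linarith

theorem convexOn_regression : ConvexOn ℝ Set.univ (regression A b c) := by
  refine ⟨convex_univ, fun x _ y _ s t hs ht hst => ?_⟩
  set z := s • x + t • y
  have h1 := inner_gradient_le A b c z x
  have h2 := inner_gradient_le A b c z y
  have h3 : s * inner ℝ (gradient (regression A b c) z) (x - z)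
      + t * inner ℝ (gradient (regression A b c) z) (y - z) = 0 := by
    rw [← inner_smul_right, ← inner_smul_right, ← inner_add_right]
    have : s • (x - z) + t • (y - z) = 0 := by
      have e : s • (x - z) + t • (y - z) = (s • x + t • y) - (s + t) • z := by
        simp only [smul_sub, add_smul]; abel
      rw [e, hst, one_smul, sub_self]
    rw [this, inner_zero_right]
  have h4 := mul_le_mul_of_nonneg_left h1 hs
  have h5 := mul_le_mul_of_nonneg_left h2 ht
  simp only [smul_eq_mul]
  have h6 : s * regression A b c z + t * regression A b c z = regression A b c z := by
    rw [← add_mul, hst, one_mul]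
  linarith

/-! ### Existence of minimizers -/

variable {A}

theorem exists_norm_le_img (hA : (Aᵀ * A).PosDef) : ∃ C : ℝ, 0 < C ∧ ∀ x, ‖x‖ ≤ C * ‖img A x‖ := by
  have hk : LinearMap.ker (img A : Vec d →ₗ[ℝ] Vec n) = ⊥ :=
    LinearMap.ker_eq_bot.2 (img_injective hA)
  obtain ⟨K, hK, h⟩ := (img A : Vec d →ₗ[ℝ] Vec n).exists_antilipschitzWith hk
  refine ⟨K, by exact_mod_cast hK, fun x => ?_⟩
  simpa using h.le_mul_norm (map_zero _) x

theorem isCompact_img_ball (hA : (Aᵀ * A).PosDef) (x₀ : Vec d) (R : ℝ) :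
    IsCompact {x : Vec d | ‖img A (x - x₀)‖ ≤ R} := by
  obtain ⟨C, hC, h⟩ := exists_norm_le_img hA
  refine Metric.isCompact_of_isClosed_isBounded ?_ ?_
  · exact isClosed_le (by fun_prop) continuous_const
  · refine (Metric.isBounded_closedBall (x := x₀) (r := C * R)).subset fun x hx => ?_
    rw [Metric.mem_closedBall, dist_eq_norm]
    exact (h _).trans (mul_le_mul_of_nonneg_left hx hC.le)

/-- A continuous function with a quartic lower bound in `‖A h‖` has a minimizer. -/
theorem exists_minimizer (hA : (Aᵀ * A).PosDef) {g : Vec d → ℝ} (hg : Continuous g)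
    {x₀ : Vec d} {γ κ : ℝ} (hκ : 0 < κ)
    (h : ∀ x, g x₀ - γ * ‖img A (x - x₀)‖ + κ * ‖img A (x - x₀)‖ ^ 4 ≤ g x) :
    ∃ x, ∀ y, g x ≤ g y := by
  set R := max 1 (γ / κ)
  have hR : 0 < R := lt_of_lt_of_le one_pos (le_max_left _ _)
  obtain ⟨x, hx, hmin⟩ := (isCompact_img_ball hA x₀ R).exists_isMinOn
    ⟨x₀, by simpa using hR.le⟩ hg.continuousOn
  refine ⟨x, fun y => ?_⟩
  by_cases hy : ‖img A (y - x₀)‖ ≤ R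
  · exact hmin hy
  · push Not at hy
    have h0 : g x ≤ g x₀ := hmin (show ‖img A (x₀ - x₀)‖ ≤ R by simpa using hR.le)
    refine h0.trans (le_trans ?_ (h y))
    set t := ‖img A (y - x₀)‖
    have h1 : 1 ≤ t := (le_max_left _ _).trans hy.le
    have h2 : γ ≤ κ * t := by
      have := (le_max_right 1 (γ / κ)).trans hy.le
      rw [div_le_iff₀ hκ] at this
      linarith
    have h3 : t ^ 2 ≤ t ^ 4 := pow_le_pow_right₀ h1 (by norm_num)
    nlinarith [mul_le_mul_of_nonneg_left h3 hκ.le,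
      mul_le_mul_of_nonneg_right h2 (by linarith : 0 ≤ t)]

theorem argmin_le {g : Vec d → ℝ} (h : ∃ x, ∀ y, g x ≤ g y) (y : Vec d) : g (argmin g) ≤ g y :=
  Classical.epsilon_spec (p := fun x => ∀ y, g x ≤ g y) h y

/-- First-order optimality without differentiating the model: along a line through the minimizer its
increment is a quartic in `t`, and the linear coefficient is the directional derivative. -/
theorem eq_zero_of_quartic_nonneg {e₁ e₂ e₃ e₄ : ℝ}
    (h : ∀ t : ℝ, 0 ≤ e₁ * t + e₂ * t ^ 2 + e₃ * t ^ 3 + e₄ * t ^ 4) : e₁ = 0 := by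
  have hd : HasDerivAt (fun t : ℝ => e₁ * t + e₂ * t ^ 2 + e₃ * t ^ 3 + e₄ * t ^ 4) e₁ 0 := by
    have h1 := (hasDerivAt_id (0 : ℝ)).const_mul e₁
    have h2 := ((hasDerivAt_id (0 : ℝ)).pow 2).const_mul e₂
    have h3 := ((hasDerivAt_id (0 : ℝ)).pow 3).const_mul e₃
    have h4 := ((hasDerivAt_id (0 : ℝ)).pow 4).const_mul e₄
    exact (((h1.add h2).add h3).add h4).congr_deriv (by simp)
  refine IsLocalMin.hasDerivAt_eq_zero (Filter.Eventually.of_forall fun t => ?_) hd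
  simpa using h t

theorem regression_xstar_le (hA : (Aᵀ * A).PosDef) (hn : 0 < n) (y : Vec d) :
    regression A b c (regressionInstance A b c).xstar ≤ regression A b c y := by
  refine argmin_le ?_ y
  have hn' : (0 : ℝ) < n := by exact_mod_cast hn
  refine exists_minimizer hA (x₀ := 0)
    (γ := (regressionInstance A b c).normBinv (gradient (regression A b c) 0))
    (κ := 1 / (3 * n)) ((contDiff_regression A b c).continuous) (by positivity) fun x => ?_
  have h1 := regression_add_ge A b c 0 x
  have h2 := abs_inner_le_normBinv b c hA (gradient (regression A b c) 0) x
  have h3 := norm_pow_four_le (img A x)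
  rw [zero_add] at h1
  rw [sub_zero]
  have h4 : 1 / (3 * n) * ‖img A x‖ ^ 4 ≤ 1 / 3 * ∑ k, img A x k ^ 4 := by
    calc _ ≤ 1 / (3 * n) * (n * ∑ k, img A x k ^ 4) :=
          mul_le_mul_of_nonneg_left h3 (by positivity)
      _ = _ := by field_simp
  change regression A b c 0 - _ + _ ≤ regression A b c x
  linarith [neg_le_of_abs_le h2]

theorem gradient_xstar (hA : (Aᵀ * A).PosDef) (hn : 0 < n) :
    gradient (regression A b c) (regressionInstance A b c).xstar = 0 := by
  have h : IsLocalMin (regression A b c) (regressionInstance A b c).xstar :=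
    Filter.Eventually.of_forall fun y => regression_xstar_le b c hA hn y
  unfold gradient
  rw [h.fderiv_eq_zero, map_zero]

/-- Uniform convexity at `x*`, where the gradient vanishes, followed by the norm comparison. It
turns a small gap into a small distance and thus drives the restarts. -/
theorem norm_pow_four_le_gap (hA : (Aᵀ * A).PosDef) (hn : 0 < n) (x : Vec d) :
    ‖img A (x - (regressionInstance A b c).xstar)‖ ^ 4 ≤ 3 * n * (regression A b c x
      - regression A b c (regressionInstance A b c).xstar) := by
  have h1 := regression_add_ge A b c (regressionInstance A b c).xstar
    (x - (regressionInstance A b c).xstar)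
  rw [gradient_xstar b c hA hn, inner_zero_left, add_sub_cancel] at h1
  have h3 := norm_pow_four_le (img A (x - (regressionInstance A b c).xstar))
  have hn' : (0 : ℝ) < n := by exact_mod_cast hn
  nlinarith

end

section

/-! ### The auxiliary problem -/

variable {n d : ℕ} {A : Matrix (Fin n) (Fin d) ℝ} (b : Fin n → ℝ) (c : Fin d → ℝ)

theorem two_mul_inv_sqrt_two_sq : 2 * (1 / √2 : ℝ) ^ 2 = 1 := by
  rw [div_pow, Real.sq_sqrt (by norm_num)]; norm_num

theorem inv_sqrt_two_pos : 0 < (1 / √2 : ℝ) := by positivity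

theorem inv_sqrt_two_le : (1 / √2 : ℝ) ≤ 0.7072 := by
  nlinarith [two_mul_inv_sqrt_two_sq, inv_sqrt_two_pos]

variable (A) in
/-- The model `Γ_y(h) = Ω_y(y + h) - f(y)`. -/
def auxModel (y h : Vec d) : ℝ :=
  inner ℝ (gradient (regression A b c) y) h
    + (auxD (res A b y) (img A h) + auxC (res A b y) (img A h))

variable (A) in
/-- The directional derivative of the model. -/
def auxModel' (y h z : Vec d) : ℝ :=
  inner ℝ (gradient (regression A b c) y) z
    + (auxD' (res A b y) (img A h) (img A z) + auxC' (res A b y) (img A h) (img A z))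

variable (A) in
/-- The minimizer of the model. -/
def auxMin (y : Vec d) : Vec d := argmin (auxModel A b c y)

theorem auxD_nonneg (r u : Vec n) : 0 ≤ auxD r u := by
  have : 0 ≤ ∑ k, 6 * r k ^ 2 * u k ^ 2 := Finset.sum_nonneg fun k _ => by positivity
  unfold auxD; positivity

theorem six_mul_norm_pow_four_le_auxD (r u : Vec n) : 6 * ‖u‖ ^ 4 ≤ auxD r u := by
  have : 0 ≤ ∑ k, 6 * r k ^ 2 * u k ^ 2 := Finset.sum_nonneg fun k _ => by positivity
  unfold auxD; linarith

@[simp] theorem auxD_zero (r : Vec n) : auxD r 0 = 0 := by simp [auxD]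
@[simp] theorem auxC_zero (r : Vec n) : auxC r 0 = 0 := by simp [auxC]
@[simp] theorem auxD'_zero (r w : Vec n) : auxD' r 0 w = 0 := by simp [auxD']
@[simp] theorem auxC'_zero (r w : Vec n) : auxC' r 0 w = 0 := by simp [auxC']

theorem bregD_zero (r u : Vec n) : bregD r u 0 = auxD r u := by simp [bregD]

theorem abs_auxC_le (r u : Vec n) : |auxC r u| ≤ 1 / √2 * auxD r u := by
  have h := abs_bregC_le inv_sqrt_two_pos two_mul_inv_sqrt_two_sq r 0 u
  simpa [bregD_zero] using h

/-- The cubic term costs at most the fraction `1/√2` of `D`, and `1 - 1/√2 > 0.29`. -/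
theorem auxModel_ge (y h : Vec d) :
    inner ℝ (gradient (regression A b c) y) h + 0.29 * auxD (res A b y) (img A h)
      ≤ auxModel A b c y h := by
  have h1 := neg_le_of_abs_le (abs_auxC_le (res A b y) (img A h))
  have h2 := mul_le_mul_of_nonneg_right inv_sqrt_two_le (auxD_nonneg (res A b y) (img A h))
  have h3 := auxD_nonneg (res A b y) (img A h)
  unfold auxModel
  linarith

theorem continuous_auxModel (y : Vec d) : Continuous (auxModel A b c y) := by
  have : ∀ k, Continuous fun h : Vec d => img A h k := fun k =>
    (EuclideanSpace.proj (𝕜 := ℝ) k).continuous.comp (img A).continuous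
  unfold auxModel auxD auxC
  fun_prop

theorem auxModel_auxMin_le (hA : (Aᵀ * A).PosDef) (y h : Vec d) :
    auxModel A b c y (auxMin A b c y) ≤ auxModel A b c y h := by
  refine argmin_le ?_ h
  refine exists_minimizer hA (x₀ := 0)
    (γ := (regressionInstance A b c).normBinv (gradient (regression A b c) y))
    (κ := 1) (continuous_auxModel b c y) one_pos fun h => ?_
  have h0 : auxModel A b c y 0 = 0 := by simp [auxModel]
  have h1 := auxModel_ge (A := A) b c y h
  have h2 := abs_inner_le_normBinv b c hA (gradient (regression A b c) y) h
  have h3 := six_mul_norm_pow_four_le_auxD (res A b y) (img A h)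
  rw [h0, sub_zero]
  have h4 : 0 ≤ ‖img A h‖ ^ 4 := by positivity
  linarith [neg_le_of_abs_le h2]

theorem auxC_add (r u w : Vec n) : auxC r (u + w) = auxC r u + auxC' r u w
    + (∑ k, 12 * r k * u k * w k ^ 2 + ∑ k, 4 * r k * w k ^ 3) := by
  simp only [auxC, auxC', ← Finset.sum_add_distrib, PiLp.add_apply]
  exact Finset.sum_congr rfl fun k _ => by ring

theorem auxD'_smul (r u w : Vec n) (t : ℝ) : auxD' r u (t • w) = t * auxD' r u w := by
  simp only [auxD', inner_smul_right, PiLp.smul_apply, smul_eq_mul, mul_add, Finset.mul_sum]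
  congr 1
  · exact Finset.sum_congr rfl fun k _ => by ring
  · ring

theorem auxC'_smul (r u w : Vec n) (t : ℝ) : auxC' r u (t • w) = t * auxC' r u w := by
  simp only [auxC', PiLp.smul_apply, smul_eq_mul, Finset.mul_sum]
  exact Finset.sum_congr rfl fun k _ => by ring

theorem auxModel'_auxMin (hA : (Aᵀ * A).PosDef) (y z : Vec d) :
    auxModel' A b c y (auxMin A b c y) z = 0 := by
  set h := auxMin A b c y
  set r := res A b y
  set u := img A h
  set w := img A z
  refine eq_zero_of_quartic_nonneg
    (e₂ := ∑ k, 6 * r k ^ 2 * w k ^ 2 + 6 * (2 * ‖u‖ ^ 2 * ‖w‖ ^ 2 + 4 * inner ℝ u w ^ 2)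
      + ∑ k, 12 * r k * u k * w k ^ 2)
    (e₃ := 24 * inner ℝ u w * ‖w‖ ^ 2 + ∑ k, 4 * r k * w k ^ 3) (e₄ := 6 * ‖w‖ ^ 4)
    fun t => ?_
  have h1 := auxModel_auxMin_le b c hA y (h + t • z)
  have h2 := bregD_add r u (t • w)
  rw [bregD, add_sub_cancel_left, auxD'_smul] at h2
  have h3 := auxC_add r u (t • w)
  have e : img A (h + t • z) = u + t • w := by simp [u, w]
  rw [auxC'_smul] at h3
  unfold auxModel at h1
  rw [e, inner_add_right, inner_smul_right] at h1
  have s1 : ∑ k, 6 * r k ^ 2 * (t • w) k ^ 2 = t ^ 2 * ∑ k, 6 * r k ^ 2 * w k ^ 2 := by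
    rw [Finset.mul_sum]; exact Finset.sum_congr rfl fun k _ => by simp; ring
  have s2 : ∑ k, 12 * r k * u k * (t • w) k ^ 2 = t ^ 2 * ∑ k, 12 * r k * u k * w k ^ 2 := by
    rw [Finset.mul_sum]; exact Finset.sum_congr rfl fun k _ => by simp; ring
  have s3 : ∑ k, 4 * r k * (t • w) k ^ 3 = t ^ 3 * ∑ k, 4 * r k * w k ^ 3 := by
    rw [Finset.mul_sum]; exact Finset.sum_congr rfl fun k _ => by simp; ring
  have s4 : ‖t • w‖ ^ 2 = t ^ 2 * ‖w‖ ^ 2 := by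
    rw [norm_smul, mul_pow, Real.norm_eq_abs, sq_abs]
  have s5 : ‖t • w‖ ^ 4 = t ^ 4 * ‖w‖ ^ 4 := by
    calc ‖t • w‖ ^ 4 = (‖t • w‖ ^ 2) ^ 2 := by ring
      _ = _ := by rw [s4]; ring
  rw [s1, s4, s5, inner_smul_right] at h2
  rw [s2, s3] at h3
  unfold auxModel'
  change _ ≤ inner ℝ _ h + t * inner ℝ _ z + (auxD r (u + t • w) + auxC r (u + t • w)) at h1
  nlinarith [h1, h2, h3]

/-- Bregman lower bound for the model. -/
theorem auxModel_breg_ge (y h z : Vec d) :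
    auxModel A b c y h + auxModel' A b c y h (z - h)
      + 0.29 * bregD (res A b y) (img A z) (img A h) ≤ auxModel A b c y z := by
  have h1 := abs_bregC_le inv_sqrt_two_pos two_mul_inv_sqrt_two_sq (res A b y) (img A h)
    (img A (z - h))
  have h2 := two_mul_norm_pow_four_le_bregD (res A b y) (img A h) (img A (z - h))
  have e : img A h + img A (z - h) = img A z := by rw [← map_add, add_sub_cancel]
  rw [e] at h1 h2
  have h3 : 0 ≤ bregD (res A b y) (img A z) (img A h) := le_trans (by positivity) h2
  have h4 := mul_le_mul_of_nonneg_right inv_sqrt_two_le h3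
  have h5 := neg_le_of_abs_le h1
  have h6 : bregD (res A b y) (img A z) (img A h) = auxD (res A b y) (img A z)
    - auxD (res A b y) (img A h) - auxD' (res A b y) (img A h) (img A (z - h)) := by
    rw [bregD, map_sub]
  unfold auxModel auxModel'
  have h7 : inner ℝ (gradient (regression A b c) y) (z - h) =
    inner ℝ (gradient (regression A b c) y) z - inner ℝ (gradient (regression A b c) y) h :=
    inner_sub_right _ _ _
  linarith

/-- Strong convexity is used twice: `auxModel_ge` at the minimizer, and the Bregman lower bound at
the minimizer evaluated at `0`, where the model vanishes. Each contributes `0.29`. -/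
theorem auxD_auxMin_le (hA : (Aᵀ * A).PosDef) (y : Vec d) :
    0.58 * auxD (res A b y) (img A (auxMin A b c y))
      ≤ -inner ℝ (gradient (regression A b c) y) (auxMin A b c y) := by
  set h := auxMin A b c y
  have h1 := auxModel_breg_ge (A := A) b c y h 0
  have h2 := auxModel_ge (A := A) b c y h
  rw [auxModel'_auxMin b c hA] at h1
  have h3 : auxModel A b c y 0 = 0 := by simp [auxModel]
  have h4 : auxD (res A b y) (img A h) ≤ bregD (res A b y) (img A 0) (img A h) := by
    rw [bregD, map_zero, zero_sub, auxD'_neg, auxD_zero]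
    have : auxD' (res A b y) (img A h) (img A h)
        = 2 * ∑ k, 6 * res A b y k ^ 2 * img A h k ^ 2 + 24 * ‖img A h‖ ^ 4 := by
      unfold auxD'
      rw [real_inner_self_eq_norm_sq, Finset.mul_sum]
      congr 1
      · exact Finset.sum_congr rfl fun k _ => by ring
      · ring
    rw [this]
    have h5 : 0 ≤ ∑ k, 6 * res A b y k ^ 2 * img A h k ^ 2 :=
      Finset.sum_nonneg fun k _ => by positivity
    unfold auxD
    have : 0 ≤ ‖img A h‖ ^ 4 := by positivity
    linarith
  linarith

/-- The objective in terms of the model. -/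
theorem regression_add_le_auxModel (y h : Vec d) :
    regression A b c (y + h)
      ≤ regression A b c y + auxModel A b c y h - 5 * ‖img A h‖ ^ 4 := by
  rw [regression_add]
  have h1 := sum_pow_four_le (img A h)
  have h2 : ∑ k, (6 * res A b y k ^ 2 * img A h k ^ 2 + 4 * res A b y k * img A h k ^ 3
      + img A h k ^ 4) = ∑ k, 6 * res A b y k ^ 2 * img A h k ^ 2 + auxC (res A b y) (img A h)
        + ∑ k, img A h k ^ 4 := by
    simp only [auxC, Finset.sum_add_distrib]
  rw [h2]
  unfold auxModel auxD
  linarith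

/-- The gradient of the objective in terms of the derivative of the model. -/
theorem inner_gradient_add (y h z : Vec d) :
    inner ℝ (gradient (regression A b c) (y + h)) z = auxModel' A b c y h z
      - 24 * ‖img A h‖ ^ 2 * inner ℝ (img A h) (img A z) + 4 * ∑ k, img A h k ^ 3 * img A z k := by
  rw [auxModel', inner_gradient, inner_gradient, auxD', auxC', Finset.mul_sum]
  have : ∑ k, 4 * res A b (y + h) k ^ 3 * img A z k = ∑ k, 4 * res A b y k ^ 3 * img A z k
      + ∑ k, 12 * res A b y k ^ 2 * img A h k * img A z k
      + ∑ k, 12 * res A b y k * img A h k ^ 2 * img A z k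
      + ∑ k, 4 * (img A h k ^ 3 * img A z k) := by
    simp only [← Finset.sum_add_distrib]
    exact Finset.sum_congr rfl fun k _ => by rw [res_add]; ring
  rw [this]; ring

/-! ### The one-dimensional dual problem -/

theorem regressionInstance_L : (regressionInstance A b c).L = 24 := rfl
theorem regressionInstance_f : (regressionInstance A b c).f = regression A b c := rfl

theorem dualMatrix_eq (y : Vec d) (t : ℝ) : (regressionInstance A b c).dualMatrix y t
    = weightedGram A fun k => √(2 * 24) * t + 12 * res A b y k ^ 2 := by
  unfold Instance.dualMatrix
  rw [regressionInstance_L, regressionInstance_f, hess_eq_weightedGram]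
  ext1 h
  refine ext_inner_right ℝ fun z => ?_
  rw [inner_weightedGram]
  change inner ℝ ((√(2 * 24) * t) • toEuclideanCLM (𝕜 := ℝ) (Aᵀ * A) h
    + weightedGram A (fun k => 12 * res A b y k ^ 2) h) z = _
  rw [inner_add_left, inner_smul_left, inner_gram, inner_weightedGram, inner_eq_sum,
    Finset.mul_sum, ← Finset.sum_add_distrib]
  refine Finset.sum_congr rfl fun k _ => ?_
  simp; ring

variable (A) in
/-- `A (√(2L) t B + ∇²f(y))⁻¹ g`. -/
def dualImg (y g : Vec d) (t : ℝ) : Vec n :=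
  img A (((regressionInstance A b c).dualMatrix y t).inverse g)

theorem inner_dualImg (hA : (Aᵀ * A).PosDef) (y g z : Vec d) {t : ℝ} (ht : 0 < t) :
    √(2 * 24) * t * inner ℝ (dualImg A b c y g t) (img A z)
      + ∑ k, 12 * res A b y k ^ 2 * dualImg A b c y g t k * img A z k = inner ℝ g z := by
  have h := inner_linSolve hA (w := fun k => √(2 * 24) * t + 12 * res A b y k ^ 2)
    (fun k => by positivity) g z
  rw [← dualMatrix_eq b c] at h
  rw [← h, inner_eq_sum, Finset.mul_sum, ← Finset.sum_add_distrib]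
  refine Finset.sum_congr rfl fun k _ => ?_
  unfold dualImg; ring

/-- Subtracting the weak equations at `t₁` and `t₂` and testing with the difference of the solutions
leaves a nonnegative Hessian term. Hence `t₂ ‖u - v‖ ≤ (t₂ - t₁) ‖u‖`, and the triangle inequality
concludes. The monotonicity converts a short bracket into a small derivative of `w`. -/
theorem mul_norm_dualImg_le (hA : (Aᵀ * A).PosDef) (y g : Vec d) {t₁ t₂ : ℝ} (h₁ : 0 < t₁)
    (h₂ : t₁ ≤ t₂) : t₁ * ‖dualImg A b c y g t₁‖ ≤ t₂ * ‖dualImg A b c y g t₂‖ := by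
  have ht2 : 0 < t₂ := h₁.trans_le h₂
  set z := ((regressionInstance A b c).dualMatrix y t₁).inverse g
    - ((regressionInstance A b c).dualMatrix y t₂).inverse g
  have e1 := inner_dualImg b c hA y g z h₁
  have e2 := inner_dualImg b c hA y g z ht2
  set u := dualImg A b c y g t₁
  set v := dualImg A b c y g t₂
  have hz : img A z = u - v := by simp [z, u, v, dualImg]
  rw [hz] at e1 e2
  have e3 : ∑ k, 12 * res A b y k ^ 2 * u k * (u - v) k
      - ∑ k, 12 * res A b y k ^ 2 * v k * (u - v) k
      = ∑ k, 12 * res A b y k ^ 2 * (u - v) k ^ 2 := by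
    rw [← Finset.sum_sub_distrib]
    exact Finset.sum_congr rfl fun k _ => by simp only [PiLp.sub_apply]; ring
  have e4 : 0 ≤ ∑ k, 12 * res A b y k ^ 2 * (u - v) k ^ 2 :=
    Finset.sum_nonneg fun k _ => by positivity
  have e5 : √(2 * 24) * (t₁ * inner ℝ u (u - v) - t₂ * inner ℝ v (u - v)) ≤ 0 := by linarith
  have e6 : t₁ * inner ℝ u (u - v) - t₂ * inner ℝ v (u - v) ≤ 0 := by
    by_contra hlt
    push Not at hlt
    have : 0 < √(2 * 24 : ℝ) := by positivity
    exact absurd e5 (not_le.2 (mul_pos this hlt))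
  have e7 : t₂ * ‖u - v‖ ^ 2 ≤ (t₂ - t₁) * (‖u‖ * ‖u - v‖) := by
    have i1 : inner ℝ u (u - v) - inner ℝ v (u - v) = ‖u - v‖ ^ 2 := by
      rw [← inner_sub_left, real_inner_self_eq_norm_sq]
    have i2 := real_inner_le_norm u (u - v)
    have i3 := mul_le_mul_of_nonneg_left i2 (sub_nonneg.2 h₂)
    nlinarith
  have e8 : t₂ * ‖u - v‖ ≤ (t₂ - t₁) * ‖u‖ := by
    rcases (norm_nonneg (u - v)).eq_or_lt with h | h
    · rw [← h, mul_zero]; exact mul_nonneg (sub_nonneg.2 h₂) (norm_nonneg _)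
    · refine le_of_mul_le_mul_right ?_ h
      linarith
  have e9 := mul_le_mul_of_nonneg_left (norm_sub_norm_le u v) ht2.le
  linarith

theorem dualSearch_zero (y g : Vec d) (lo hi : ℝ) :
    ((regressionInstance A b c).dualSearch y g 0 lo hi).val = hi := rfl

theorem dualSearch_succ (y g : Vec d) (J : ℕ) (lo hi : ℝ) :
    ((regressionInstance A b c).dualSearch y g (J + 1) lo hi).val
      = if 0 ≤ (lo + hi) / 2 - √(2 * 24) / 2 * ‖dualImg A b c y g ((lo + hi) / 2)‖ ^ 2 then
          ((regressionInstance A b c).dualSearch y g J lo ((lo + hi) / 2)).val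
        else ((regressionInstance A b c).dualSearch y g J ((lo + hi) / 2) hi).val := by
  unfold dualImg
  rw [← normB_eq A b c, ← apply_ite]
  rfl

/-- The bisection keeps `w' ≤ 0` at the lower end and `w' ≥ 0` at the upper end. At `0` no condition
is imposed, because the matrix `∇²f(y)` may be singular there. -/
theorem dualSearch_spec (hA : (Aᵀ * A).PosDef) (y g : Vec d) (J : ℕ) :
    ∀ lo hi : ℝ, 0 ≤ lo → lo < hi → (0 < lo → lo ≤ √(2 * 24) / 2 * ‖dualImg A b c y g lo‖ ^ 2) →
      √(2 * 24) / 2 * ‖dualImg A b c y g hi‖ ^ 2 ≤ hi →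
      0 < ((regressionInstance A b c).dualSearch y g J lo hi).val ∧
      ((regressionInstance A b c).dualSearch y g J lo hi).val ≤ hi ∧
      √(2 * 24) / 2 * ‖dualImg A b c y g ((regressionInstance A b c).dualSearch y g J lo hi).val‖ ^ 2
        ≤ ((regressionInstance A b c).dualSearch y g J lo hi).val ∧
      ((regressionInstance A b c).dualSearch y g J lo hi).val - √(2 * 24) / 2 *
        ‖dualImg A b c y g ((regressionInstance A b c).dualSearch y g J lo hi).val‖ ^ 2
          ≤ 3 * ((hi - lo) / 2 ^ J) := by
  induction J with
  | zero =>
    intro lo hi h0 hlt hlo hhi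
    rw [dualSearch_zero]
    refine ⟨h0.trans_lt hlt, le_rfl, hhi, ?_⟩
    rw [pow_zero, div_one]
    have hh := h0.trans_lt hlt
    have hc : (0 : ℝ) ≤ √(2 * 24) / 2 := by positivity
    rcases h0.eq_or_lt with rfl | hpos
    · nlinarith [mul_nonneg hc (sq_nonneg ‖dualImg A b c y g hi‖)]
    · have h1 := mul_norm_dualImg_le b c hA y g hpos hlt.le
      have h2 := hlo hpos
      have h3 := pow_le_pow_left₀ (by positivity) h1 2
      rw [mul_pow, mul_pow] at h3
      set p := ‖dualImg A b c y g lo‖ ^ 2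
      set q := ‖dualImg A b c y g hi‖ ^ 2
      have h4 := mul_le_mul_of_nonneg_left h3 hc
      -- Writing `γ = √48/2`, the sign at `lo` and the monotonicity give `lo³ ≤ γ lo² p ≤ γ hi² q`.
      -- So `hi² w'(hi) ≤ hi³ - lo³ ≤ 3 hi² (hi - lo)`, with no division by `lo`.
      have h5 : lo ^ 3 ≤ hi ^ 2 * (√(2 * 24) / 2 * q) := by nlinarith [sq_nonneg lo]
      have h6 : hi ^ 2 * (hi - √(2 * 24) / 2 * q) ≤ hi ^ 2 * (3 * (hi - lo)) := by
        have : hi ^ 3 - lo ^ 3 ≤ hi ^ 2 * (3 * (hi - lo)) := by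
          have : hi ^ 3 - lo ^ 3 = (hi - lo) * (hi ^ 2 + hi * lo + lo ^ 2) := by ring
          rw [this]
          have : hi ^ 2 + hi * lo + lo ^ 2 ≤ 3 * hi ^ 2 := by nlinarith
          nlinarith [mul_le_mul_of_nonneg_left this (sub_nonneg.2 hlt.le)]
        linarith
      exact le_of_mul_le_mul_left h6 (by positivity)
  | succ J ih =>
    intro lo hi h0 hlt hlo hhi
    rw [dualSearch_succ]
    set m := (lo + hi) / 2 with hm
    have e1 : (hi - lo) / 2 ^ (J + 1) = (m - lo) / 2 ^ J := by
      rw [hm, pow_succ]; field_simp; ring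
    have e2 : (hi - lo) / 2 ^ (J + 1) = (hi - m) / 2 ^ J := by
      rw [hm, pow_succ]; field_simp; ring
    split_ifs with hif
    · rw [e1]
      have h := ih lo m h0 (by linarith) hlo (by linarith)
      exact ⟨h.1, h.2.1.trans (by linarith), h.2.2⟩
    · rw [e2]
      push Not at hif
      exact ih m hi (by linarith) (by linarith) (fun _ => by linarith) hhi

end

section

variable {n d : ℕ} {A : Matrix (Fin n) (Fin d) ℝ} (b : Fin n → ℝ) (c : Fin d → ℝ)

/-! ### Convergence of `ApproxAuxMin` -/

variable (A) in
/-- The vector `g` of one step of `ApproxAuxMin`. -/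
def auxRhs (y h : Vec d) : Vec d :=
  let f := regression A b c
  let p₀ := gradient f y
  let p₁ := gradient f (y + h)
  let pm := gradient f (y - h)
  let p₂ := gradient f (y + (2 : ℝ) • h)
  let q := (1 / 6 : ℝ) • (p₂ - (3 : ℝ) • p₁ + (3 : ℝ) • p₀ - pm)
  let hessh := (1 / 2 : ℝ) • (p₁ - pm) - q
  let quart := (24 * (regressionInstance A b c).normB h ^ 2) •
    toEuclideanCLM (𝕜 := ℝ) (Aᵀ * A) h
  let ct := p₁ - q + quart
  (1 + 1 / √2)⁻¹ • ct - (hessh + quart)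

variable (A) in
/-- The initial upper end of the bisection. -/
def dualUpper (g : Vec d) : ℝ :=
  1 + inner ℝ g ((regressionInstance A b c).B.inverse g) / √(2 * 24)

variable (A) in
/-- The result of the bisection. -/
def dualPoint (J : ℕ) (y g : Vec d) : ℝ :=
  ((regressionInstance A b c).dualSearch y g J 0 (dualUpper A b c g)).val

theorem auxStep_val (J : ℕ) (y h : Vec d) : ((regressionInstance A b c).auxStep J y h).val
    = -((regressionInstance A b c).dualMatrix y
        (dualPoint A b c J y (auxRhs A b c y h))).inverse (auxRhs A b c y h) := rfl

theorem auxIter_val_zero (J : ℕ) (y : Vec d) :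
    ((regressionInstance A b c).auxIter J y 0).val = 0 := rfl

theorem auxIter_val_succ (J : ℕ) (y : Vec d) (K : ℕ) :
    ((regressionInstance A b c).auxIter J y (K + 1)).val
      = ((regressionInstance A b c).auxStep J y
          ((regressionInstance A b c).auxIter J y K).val).val := rfl

/-- An identity rather than an approximation: gradients are cubic along lines, and the third
difference isolates exactly the term `4 ∑ u³ w` that separates `∇f(y + h)` from the unregularized
model derivative. -/
theorem inner_auxRhs (y h z : Vec d) : inner ℝ (auxRhs A b c y h) z
    = (1 + 1 / √2)⁻¹ * auxModel' A b c y h z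
      - auxD' (res A b y) (img A h) (img A z) := by
  have e1 : ∀ k, res A b (y + h) k = res A b y k + img A h k := fun k => res_add A b y h k
  have e2 : ∀ k, res A b (y - h) k = res A b y k - img A h k := fun k => by
    rw [sub_eq_add_neg, res_add]; simp; ring
  have e3 : ∀ k, res A b (y + (2 : ℝ) • h) k = res A b y k + 2 * img A h k := fun k => by
    rw [res_add_smul]
  set ℓ := ∑ j, c j * z j
  set r := res A b y
  set u := img A h
  set w := img A z
  have g0 := inner_gradient A b c y z
  have g1 := inner_gradient A b c (y + h) z
  have gm := inner_gradient A b c (y - h) z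
  have g2 := inner_gradient A b c (y + (2 : ℝ) • h) z
  have s1 : ∑ k, 4 * res A b (y + h) k ^ 3 * w k = ∑ k, 4 * r k ^ 3 * w k
      + ∑ k, 12 * r k ^ 2 * u k * w k + ∑ k, 12 * r k * u k ^ 2 * w k
      + ∑ k, 4 * u k ^ 3 * w k := by
    simp only [← Finset.sum_add_distrib]
    exact Finset.sum_congr rfl fun k _ => by rw [e1]; ring
  have sm : ∑ k, 4 * res A b (y - h) k ^ 3 * w k = ∑ k, 4 * r k ^ 3 * w k
      - ∑ k, 12 * r k ^ 2 * u k * w k + ∑ k, 12 * r k * u k ^ 2 * w k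
      - ∑ k, 4 * u k ^ 3 * w k := by
    simp only [← Finset.sum_add_distrib, ← Finset.sum_sub_distrib]
    exact Finset.sum_congr rfl fun k _ => by rw [e2]; ring
  have s2 : ∑ k, 4 * res A b (y + (2 : ℝ) • h) k ^ 3 * w k = ∑ k, 4 * r k ^ 3 * w k
      + 2 * ∑ k, 12 * r k ^ 2 * u k * w k + 4 * ∑ k, 12 * r k * u k ^ 2 * w k
      + 8 * ∑ k, 4 * u k ^ 3 * w k := by
    simp only [← Finset.sum_add_distrib, Finset.mul_sum]
    exact Finset.sum_congr rfl fun k _ => by rw [e3]; ring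
  rw [s1] at g1
  rw [sm] at gm
  rw [s2] at g2
  unfold auxModel'
  rw [g0]
  simp only [auxRhs, inner_add_left, inner_sub_left, inner_smul_left, RCLike.conj_to_real,
    g0, g1, gm, g2, inner_gram, normB_eq]
  unfold auxD' auxC'
  ring

theorem dualUpper_eq (hA : (Aᵀ * A).PosDef) (g : Vec d) : dualUpper A b c g
    = 1 + (regressionInstance A b c).normBinv g ^ 2 / √(2 * 24) := by
  unfold dualUpper
  rw [normBinv_eq b c hA, ← inner_img_gramInv b c hA g, real_inner_self_eq_norm_sq]

theorem sqrt_two_mul_bounds : 6.9 ≤ √(2 * 24 : ℝ) ∧ √(2 * 24 : ℝ) ≤ 7 ∧ √(2 * 24 : ℝ) ^ 2 = 48 := by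
  refine ⟨?_, ?_, ?_⟩
  · exact Real.le_sqrt_of_sq_le (by norm_num)
  · exact Real.sqrt_le_iff.2 ⟨by norm_num, by norm_num⟩
  · rw [Real.sq_sqrt (by norm_num)]; norm_num

theorem dualUpper_pos (hA : (Aᵀ * A).PosDef) (g : Vec d) : 0 < dualUpper A b c g := by
  rw [dualUpper_eq b c hA]; positivity

/-- Testing the system with its own solution gives `√48 t ‖v‖ ≤ ‖g‖_{B⁻¹}`. The upper end is chosen
so that `‖g‖_{B⁻¹}² = (t - 1) √48`, which yields `w'(t) ≥ 0` because `t ≥ 1`. -/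
theorem dualUpper_valid (hA : (Aᵀ * A).PosDef) (y g : Vec d) :
    √(2 * 24) / 2 * ‖dualImg A b c y g (dualUpper A b c g)‖ ^ 2 ≤ dualUpper A b c g := by
  set t := dualUpper A b c g with ht
  have ht0 : 0 < t := dualUpper_pos b c hA g
  set γ := (regressionInstance A b c).normBinv g
  have ht1 : t = 1 + γ ^ 2 / √(2 * 24) := dualUpper_eq b c hA g
  obtain ⟨q1, q2, q3⟩ := sqrt_two_mul_bounds
  set q := √(2 * 24 : ℝ)
  have h1 := inner_dualImg b c hA y g (((regressionInstance A b c).dualMatrix y t).inverse g) ht0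
  change q * t * inner ℝ (dualImg A b c y g t) (dualImg A b c y g t) +
    ∑ k, 12 * res A b y k ^ 2 * dualImg A b c y g t k * dualImg A b c y g t k = _ at h1
  have h2 : 0 ≤ ∑ k, 12 * res A b y k ^ 2 * dualImg A b c y g t k * dualImg A b c y g t k :=
    Finset.sum_nonneg fun k _ => by
      rw [mul_assoc _ (dualImg A b c y g t k)]
      exact mul_nonneg (by positivity) (mul_self_nonneg _)
  have h3 := le_of_abs_le (abs_inner_le_normBinv b c hA g
    (((regressionInstance A b c).dualMatrix y t).inverse g))
  change _ ≤ γ * ‖dualImg A b c y g t‖ at h3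
  rw [real_inner_self_eq_norm_sq] at h1
  set v := ‖dualImg A b c y g t‖
  have hv : 0 ≤ v := norm_nonneg _
  have h4 : q * t * v ^ 2 ≤ γ * v := by linarith
  have hγ0 : 0 ≤ γ := Real.sqrt_nonneg _
  have h5 : q * t * v ≤ γ := by
    rcases hv.eq_or_lt with h | h
    · rw [← h]; simpa using hγ0
    · exact le_of_mul_le_mul_right (by linarith) h
  have h6 : (q * t * v) ^ 2 ≤ γ ^ 2 := pow_le_pow_left₀ (by positivity) h5 2
  have h7 : γ ^ 2 = (t - 1) * q := by rw [ht1]; field_simp; ring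
  have h8 : 1 ≤ t := by rw [ht1]; exact le_add_of_nonneg_right (by positivity)
  have h9 : 48 * v ^ 2 ≤ (t - 1) * q := by
    have : 48 * v ^ 2 ≤ (q * t * v) ^ 2 := by
      rw [← q3, mul_pow, mul_pow]
      have : 1 ≤ t ^ 2 := one_le_pow₀ h8
      nlinarith [mul_nonneg (sq_nonneg q) (sq_nonneg v)]
    linarith
  nlinarith

/-- The optimality residual of the computed point is exactly `√48 w'(t) ⟨v, ·⟩` with `v = dualImg A
b c y g t`. The bisection bounds `w'(t)` by `3 Δ / 2^J` with `Δ = 1 + G²`; moreover `‖v‖ ≤ Δ` and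
`√48 ≤ 7`. -/
theorem auxStep_spec (hA : (Aᵀ * A).PosDef) (J : ℕ) (y h z : Vec d) {G : ℝ} (hG : 0 ≤ G)
    (hg : ∀ z, inner ℝ (auxRhs A b c y h) z ≤ G * ‖img A z‖) :
    |auxD' (res A b y) (img A ((regressionInstance A b c).auxStep J y h).val) (img A z)
      + inner ℝ (auxRhs A b c y h) z| ≤ 21 * (1 + G ^ 2) ^ 2 / 2 ^ J * ‖img A z‖ := by
  rw [auxStep_val]
  set g := auxRhs A b c y h
  have hup0 := dualUpper_pos b c hA g
  obtain ⟨t0, t1, t2, t3⟩ := dualSearch_spec b c hA y g J 0 (dualUpper A b c g) le_rfl hup0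
    (fun h => absurd h (lt_irrefl _)) (dualUpper_valid b c hA y g)
  change 0 < dualPoint A b c J y g at t0
  change dualPoint A b c J y g ≤ _ at t1
  change √(2 * 24) / 2 * ‖dualImg A b c y g (dualPoint A b c J y g)‖ ^ 2
    ≤ dualPoint A b c J y g at t2
  change dualPoint A b c J y g - √(2 * 24) / 2 * ‖dualImg A b c y g (dualPoint A b c J y g)‖ ^ 2
    ≤ _ at t3
  have hup : dualUpper A b c g ≤ 1 + G ^ 2 := by
    rw [dualUpper_eq b c hA]
    have h1 := pow_le_pow_left₀ (Real.sqrt_nonneg _) (normBinv_le b c hA hG hg) 2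
    have : (regressionInstance A b c).normBinv g ^ 2 / √(2 * 24)
        ≤ (regressionInstance A b c).normBinv g ^ 2 :=
      div_le_self (sq_nonneg _) (le_trans (by norm_num) sqrt_two_mul_bounds.1)
    change (regressionInstance A b c).normBinv g ^ 2 ≤ G ^ 2 at h1
    linarith
  set t := dualPoint A b c J y g
  have e1 := inner_dualImg b c hA y g z t0
  set v := dualImg A b c y g t with hv
  have e2 : img A (-((regressionInstance A b c).dualMatrix y t).inverse g) = -v := by
    rw [map_neg]; rfl
  obtain ⟨q1, q2, q3⟩ := sqrt_two_mul_bounds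
  set q := √(2 * 24 : ℝ)
  rw [e2, ← e1]
  have e3 : auxD' (res A b y) (-v) (img A z) + (q * t * inner ℝ v (img A z)
      + ∑ k, 12 * res A b y k ^ 2 * v k * img A z k)
      = q * (t - q / 2 * ‖v‖ ^ 2) * inner ℝ v (img A z) := by
    unfold auxD'
    rw [inner_neg_left, norm_neg]
    have : ∑ k, 12 * res A b y k ^ 2 * (-v) k * img A z k
        = -∑ k, 12 * res A b y k ^ 2 * v k * img A z k := by
      rw [← Finset.sum_neg_distrib]
      exact Finset.sum_congr rfl fun k _ => by simp
    rw [this]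
    linear_combination (1 / 2 * ‖v‖ ^ 2 * inner ℝ v (img A z)) * q3
  rw [e3, abs_mul, abs_of_nonneg (mul_nonneg (by linarith) (by linarith))]
  set Δ := 1 + G ^ 2
  have hΔ1 : 1 ≤ Δ := le_add_of_nonneg_right (sq_nonneg G)
  have hvΔ : ‖v‖ ≤ Δ := by
    refine abs_le_of_sq_le_sq' ?_ (by linarith) |>.2
    nlinarith [sq_nonneg ‖v‖]
  have h2J : (0 : ℝ) < 2 ^ J := by positivity
  have k1 : q * (t - q / 2 * ‖v‖ ^ 2) ≤ 21 * (Δ / 2 ^ J) := by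
    have : (dualUpper A b c g - 0) / 2 ^ J ≤ Δ / 2 ^ J := by
      rw [sub_zero]; exact div_le_div_of_nonneg_right hup h2J.le
    calc _ ≤ 7 * (3 * (Δ / 2 ^ J)) := by
          refine mul_le_mul q2 (by linarith) (by linarith) (by norm_num)
      _ = _ := by ring
  calc _ ≤ 21 * (Δ / 2 ^ J) * (‖v‖ * ‖img A z‖) :=
        mul_le_mul k1 (abs_real_inner_le_norm _ _) (abs_nonneg _) (by positivity)
    _ ≤ 21 * (Δ / 2 ^ J) * (Δ * ‖img A z‖) := by gcongr
    _ = _ := by ring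

theorem abs_auxD'_le {r : Vec n} {κ : ℝ} (hκ : 0 ≤ κ)
    {u w : Vec n} (hu : ∑ k, 12 * r k ^ 2 * u k ^ 2 ≤ κ * ‖u‖ ^ 2)
    (hw : ∑ k, 12 * r k ^ 2 * w k ^ 2 ≤ κ * ‖w‖ ^ 2) :
    |auxD' r u w| ≤ (κ * ‖u‖ + 24 * ‖u‖ ^ 3) * ‖w‖ := by
  have a := sum_mul_abs_le (q := fun k => 12 * r k ^ 2) (fun k => by positivity) hκ hu hw
  have h1 : |∑ k, 12 * r k ^ 2 * u k * w k| ≤ κ * ‖u‖ * ‖w‖ := by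
    refine (Finset.abs_sum_le_sum_abs _ _).trans (le_trans (le_of_eq ?_) a)
    refine Finset.sum_congr rfl fun k _ => ?_
    rw [mul_assoc, abs_mul, abs_mul (u k), abs_of_nonneg (by positivity : 0 ≤ 12 * r k ^ 2)]
  have h2 : |24 * ‖u‖ ^ 2 * inner ℝ u w| ≤ 24 * ‖u‖ ^ 2 * (‖u‖ * ‖w‖) := by
    rw [abs_mul, abs_of_nonneg (by positivity)]
    exact mul_le_mul_of_nonneg_left (abs_real_inner_le_norm u w) (by positivity)
  unfold auxD'
  refine (abs_add_le _ _).trans ?_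
  nlinarith

/-- Bounds in terms of `X` on the data of the model at `y`. -/
structure ModelBounds (A : Matrix (Fin n) (Fin d) ℝ) (b : Fin n → ℝ) (c : Fin d → ℝ) (X : ℝ)
    (y : Vec d) : Prop where
  two_le : 2 ≤ X
  hess_le : ∀ h, ∑ k, 12 * res A b y k ^ 2 * img A h k ^ 2 ≤ X ^ 7 * ‖img A h‖ ^ 2
  grad_le : ∀ z, |inner ℝ (gradient (regression A b c) y) z| ≤ X ^ 2 * ‖img A z‖
  auxMin_le : ‖img A (auxMin A b c y)‖ ≤ X

variable {b c}

theorem inner_auxRhs_le {X : ℝ} {y : Vec d} (hy : ModelBounds A b c X y) {h : Vec d}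
    (hh : ‖img A h‖ ≤ 2 * X) (z : Vec d) :
    inner ℝ (auxRhs A b c y h) z ≤ X ^ 14 * ‖img A z‖ := by
  have hX := hy.two_le
  rw [inner_auxRhs]
  have h1 := abs_auxD'_le (by positivity) (hy.hess_le h) (hy.hess_le z)
  have h2 := abs_auxD'_add_auxC'_sub_le (by positivity)
    (by rw [sub_zero]; exact hy.hess_le h) (hy.hess_le z)
  have h3 := hy.grad_le z
  simp only [auxD'_zero, auxC'_zero, add_zero, sub_zero, norm_zero] at h2
  have h4 : |auxModel' A b c y h z| ≤ X ^ 2 * ‖img A z‖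
      + (2 * X ^ 7 + 36 * ‖img A h‖ ^ 2) * ‖img A h‖ * ‖img A z‖ :=
    (abs_add_le _ _).trans (add_le_add h3 h2)
  have h5 : (1 + 1 / √2)⁻¹ * auxModel' A b c y h z ≤ |auxModel' A b c y h z| := by
    refine (le_abs_self _).trans ?_
    rw [abs_mul, abs_of_nonneg (by positivity)]
    refine mul_le_of_le_one_left (abs_nonneg _) (inv_le_one_of_one_le₀ ?_)
    exact le_add_of_nonneg_right (by positivity)
  have h6 := neg_le_of_abs_le h1
  set u := ‖img A h‖
  have hu : 0 ≤ u := norm_nonneg _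
  have hu2 : u ^ 2 ≤ (2 * X) ^ 2 := pow_le_pow_left₀ hu hh 2
  have hX7 : 0 ≤ X ^ 7 := by positivity
  have h7 : (2 * X ^ 7 + 36 * u ^ 2) * u ≤ (2 * X ^ 7 + 36 * (2 * X) ^ 2) * (2 * X) := by gcongr
  have h8 : X ^ 7 * u + 24 * u ^ 3 ≤ X ^ 7 * (2 * X) + 24 * (2 * X) ^ 3 := by gcongr
  have h9 : X ^ 2 + (2 * X ^ 7 + 36 * (2 * X) ^ 2) * (2 * X) + (X ^ 7 * (2 * X) + 24 * (2 * X) ^ 3)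
      ≤ X ^ 14 := by
    have p : ∀ m : ℕ, (0 : ℝ) ≤ X ^ m := fun m => by positivity
    -- The chain `2 X^m ≤ X^{m+1}` lets linear arithmetic trade numerical constants for powers of
    -- `X`; the same device recurs below.
    have q : ∀ m : ℕ, 2 * X ^ m ≤ X * X ^ m := fun m => mul_le_mul_of_nonneg_right hX (p m)
    have e : (2 * X ^ 7 + 36 * (2 * X) ^ 2) * (2 * X) + (X ^ 7 * (2 * X) + 24 * (2 * X) ^ 3)
        = 6 * X ^ 8 + 480 * X ^ 3 := by ring
    linarith [q 2, q 3, q 4, q 5, q 6, q 7, q 8, q 9, q 10, q 11, q 12, q 13, p 2, p 3]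
  have h10 := mul_le_mul_of_nonneg_right h9 (norm_nonneg (img A z))
  have h11 := mul_le_mul_of_nonneg_right h7 (norm_nonneg (img A z))
  have h12 := mul_le_mul_of_nonneg_right h8 (norm_nonneg (img A z))
  linarith

theorem auxD_auxMin_le_pow (hA : (Aᵀ * A).PosDef) {X : ℝ} {y : Vec d}
    (hy : ModelBounds A b c X y) :
    auxD (res A b y) (img A (auxMin A b c y)) ≤ X ^ 4 := by
  have hX := hy.two_le
  have h1 := auxD_auxMin_le b c hA y
  have h2 := neg_le_of_abs_le (hy.grad_le (auxMin A b c y))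
  have h3 := mul_le_mul_of_nonneg_left hy.auxMin_le (by positivity : 0 ≤ X ^ 2)
  have h4 : 0 ≤ X ^ 3 := by positivity
  nlinarith

/-- The value `20 θ` with `θ = X⁶³/2^J` is the fixed point of `x ↦ 0.9 x + 2 θ`. The starting value
is `D` at the minimizer, which is at most `X⁴`. The induction also has to keep the iterates bounded,
since the accuracy of a step depends on the size of its right-hand side. -/
theorem bregD_auxIter_le (hA : (Aᵀ * A).PosDef) {X : ℝ} {y : Vec d}
    (hy : ModelBounds A b c X y) {J : ℕ} (hJ : X ^ 310 ≤ 2 ^ J) (K : ℕ) :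
    bregD (res A b y) (img A (auxMin A b c y))
      (img A ((regressionInstance A b c).auxIter J y K).val)
        ≤ 0.9 ^ K * X ^ 4 + 20 * (X ^ 63 / 2 ^ J) := by
  have hX := hy.two_le
  have hX0 : 0 < X := by linarith
  have hθ : X ^ 63 / 2 ^ J ≤ 1 / 10 := by
    rw [div_le_iff₀ (by positivity)]
    have h1 : X ^ 67 ≤ X ^ 310 := pow_le_pow_right₀ (by linarith) (by norm_num)
    have h2 : X ^ 67 = X ^ 63 * X ^ 4 := by ring
    have h3 : (2 : ℝ) ^ 4 ≤ X ^ 4 := pow_le_pow_left₀ (by norm_num) hX 4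
    have h4 : 0 < X ^ 63 := by positivity
    nlinarith
  set θ := X ^ 63 / 2 ^ J
  have hθ0 : 0 ≤ θ := by positivity
  have hX4 : (16 : ℝ) ≤ X ^ 4 := by
    calc (16 : ℝ) = 2 ^ 4 := by norm_num
      _ ≤ X ^ 4 := pow_le_pow_left₀ (by norm_num) hX 4
  induction K with
  | zero =>
    rw [auxIter_val_zero, map_zero, bregD_zero]
    have := auxD_auxMin_le_pow hA hy
    simp only [pow_zero, one_mul]
    linarith
  | succ K ih =>
    rw [auxIter_val_succ]
    set h := ((regressionInstance A b c).auxIter J y K).val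
    set h' := ((regressionInstance A b c).auxStep J y h).val
    set m := auxMin A b c y
    have hV := two_mul_norm_pow_four_le_bregD (res A b y) (img A h) (img A m - img A h)
    rw [add_sub_cancel] at hV
    have hK1 : (0.9 : ℝ) ^ K ≤ 1 := pow_le_one₀ (by norm_num) (by norm_num)
    -- The induction hypothesis bounds the divergence by `2 X⁴`, and the divergence is at least `2
    -- ‖·‖⁴`.
    have hdist : ‖img A m - img A h‖ ≤ X := by
      by_contra hlt
      push Not at hlt
      have : X ^ 4 < ‖img A m - img A h‖ ^ 4 := pow_lt_pow_left₀ hlt hX0.le (by norm_num)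
      nlinarith
    have hh : ‖img A h‖ ≤ 2 * X := by
      have h1 := norm_sub_norm_le (img A h) (img A m)
      rw [norm_sub_rev] at h1
      linarith [hy.auxMin_le]
    have hs := auxStep_spec b c hA J y h (m - h') (by positivity) (inner_auxRhs_le hy hh)
    have hθ2 : 21 * (1 + (X ^ 14) ^ 2) ^ 2 / 2 ^ J ≤ θ := by
      refine div_le_div_of_nonneg_right ?_ (by positivity)
      have h1 : 1 ≤ X ^ 28 := one_le_pow₀ (by linarith)
      have h2 : (1 + (X ^ 14) ^ 2) ^ 2 ≤ (2 * X ^ 28) ^ 2 := by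
        refine pow_le_pow_left₀ (by positivity) ?_ 2
        rw [← pow_mul]; norm_num; linarith
      have h3 : (2 : ℝ) ^ 7 ≤ X ^ 7 := pow_le_pow_left₀ (by norm_num) hX 7
      have h4 : X ^ 63 = X ^ 56 * X ^ 7 := by ring
      have h5 : (2 * X ^ 28) ^ 2 = 4 * X ^ 56 := by ring
      have h6 : 0 < X ^ 56 := by positivity
      rw [h4]
      nlinarith
    have hmin := auxModel_auxMin_le b c hA y h'
    have hstep := bregD_step' inv_sqrt_two_pos two_mul_inv_sqrt_two_sq (res A b y) (img A h)
      (img A h') (img A m) (lv := inner ℝ (gradient (regression A b c) y) h')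
      (lz := inner ℝ (gradient (regression A b c) y) m) hθ0 hθ
      (by unfold auxModel at hmin; linarith) (by
        rw [inner_auxRhs, map_sub] at hs
        unfold auxModel' at hs
        rw [inner_sub_right] at hs
        refine le_trans (le_of_eq ?_)
          (hs.trans (mul_le_mul_of_nonneg_right hθ2 (norm_nonneg _)))
        congr 1
        rw [map_sub]
        ring)
    rw [pow_succ]
    linarith

/-- The point computed by `ApproxAuxMin` is close to the minimizer of the model. -/
theorem norm_auxIter_sub_le (hA : (Aᵀ * A).PosDef) {X : ℝ} {y : Vec d}
    (hy : ModelBounds A b c X y) {J K : ℕ} (hJ : X ^ 310 ≤ 2 ^ J) (hK : X ^ 250 * 0.9 ^ K ≤ 1) :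
    ‖img A ((regressionInstance A b c).auxIter J y K).val - img A (auxMin A b c y)‖
      ≤ (X ^ 60)⁻¹ := by
  have hX := hy.two_le
  have hX0 : 0 < X := by linarith
  have h1 := bregD_auxIter_le hA hy hJ K
  set u := img A ((regressionInstance A b c).auxIter J y K).val
  set v := img A (auxMin A b c y)
  have h2 := two_mul_norm_pow_four_le_bregD (res A b y) u (v - u)
  rw [add_sub_cancel, norm_sub_rev] at h2
  -- The exponents `250` and `310` are chosen so that both error terms fall below `X⁻²⁴⁰`; the
  -- fourth root in the uniform convexity bound then gives `X⁻⁶⁰`.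
  have h3 : 0.9 ^ K * X ^ 4 ≤ (X ^ 240)⁻¹ := by
    rw [le_inv_comm₀ (by positivity) (by positivity)]
    rw [le_inv_comm₀ (by positivity) (by positivity)]
    rw [← one_div, le_div_iff₀ (by positivity)]
    have : (0.9 : ℝ) ^ K * X ^ 244 ≤ X ^ 250 * 0.9 ^ K := by
      rw [mul_comm]
      exact mul_le_mul_of_nonneg_right (pow_le_pow_right₀ (by linarith) (by norm_num))
        (by positivity)
    calc _ = (0.9 : ℝ) ^ K * X ^ 244 := by ring
      _ ≤ _ := this.trans hK
  have h4 : 20 * (X ^ 63 / 2 ^ J) ≤ (X ^ 240)⁻¹ := by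
    rw [← one_div, le_div_iff₀ (by positivity), mul_div_assoc', div_mul_eq_mul_div,
      div_le_iff₀ (by positivity), one_mul]
    refine le_trans ?_ hJ
    have : (2 : ℝ) ^ 7 ≤ X ^ 7 := pow_le_pow_left₀ (by norm_num) hX 7
    have h303 : 0 < X ^ 303 := by positivity
    calc 20 * X ^ 63 * X ^ 240 = 20 * X ^ 303 := by ring
      _ ≤ X ^ 7 * X ^ 303 := by nlinarith
      _ = X ^ 310 := by ring
  by_contra hlt
  push Not at hlt
  have h5 : ((X ^ 60)⁻¹) ^ 4 < ‖u - v‖ ^ 4 := pow_lt_pow_left₀ hlt (by positivity) (by norm_num)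
  rw [inv_pow, ← pow_mul] at h5
  linarith

end

section

variable {n d : ℕ} {A : Matrix (Fin n) (Fin d) ℝ} {b : Fin n → ℝ} {c : Fin d → ℝ}

/-! ### One accelerated step -/

theorem mem_setL_iff {z x : Vec d} : x ∈ (regressionInstance A b c).setL z
    ↔ regression A b c x ≤ (regressionInstance A b c).maxF z := Iff.rfl

theorem mem_setK_iff {z x : Vec d} : x ∈ (regressionInstance A b c).setK z ↔ ‖img A (x - z)‖
    ≤ 2 * ‖img A (z - (regressionInstance A b c).xstar)‖ := by
  have : x ∈ (regressionInstance A b c).setK z ↔ (regressionInstance A b c).normB (x - z) ^ 2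
    ≤ 4 * (regressionInstance A b c).normB (z - (regressionInstance A b c).xstar) ^ 2 := Iff.rfl
  rw [this, normB_eq, normB_eq,
    show 4 * ‖img A (z - (regressionInstance A b c).xstar)‖ ^ 2
    = (2 * ‖img A (z - (regressionInstance A b c).xstar)‖) ^ 2 by ring]
  exact sq_le_sq₀ (norm_nonneg _) (by positivity)

theorem isCompact_setK (hA : (Aᵀ * A).PosDef) (z : Vec d) :
    IsCompact ((regressionInstance A b c).setK z) := by
  have : (regressionInstance A b c).setK z = {x : Vec d | ‖img A (x - z)‖
      ≤ 2 * ‖img A (z - (regressionInstance A b c).xstar)‖} :=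
    Set.ext fun x => mem_setK_iff
  rw [this]
  exact isCompact_img_ball hA _ _

theorem bddAbove_image_setK (hA : (Aᵀ * A).PosDef) (z : Vec d) :
    BddAbove ((regressionInstance A b c).f '' (regressionInstance A b c).setK z) :=
  (isCompact_setK hA z).bddAbove_image (contDiff_regression A b c).continuous.continuousOn

theorem mem_setL_of_mem_setK (hA : (Aᵀ * A).PosDef) {z x : Vec d}
    (hx : x ∈ (regressionInstance A b c).setK z) : x ∈ (regressionInstance A b c).setL z := by
  exact le_csSup (bddAbove_image_setK hA z) (Set.mem_image_of_mem _ hx)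

/-- Points as close to the minimizer as the starting point belong to the level set. -/
theorem mem_setL_of_norm_le (hA : (Aᵀ * A).PosDef) {z x : Vec d}
    (hx : ‖img A (x - (regressionInstance A b c).xstar)‖
      ≤ ‖img A (z - (regressionInstance A b c).xstar)‖) :
    x ∈ (regressionInstance A b c).setL z := by
  refine mem_setL_of_mem_setK hA (mem_setK_iff.2 ?_)
  have e : x - z = (x - (regressionInstance A b c).xstar)
      - (z - (regressionInstance A b c).xstar) := by abel
  rw [e, map_sub]
  exact (norm_sub_le _ _).trans (by linarith)

theorem convex_setL (z : Vec d) : Convex ℝ ((regressionInstance A b c).setL z) := by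
  have := (convexOn_regression A b c).convex_le ((regressionInstance A b c).maxF z)
  simpa [Instance.setL, regressionInstance_f] using this

/-- Bounds in terms of `X` on the data of the problem on the level set of a starting point. -/
structure RunBounds (A : Matrix (Fin n) (Fin d) ℝ) (b : Fin n → ℝ) (c : Fin d → ℝ) (X : ℝ)
    (z : Vec d) : Prop where
  two_le : 2 ≤ X
  sq_le_parP : ∀ x ∈ (regressionInstance A b c).setL z, ∀ y ∈ (regressionInstance A b c).setL z,
    ‖img A (x - y)‖ ^ 2 ≤ (regressionInstance A b c).parP z
  parP_le : (regressionInstance A b c).parP z ≤ X ^ 2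
  hess_le : ∀ y ∈ (regressionInstance A b c).setL z, ∀ h,
    ∑ k, 12 * res A b y k ^ 2 * img A h k ^ 2 ≤ X ^ 7 * ‖img A h‖ ^ 2
  grad_le : ∀ y ∈ (regressionInstance A b c).setL z, ∀ v,
    |inner ℝ (gradient (regression A b c) y) v| ≤ X ^ 2 * ‖img A v‖

theorem RunBounds.norm_le {X : ℝ} {z : Vec d} (h : RunBounds A b c X z) {x y : Vec d}
    (hx : x ∈ (regressionInstance A b c).setL z) (hy : y ∈ (regressionInstance A b c).setL z) :
    ‖img A (x - y)‖ ≤ X :=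
  abs_le_of_sq_le_sq' ((h.sq_le_parP x hx y hy).trans h.parP_le) (by linarith [h.two_le]) |>.2

theorem auxMin_mem {z y : Vec d} (hA : (Aᵀ * A).PosDef)
    (hy : y ∈ (regressionInstance A b c).setL z) :
    y + auxMin A b c y ∈ (regressionInstance A b c).setL z := by
  rw [mem_setL_iff] at hy ⊢
  refine le_trans ?_ hy
  have h1 := regression_add_le_auxModel (A := A) b c y (auxMin A b c y)
  have h2 := auxModel_auxMin_le b c hA y 0
  have h3 : auxModel A b c y 0 = 0 := by simp [auxModel]
  have h4 : 0 ≤ ‖img A (auxMin A b c y)‖ ^ 4 := by positivity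
  linarith

theorem RunBounds.modelBounds {X : ℝ} {z y : Vec d} (hA : (Aᵀ * A).PosDef)
    (h : RunBounds A b c X z) (hy : y ∈ (regressionInstance A b c).setL z) :
    ModelBounds A b c X y where
  two_le := h.two_le
  hess_le := h.hess_le y hy
  grad_le := h.grad_le y hy
  auxMin_le := by simpa using h.norm_le (auxMin_mem hA hy) hy

/-- The accuracy of the loops inside a run. -/
structure LoopBounds (X : ℝ) (i : Init) : Prop where
  dual : X ^ 310 ≤ 2 ^ i.numDual
  aux : X ^ 250 * 0.9 ^ i.numAux ≤ 1
  rho : X ^ 148 ≤ 2 ^ i.numRho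
  rhoInit : i.rhoInit = (X ^ 10)⁻¹
  epsAam : i.epsAam = (X ^ 72)⁻¹

theorem pow_inv_le {X : ℝ} (hX : 2 ≤ X) {m k : ℕ} (h : m ≤ k) : (X ^ k)⁻¹ ≤ (X ^ m)⁻¹ :=
  inv_anti₀ (by positivity) (pow_le_pow_right₀ (by linarith) h)

theorem mul_pow_inv_le {X : ℝ} (hX : 2 ≤ X) {C : ℝ} (j : ℕ) (hC : C ≤ 2 ^ j) (m : ℕ) :
    C * (X ^ (m + j))⁻¹ ≤ (X ^ m)⁻¹ := by
  have : C ≤ X ^ j := hC.trans (pow_le_pow_left₀ (by norm_num) hX j)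
  rw [pow_add, mul_inv, ← mul_assoc, mul_comm C, mul_assoc]
  refine mul_le_of_le_one_right (by positivity) ?_
  rw [← div_eq_mul_inv]
  exact div_le_one_of_le₀ this (by positivity)

/-! ### The output of `ApproxAuxMin` as an inexact proximal step -/

section approx

variable {X : ℝ} {z y : Vec d} {i : Init} (hA : (Aᵀ * A).PosDef) (h : RunBounds A b c X z)
  (hi : LoopBounds X i) (hy : y ∈ (regressionInstance A b c).setL z)

variable (A b c) in
/-- The increment computed by `ApproxAuxMin`. -/
def auxApprox (i : Init) (y : Vec d) : Vec d :=
  ((regressionInstance A b c).auxIter i.numDual y i.numAux).val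

include hA h hi hy

theorem auxApprox_dist :
    ‖img A (auxApprox A b c i y) - img A (auxMin A b c y)‖ ≤ (X ^ 60)⁻¹ :=
  norm_auxIter_sub_le hA (h.modelBounds hA hy) hi.dual hi.aux

theorem norm_auxApprox_le : ‖img A (auxApprox A b c i y)‖ ≤ 2 * X := by
  have h1 := auxApprox_dist hA h hi hy
  have h2 := norm_sub_norm_le (img A (auxApprox A b c i y)) (img A (auxMin A b c y))
  have h3 := (h.modelBounds hA hy).auxMin_le
  have h4 : (X ^ 60)⁻¹ ≤ 1 := inv_le_one_of_one_le₀ (one_le_pow₀ (by linarith [h.two_le]))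
  linarith [h.two_le]

/-- The derivative of the model vanishes at the exact minimizer and has Lipschitz constant at most
`X¹³` on the relevant ball; the distance to the minimizer is at most `X⁻⁶⁰`. -/
theorem abs_auxModel'_auxApprox_le (v : Vec d) :
    |auxModel' A b c y (auxApprox A b c i y) v| ≤ (X ^ 47)⁻¹ * ‖img A v‖ := by
  have hX := h.two_le
  have hm := h.modelBounds hA hy
  have h1 := auxModel'_auxMin b c hA y v
  have h2 := abs_auxD'_add_auxC'_sub_le (by positivity)
    (u := img A (auxApprox A b c i y)) (v := img A (auxMin A b c y))
    (by rw [← map_sub]; exact hm.hess_le _) (hm.hess_le v)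
  have e : auxModel' A b c y (auxApprox A b c i y) v
      = auxD' (res A b y) (img A (auxApprox A b c i y)) (img A v)
        + auxC' (res A b y) (img A (auxApprox A b c i y)) (img A v)
        - (auxD' (res A b y) (img A (auxMin A b c y)) (img A v)
        + auxC' (res A b y) (img A (auxMin A b c y)) (img A v)) := by
    unfold auxModel' at h1 ⊢
    linarith
  rw [e]
  refine h2.trans (mul_le_mul_of_nonneg_right ?_ (norm_nonneg _))
  have h3 := norm_auxApprox_le hA h hi hy
  have h4 := hm.auxMin_le
  have h5 : 2 * X ^ 7 + 36 * (‖img A (auxApprox A b c i y)‖ + ‖img A (auxMin A b c y)‖) ^ 2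
      ≤ X ^ 13 := by
    have : (‖img A (auxApprox A b c i y)‖ + ‖img A (auxMin A b c y)‖) ^ 2 ≤ (3 * X) ^ 2 :=
      pow_le_pow_left₀ (by positivity) (by linarith) 2
    have q : ∀ m : ℕ, 2 * X ^ m ≤ X * X ^ m := fun m =>
      mul_le_mul_of_nonneg_right hX (by positivity)
    have e : (3 * X) ^ 2 = 9 * X ^ 2 := by ring
    have p : 0 ≤ X ^ 7 := by positivity
    linarith [q 2, q 3, q 4, q 5, q 6, q 7, q 8, q 9, q 10, q 11, q 12]
  calc _ ≤ X ^ 13 * (X ^ 60)⁻¹ :=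
        mul_le_mul h5 (auxApprox_dist hA h hi hy) (norm_nonneg _) (by positivity)
    _ = _ := by
      rw [show X ^ 60 = X ^ 13 * X ^ 47 by ring]
      have : X ^ 13 ≠ 0 := by positivity
      field_simp

/-- The model exceeds `f` by at least `5 ‖u‖⁴`. By convexity its excess over its minimum is at most
residual times distance, that is `X⁻⁴⁷ X⁻⁶⁰`. -/
theorem regression_auxApprox_le : regression A b c (y + auxApprox A b c i y)
    ≤ regression A b c y + (X ^ 100)⁻¹ - 5 * ‖img A (auxApprox A b c i y)‖ ^ 4 := by
  have hX := h.two_le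
  set h' := auxApprox A b c i y
  have h1 := regression_add_le_auxModel (A := A) b c y h'
  have h2 := auxModel_auxMin_le b c hA y 0
  have h3 : auxModel A b c y 0 = 0 := by simp [auxModel]
  have h4 := auxModel_breg_ge (A := A) b c y h' (auxMin A b c y)
  have h5 := neg_le_of_abs_le
    (abs_auxModel'_auxApprox_le hA h hi hy (auxMin A b c y - h'))
  have h6 := two_mul_norm_pow_four_le_bregD (res A b y) (img A h')
    (img A (auxMin A b c y) - img A h')
  rw [add_sub_cancel] at h6
  have h7 : 0 ≤ bregD (res A b y) (img A (auxMin A b c y)) (img A h') :=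
    le_trans (by positivity) h6
  have h8 := auxApprox_dist hA h hi hy
  rw [norm_sub_rev, ← map_sub] at h8
  have h9 : (X ^ 47)⁻¹ * ‖img A (auxMin A b c y - h')‖ ≤ (X ^ 100)⁻¹ := by
    calc _ ≤ (X ^ 47)⁻¹ * (X ^ 60)⁻¹ := mul_le_mul_of_nonneg_left h8 (by positivity)
      _ = (X ^ 107)⁻¹ := by rw [← mul_inv, ← pow_add]
      _ ≤ _ := pow_inv_le hX (by norm_num)
  linarith

theorem abs_norm_sq_auxApprox_sub_le :
    |‖img A (auxApprox A b c i y)‖ ^ 2 - ‖img A (auxMin A b c y)‖ ^ 2| ≤ (X ^ 57)⁻¹ := by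
  have hX := h.two_le
  have h1 := auxApprox_dist hA h hi hy
  have h3 := norm_auxApprox_le hA h hi hy
  have h4 := (h.modelBounds hA hy).auxMin_le
  have e : ‖img A (auxApprox A b c i y)‖ ^ 2 - ‖img A (auxMin A b c y)‖ ^ 2
      = (‖img A (auxApprox A b c i y)‖ + ‖img A (auxMin A b c y)‖)
        * (‖img A (auxApprox A b c i y)‖ - ‖img A (auxMin A b c y)‖) := by ring
  rw [e, abs_mul, abs_of_nonneg (by positivity)]
  calc _ ≤ (3 * X) * (X ^ 60)⁻¹ :=
        mul_le_mul (by linarith) ((abs_norm_sub_norm_le _ _).trans h1) (abs_nonneg _)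
          (by linarith)
    _ = 3 * (X ^ (57 + 2))⁻¹ := by
      have : X ≠ 0 := by positivity
      field_simp
    _ ≤ _ := mul_pow_inv_le hX 2 (by norm_num) 57

theorem abs_inner_gradient_auxApprox_le (v : Vec d) :
    |inner ℝ (gradient (regression A b c) (y + auxApprox A b c i y)) v|
      ≤ ((X ^ 47)⁻¹ + 28 * ‖img A (auxApprox A b c i y)‖ ^ 3) * ‖img A v‖ := by
  rw [inner_gradient_add]
  set u := img A (auxApprox A b c i y)
  have h1 := abs_auxModel'_auxApprox_le hA h hi hy v
  have h2 := abs_sum_pow_three_mul_le u (img A v)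
  have h3 := abs_real_inner_le_norm u (img A v)
  have h4 : |24 * ‖u‖ ^ 2 * inner ℝ u (img A v)| ≤ 24 * ‖u‖ ^ 2 * (‖u‖ * ‖img A v‖) := by
    rw [abs_mul, abs_of_nonneg (by positivity)]
    exact mul_le_mul_of_nonneg_left h3 (by positivity)
  rw [abs_le] at h1 h2 h4 ⊢
  constructor <;> linarith [h1.1, h1.2, h2.1, h2.2, h4.1, h4.2]

/-- A short step means that the point is nearly optimal. -/
theorem gap_le_of_short (hs : ‖img A (auxApprox A b c i y)‖ ^ 2 ≤ 2 * (X ^ 10)⁻¹) :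
    regression A b c (y + auxApprox A b c i y)
      - regression A b c (regressionInstance A b c).xstar ≤ X⁻¹ := by
  have hX := h.two_le
  set h' := auxApprox A b c i y
  set xs := (regressionInstance A b c).xstar
  have h1 := inner_gradient_le A b c (y + h') xs
  have h2 := abs_inner_gradient_auxApprox_le hA h hi hy (y + h' - xs)
  have h3 : inner ℝ (gradient (regression A b c) (y + h')) (xs - (y + h'))
      = -inner ℝ (gradient (regression A b c) (y + h')) (y + h' - xs) := by
    rw [← inner_neg_right, neg_sub]
  have hu1 : ‖img A h'‖ ≤ 1 := by
    have := mul_pow_inv_le hX (C := 2) 1 (by norm_num) 9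
    have h9 : (X ^ 9)⁻¹ ≤ 1 := inv_le_one_of_one_le₀ (one_le_pow₀ (by linarith))
    exact abs_le_of_sq_le_sq' (by linarith) zero_le_one |>.2
  have hu3 : ‖img A h'‖ ^ 3 ≤ 2 * (X ^ 10)⁻¹ := by
    have : ‖img A h'‖ ^ 3 ≤ ‖img A h'‖ ^ 2 :=
      pow_le_pow_of_le_one (norm_nonneg _) hu1 (by norm_num)
    linarith
  have hxs : xs ∈ (regressionInstance A b c).setL z :=
    mem_setL_of_norm_le hA (by rw [sub_self, map_zero, norm_zero]; exact norm_nonneg _)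
  have h5 : ‖img A (y + h' - xs)‖ ≤ 2 * X := by
    have e : y + h' - xs = (y - xs) + h' := by abel
    rw [e, map_add]
    have := h.norm_le hy hxs
    exact (norm_add_le _ _).trans (by linarith)
  have h6 : (X ^ 47)⁻¹ ≤ (X ^ 10)⁻¹ := pow_inv_le hX (by norm_num)
  have h7 : ((X ^ 47)⁻¹ + 28 * ‖img A h'‖ ^ 3) * ‖img A (y + h' - xs)‖
      ≤ (57 * (X ^ 10)⁻¹) * (2 * X) :=
    mul_le_mul (by linarith) h5 (norm_nonneg _) (by positivity)
  have h8 : (57 * (X ^ 10)⁻¹) * (2 * X) = 114 * (X ^ (2 + 7))⁻¹ := by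
    have : X ≠ 0 := by positivity
    field_simp; ring
  have h9 := mul_pow_inv_le hX (C := 114) 7 (by norm_num) 2
  have h10 := pow_inv_le hX (m := 1) (k := 2) (by norm_num)
  rw [pow_one] at h10
  have h11 := neg_le_of_abs_le h2
  have h12 := le_of_abs_le h2
  linarith

/-- The approximate step is a step of the accelerated proximal point method. -/
theorem proximal_auxApprox {ρ : ℝ} (hρ0 : (X ^ 10)⁻¹ ≤ ρ)
    (hρ : |ρ - ‖img A (auxApprox A b c i y)‖ ^ 2| ≤ ρ / 10) (v : Vec d) :
    |inner ℝ (gradient (regression A b c) (y + auxApprox A b c i y)) v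
      + 24 * ρ * inner ℝ (img A (auxApprox A b c i y)) (img A v)|
        ≤ 12 * ρ * ‖img A (auxApprox A b c i y)‖ * ‖img A v‖ := by
  have hX := h.two_le
  rw [inner_gradient_add]
  set u := img A (auxApprox A b c i y)
  set w := img A v
  have h1 := abs_auxModel'_auxApprox_le hA h hi hy v
  have h2 := abs_sum_pow_three_mul_le u w
  have h3 := abs_real_inner_le_norm u w
  have hp : 0 < (X ^ 10)⁻¹ := by positivity
  have hρp : 0 < ρ := lt_of_lt_of_le hp hρ0
  have hp1 : (X ^ 10)⁻¹ ≤ 1 := inv_le_one_of_one_le₀ (one_le_pow₀ (by linarith))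
  rw [abs_le] at hρ
  have hu : (X ^ 10)⁻¹ ≤ 2 * ‖u‖ := by
    by_contra hlt
    push Not at hlt
    have h1 : (2 * ‖u‖) ^ 2 ≤ ((X ^ 10)⁻¹) ^ 2 := pow_le_pow_left₀ (by positivity) hlt.le 2
    nlinarith
  have hsmall : (X ^ 47)⁻¹ ≤ ρ * ‖u‖ := by
    have h4 : (X ^ 10)⁻¹ * (X ^ 10)⁻¹ ≤ ρ * (2 * ‖u‖) := mul_le_mul hρ0 hu hp.le hρp.le
    rw [← mul_inv, ← pow_add] at h4
    have h5 := mul_pow_inv_le hX (C := 2) 27 (by norm_num) 20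
    norm_num at h4 h5
    linarith
  -- In units of `ρ ‖u‖ ‖w‖` the errors are `1` from the model residual, `24/10` from replacing
  -- `‖u‖²` by `ρ`, and `4 · 1.1` from the quartic term of `f`: together below `12`.
  have h4 : |24 * (ρ - ‖u‖ ^ 2) * inner ℝ u w| ≤ 24 * (ρ / 10) * (‖u‖ * ‖w‖) := by
    rw [abs_mul, abs_mul, abs_of_pos (by norm_num : (0 : ℝ) < 24)]
    refine mul_le_mul (mul_le_mul_of_nonneg_left (abs_le.2 hρ) (by norm_num)) h3
      (abs_nonneg _) (by positivity)
  have h5 : ‖u‖ ^ 3 * ‖w‖ ≤ 1.1 * ρ * (‖u‖ * ‖w‖) := by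
    have : ‖u‖ ^ 2 ≤ 1.1 * ρ := by linarith [hρ.1]
    calc _ = ‖u‖ ^ 2 * (‖u‖ * ‖w‖) := by ring
      _ ≤ _ := mul_le_mul_of_nonneg_right this (by positivity)
  have h6 := mul_le_mul_of_nonneg_right hsmall (norm_nonneg w)
  have h7 : 0 ≤ ρ * (‖u‖ * ‖w‖) := by positivity
  rw [abs_le] at h1 h2 h4 ⊢
  constructor <;> nlinarith [h1.1, h1.2, h2.1, h2.2, h4.1, h4.2]

/-- The step is long enough, `‖u‖² ≥ 0.9 X⁻¹⁰`, for the decrease `5 ‖u‖⁴` to outweigh the error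
`X⁻¹⁰⁰`, so `f` does not increase. -/
theorem auxApprox_mem {ρ : ℝ} (hρ0 : (X ^ 10)⁻¹ ≤ ρ)
    (hρ : |ρ - ‖img A (auxApprox A b c i y)‖ ^ 2| ≤ ρ / 10) :
    y + auxApprox A b c i y ∈ (regressionInstance A b c).setL z := by
  have hX := h.two_le
  rw [mem_setL_iff] at hy ⊢
  refine le_trans ?_ hy
  have h1 := regression_auxApprox_le hA h hi hy
  set u := img A (auxApprox A b c i y)
  rw [abs_le] at hρ
  have hp : 0 < (X ^ 10)⁻¹ := by positivity
  have h2 : 0.9 * (X ^ 10)⁻¹ ≤ ‖u‖ ^ 2 := by linarith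
  have h3 : (0.9 * (X ^ 10)⁻¹) ^ 2 ≤ (‖u‖ ^ 2) ^ 2 := pow_le_pow_left₀ (by positivity) h2 2
  have h4 : ((X ^ 10)⁻¹) ^ 2 = (X ^ 20)⁻¹ := by rw [inv_pow, ← pow_mul]
  have h5 : (X ^ 100)⁻¹ ≤ (X ^ 20)⁻¹ := pow_inv_le hX (by norm_num)
  have h6 : 0 < (X ^ 20)⁻¹ := by positivity
  rw [mul_pow, h4, ← pow_mul] at h3
  norm_num at h3
  linarith

end approx

/-- The Lyapunov inequality of one accelerated step. -/
theorem lyapunov_step (hA : (Aᵀ * A).PosDef) (xs x v y x' : Vec d) {Ak a ρ : ℝ} (hAk : 0 ≤ Ak)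
    (ha : 0 < a) (hρ : 0 < ρ) (haρ : 24 * ρ * a ^ 2 = Ak + a)
    (hy : (Ak + a) • y = Ak • x + a • v) (hr : 0.9 * ρ ≤ ‖img A (x' - y)‖ ^ 2)
    (hprox : ∀ w, |inner ℝ (gradient (regression A b c) x') w
      + 24 * ρ * inner ℝ (img A (x' - y)) (img A w)| ≤ 12 * ρ * ‖img A (x' - y)‖ * ‖img A w‖) :
    (Ak + a) * (regression A b c x' - regression A b c xs)
      + 1 / 2 * ‖img A (v - a • (regressionInstance A b c).B.inverse
          (gradient (regression A b c) x') - xs)‖ ^ 2 + 8 * (Ak + a) * ρ ^ 2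
      ≤ Ak * (regression A b c x - regression A b c xs) + 1 / 2 * ‖img A (v - xs)‖ ^ 2 := by
  set g := gradient (regression A b c) x' with hg
  set e := (regressionInstance A b c).B.inverse g
  have hp : ∀ w, inner ℝ (img A e) (img A w) = inner ℝ g w := inner_img_gramInv b c hA g
  set p := img A e
  set u := img A (x' - y)
  have c1 := inner_gradient_le A b c x' xs
  have c2 := inner_gradient_le A b c x' x
  rw [← hg] at c1 c2
  have e1 : img A (v - a • e - xs) = img A (v - xs) - a • p := by
    simp only [p, map_sub, map_smul]; abel
  have e2 : ‖img A (v - a • e - xs)‖ ^ 2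
      = ‖img A (v - xs)‖ ^ 2 - 2 * a * inner ℝ g (v - xs) + a ^ 2 * ‖p‖ ^ 2 := by
    rw [e1, norm_sub_sq_real, inner_smul_right, real_inner_comm, hp, norm_smul, mul_pow,
      Real.norm_eq_abs, sq_abs]
    ring
  have e3 : a * inner ℝ g (xs - x') + Ak * inner ℝ g (x - x')
      = -((Ak + a) * inner ℝ p u) - a * inner ℝ g (v - xs) := by
    have : a • (xs - x') + Ak • (x - x') = -((Ak + a) • (x' - y)) - a • (v - xs) := by
      rw [smul_sub (Ak + a), hy]
      module
    rw [← inner_smul_right, ← inner_smul_right, ← inner_add_right, this, inner_sub_right,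
      inner_neg_right, inner_smul_right, inner_smul_right, hp]
  -- Testing with the residual `B⁻¹ g + 24 ρ (x' - y)` itself turns the weak inequality into a norm
  -- bound with relative error one half.
  have h1 := hprox (e + (24 * ρ) • (x' - y))
  have e4 : img A (e + (24 * ρ) • (x' - y)) = p + (24 * ρ) • u := by
    simp only [p, u, map_add, map_smul]
  rw [← hp, e4] at h1
  set q := p + (24 * ρ) • u
  have e5 : inner ℝ p q + 24 * ρ * inner ℝ u q = ‖q‖ ^ 2 := by
    rw [← real_inner_self_eq_norm_sq, ← real_inner_smul_left, ← inner_add_left]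
  have e6 : ‖q‖ ^ 2 = ‖p‖ ^ 2 + 48 * ρ * inner ℝ p u + 576 * ρ ^ 2 * ‖u‖ ^ 2 := by
    rw [norm_add_sq_real, inner_smul_right, norm_smul, mul_pow, Real.norm_eq_abs, sq_abs]; ring
  rw [e5, abs_of_nonneg (sq_nonneg _)] at h1
  have h2 : ‖q‖ ≤ 12 * ρ * ‖u‖ := by
    rcases (norm_nonneg q).eq_or_lt with h | h
    · rw [← h]; positivity
    · exact le_of_mul_le_mul_right (by rw [← sq]; exact h1) h
  have h3 : ‖q‖ ^ 2 ≤ 144 * ρ ^ 2 * ‖u‖ ^ 2 := by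
    calc _ ≤ (12 * ρ * ‖u‖) ^ 2 := pow_le_pow_left₀ (norm_nonneg _) h2 2
      _ = _ := by ring
  -- Here `432 = 576 - 144`, and `432 · 0.9 / 2 > 192`, which is the coefficient of `a² ρ³` in the
  -- claimed gain `8 (Ak + a) ρ²`.
  have h4 : 1 / 2 * a ^ 2 * (48 * ρ * inner ℝ p u + ‖p‖ ^ 2)
      ≤ 1 / 2 * a ^ 2 * (-(432 * ρ ^ 2 * (0.9 * ρ))) := by
    refine mul_le_mul_of_nonneg_left ?_ (by positivity)
    have := mul_le_mul_of_nonneg_left hr (by positivity : 0 ≤ 432 * ρ ^ 2)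
    linarith
  have h5 : 0 < a ^ 2 * ρ ^ 3 := by positivity
  have h6 : (Ak + a) * inner ℝ p u = 24 * ρ * a ^ 2 * inner ℝ p u := by rw [haρ]
  have h7 : 8 * (Ak + a) * ρ ^ 2 = 192 * (a ^ 2 * ρ ^ 3) := by rw [← haρ]; ring
  rw [e2, h7]
  have c1' := mul_le_mul_of_nonneg_left c1 ha.le
  have c2' := mul_le_mul_of_nonneg_left c2 hAk
  nlinarith [c1', c2', e3, h4, h5, h6]

end

section

variable {n d : ℕ} {A : Matrix (Fin n) (Fin d) ℝ} {b : Fin n → ℝ} {c : Fin d → ℝ}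

/-! ### The step size -/

theorem stepSize_pos {Ak ρ : ℝ} (hρ : 0 < ρ) :
    0 < (regressionInstance A b c).stepSize Ak ρ := by
  unfold Instance.stepSize
  rw [regressionInstance_L]
  positivity

theorem stepSize_eq (Ak ρ : ℝ) : (regressionInstance A b c).stepSize Ak ρ
    = (1 + √(1 + 4 * 24 * Ak * ρ)) / (2 * 24 * ρ) := rfl

theorem mul_stepSize_sq {Ak ρ : ℝ} (hA : 0 ≤ Ak) (hρ : 0 < ρ) :
    24 * ρ * (regressionInstance A b c).stepSize Ak ρ ^ 2
      = Ak + (regressionInstance A b c).stepSize Ak ρ := by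
  rw [stepSize_eq]
  have h := Real.sq_sqrt (by positivity : 0 ≤ 1 + 4 * 24 * Ak * ρ)
  set s := √(1 + 4 * 24 * Ak * ρ)
  field_simp
  linear_combination h

theorem weight_eq {Ak ρ : ℝ} (hA : 0 ≤ Ak) (hρ : 0 < ρ) :
    (regressionInstance A b c).stepSize Ak ρ / (Ak + (regressionInstance A b c).stepSize Ak ρ)
      = 2 / (1 + √(1 + 4 * 24 * Ak * ρ)) := by
  rw [← mul_stepSize_sq hA hρ]
  have hpos := stepSize_pos (A := A) (b := b) (c := c) (Ak := Ak) hρ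
  have h : 24 * ρ * (regressionInstance A b c).stepSize Ak ρ
      = (1 + √(1 + 4 * 24 * Ak * ρ)) / 2 := by
    rw [stepSize_eq]; field_simp
  have h0 : 0 < √(1 + 4 * 24 * Ak * ρ) := by positivity
  have h1 : 0 < 24 * ρ * (regressionInstance A b c).stepSize Ak ρ := by positivity
  calc _ = 1 / (24 * ρ * (regressionInstance A b c).stepSize Ak ρ) := by
        field_simp
    _ = _ := by rw [h]; field_simp

/-- The weight has the closed form `2/(1 + √(1 + 96 A ρ))`. Rationalizing the difference of the
roots gives a Lipschitz bound uniform in `A`, needed because `A_k` has no upper bound. -/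
theorem weight_sub_le {Ak ρ₁ ρ₂ : ℝ} (hA : 0 ≤ Ak) (h₁ : 0 < ρ₁) (h₂ : ρ₁ ≤ ρ₂) :
    |2 / (1 + √(1 + 4 * 24 * Ak * ρ₁)) - 2 / (1 + √(1 + 4 * 24 * Ak * ρ₂))|
      ≤ 2 * (ρ₂ - ρ₁) / ρ₁ := by
  have hρ2 : 0 < ρ₂ := h₁.trans_le h₂
  have e1 := Real.sq_sqrt (by positivity : 0 ≤ 1 + 4 * 24 * Ak * ρ₁)
  have e2 := Real.sq_sqrt (by positivity : 0 ≤ 1 + 4 * 24 * Ak * ρ₂)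
  have g1 : 0 < √(1 + 4 * 24 * Ak * ρ₁) := by positivity
  have hle : √(1 + 4 * 24 * Ak * ρ₁) ≤ √(1 + 4 * 24 * Ak * ρ₂) := by
    apply Real.sqrt_le_sqrt
    have := mul_le_mul_of_nonneg_left h₂ (by positivity : 0 ≤ 4 * 24 * Ak)
    linarith
  set s := √(1 + 4 * 24 * Ak * ρ₁)
  set t := √(1 + 4 * 24 * Ak * ρ₂)
  have ht : 0 < t := g1.trans_le hle
  have e : 2 / (1 + s) - 2 / (1 + t) = 2 * (t - s) / ((1 + s) * (1 + t)) := by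
    field_simp; ring
  rw [e, abs_of_nonneg (div_nonneg (by linarith) (by positivity)),
    div_le_div_iff₀ (by positivity) h₁]
  have k1 : (t - s) * (t + s) * ρ₁ = (4 * 24 * Ak * ρ₁) * (ρ₂ - ρ₁) := by
    linear_combination ρ₁ * e2 - ρ₁ * e1
  have k2 : (4 * 24 * Ak * ρ₁) * (ρ₂ - ρ₁) ≤ s ^ 2 * (ρ₂ - ρ₁) :=
    mul_le_mul_of_nonneg_right (by linarith) (by linarith)
  have k3 : (t - s) * s * ρ₁ ≤ (t - s) * (t + s) * ρ₁ := by
    have : 0 ≤ (t - s) * ρ₁ := mul_nonneg (by linarith) h₁.le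
    nlinarith
  have k4 : s * ((t - s) * ρ₁) ≤ s * (s * (ρ₂ - ρ₁)) := by nlinarith
  have k5 : (t - s) * ρ₁ ≤ s * (ρ₂ - ρ₁) := le_of_mul_le_mul_left k4 g1
  have k6 : s * (ρ₂ - ρ₁) ≤ ((1 + s) * (1 + t)) * (ρ₂ - ρ₁) :=
    mul_le_mul_of_nonneg_right (by nlinarith) (by linarith)
  nlinarith

theorem weight_bounds {Ak ρ : ℝ} : 0 ≤ 2 / (1 + √(1 + 4 * 24 * Ak * ρ)) ∧
    (0 ≤ Ak → 0 < ρ → 2 / (1 + √(1 + 4 * 24 * Ak * ρ)) ≤ 1) := by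
  refine ⟨by positivity, fun hA hρ => ?_⟩
  rw [div_le_one (by positivity)]
  have : 1 ≤ √(1 + 4 * 24 * Ak * ρ) := by
    rw [Real.one_le_sqrt]
    have : 0 ≤ 4 * 24 * Ak * ρ := by positivity
    linarith
  linarith

variable (A b c) in
/-- The point `y(x, v, A, ρ)`. -/
def rhoPoint (x v : Vec d) (Ak ρ : ℝ) : Vec d :=
  Instance.mixPoint Ak ((regressionInstance A b c).stepSize Ak ρ) x v

theorem rhoPoint_mem {z x v : Vec d} (hx : x ∈ (regressionInstance A b c).setL z)
    (hv : v ∈ (regressionInstance A b c).setL z) {Ak ρ : ℝ} (hA : 0 ≤ Ak) (hρ : 0 < ρ) :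
    rhoPoint A b c x v Ak ρ ∈ (regressionInstance A b c).setL z := by
  unfold rhoPoint Instance.mixPoint
  rw [weight_eq hA hρ]
  have h := weight_bounds (Ak := Ak) (ρ := ρ)
  exact convex_setL z hx hv (sub_nonneg.2 (h.2 hA hρ)) h.1 (sub_add_cancel _ _)

theorem rhoPoint_sub_le {x v : Vec d} {Ak ρ₁ ρ₂ : ℝ} (hA : 0 ≤ Ak) (h₁ : 0 < ρ₁)
    (h₂ : ρ₁ ≤ ρ₂) : ‖img A (rhoPoint A b c x v Ak ρ₁ - rhoPoint A b c x v Ak ρ₂)‖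
      ≤ 2 * (ρ₂ - ρ₁) / ρ₁ * ‖img A (v - x)‖ := by
  unfold rhoPoint Instance.mixPoint
  rw [weight_eq hA h₁, weight_eq hA (h₁.trans_le h₂)]
  have := weight_sub_le hA h₁ h₂
  set s := 2 / (1 + √(1 + 4 * 24 * Ak * ρ₁))
  set t := 2 / (1 + √(1 + 4 * 24 * Ak * ρ₂))
  have e : (1 - s) • x + s • v - ((1 - t) • x + t • v) = (s - t) • (v - x) := by module
  rw [e, map_smul, norm_smul, Real.norm_eq_abs]
  exact mul_le_mul_of_nonneg_right this (norm_nonneg _)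

theorem smul_rhoPoint {x v : Vec d} {Ak ρ : ℝ} (hA : 0 ≤ Ak) (hρ : 0 < ρ) :
    (Ak + (regressionInstance A b c).stepSize Ak ρ) • rhoPoint A b c x v Ak ρ
      = Ak • x + (regressionInstance A b c).stepSize Ak ρ • v := by
  unfold rhoPoint Instance.mixPoint
  have hpos := stepSize_pos (A := A) (b := b) (c := c) (Ak := Ak) hρ
  set a := (regressionInstance A b c).stepSize Ak ρ
  have h : Ak + a ≠ 0 := by positivity
  rw [smul_add, smul_smul, smul_smul]
  congr 2 <;> field_simp
  ring

/-! ### Continuity of the minimizer of the model -/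

/-- Hölder continuity with exponent `1/3`. Uniform convexity of the first model bounds `‖w‖⁴` by its
derivative at the second minimizer. The second model has zero derivative there, and at a fixed
increment the two derivatives differ only through `∇f(y₁ + m₂) - ∇f(y₂ + m₂)`, which is linear in
`‖y₁ - y₂‖` up to powers of `X`. -/
theorem norm_auxMin_sub_pow_le (hA : (Aᵀ * A).PosDef) {X : ℝ} {z y₁ y₂ : Vec d}
    (h : RunBounds A b c X z) (h₁ : y₁ ∈ (regressionInstance A b c).setL z)
    (h₂ : y₂ ∈ (regressionInstance A b c).setL z) :
    ‖img A (auxMin A b c y₁) - img A (auxMin A b c y₂)‖ ^ 3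
      ≤ X ^ 13 * ‖img A (y₁ - y₂)‖ := by
  have hX := h.two_le
  set m₁ := auxMin A b c y₁
  set m₂ := auxMin A b c y₂
  set e := img A (y₁ - y₂) with he
  have heX : ‖e‖ ≤ X := h.norm_le h₁ h₂
  have hb := auxModel_breg_ge (A := A) b c y₁ m₂ m₁
  have hm := auxModel_auxMin_le b c hA y₁ m₂
  have hv := two_mul_norm_pow_four_le_bregD (res A b y₁) (img A m₂) (img A m₁ - img A m₂)
  rw [add_sub_cancel] at hv
  have h0 := auxModel'_auxMin b c hA y₂ (m₁ - m₂)
  set w := img A m₁ - img A m₂ with hw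
  have hwz : img A (m₁ - m₂) = w := map_sub _ _ _
  have hq := h.hess_le _ (auxMin_mem hA h₂)
  set q := res A b (y₂ + m₂) with hqdef
  have hdiff : auxModel' A b c y₁ m₂ (m₁ - m₂) - auxModel' A b c y₂ m₂ (m₁ - m₂)
      = ∑ k, (4 * (q k + e k) ^ 3 - 4 * q k ^ 3) * w k := by
    have s : ∀ y : Vec d, auxModel' A b c y m₂ (m₁ - m₂)
        = ∑ j, c j * (m₁ - m₂) j + ∑ k, (4 * res A b (y + m₂) k ^ 3 * w k - 4 * img A m₂ k ^ 3 * w k)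
          + 24 * ‖img A m₂‖ ^ 2 * inner ℝ (img A m₂) w := by
      intro y
      rw [auxModel', inner_gradient, auxD', auxC', hwz]
      have : ∑ k, (4 * res A b (y + m₂) k ^ 3 * w k - 4 * img A m₂ k ^ 3 * w k)
          = ∑ k, 4 * res A b y k ^ 3 * w k + ∑ k, 12 * res A b y k ^ 2 * img A m₂ k * w k
            + ∑ k, 12 * res A b y k * img A m₂ k ^ 2 * w k := by
        rw [← Finset.sum_add_distrib, ← Finset.sum_add_distrib]
        exact Finset.sum_congr rfl fun k _ => by rw [res_add]; ring
      rw [this]; ring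
    rw [s, s]
    have : ∑ k, (4 * (q k + e k) ^ 3 - 4 * q k ^ 3) * w k
        = ∑ k, (4 * res A b (y₁ + m₂) k ^ 3 * w k - 4 * img A m₂ k ^ 3 * w k)
          - ∑ k, (4 * res A b (y₂ + m₂) k ^ 3 * w k - 4 * img A m₂ k ^ 3 * w k) := by
      rw [← Finset.sum_sub_distrib]
      refine Finset.sum_congr rfl fun k _ => ?_
      have : res A b (y₁ + m₂) k = q k + e k := by
        rw [hqdef, he, ← res_add, show y₂ + m₂ + (y₁ - y₂) = y₁ + m₂ by abel]
      rw [this, hqdef]; ring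
    rw [this]; ring
  have hbound : |∑ k, (4 * (q k + e k) ^ 3 - 4 * q k ^ 3) * w k|
      ≤ (2 * X ^ 7 + 16 * ‖e‖ ^ 2) * ‖e‖ * ‖w‖ := by
    have a := sum_mul_abs_le (q := fun k => 12 * q k ^ 2) (fun k => by positivity)
      (by positivity) (hq (y₁ - y₂)) (hwz ▸ hq (m₁ - m₂))
    have a2 := sum_sq_mul_abs_le e e w
    calc _ ≤ ∑ k, |(4 * (q k + e k) ^ 3 - 4 * q k ^ 3) * w k| := Finset.abs_sum_le_sum_abs _ _
      _ ≤ ∑ k, (2 * (12 * q k ^ 2 * (|e k| * |w k|)) + 16 * (e k ^ 2 * (|e k| * |w k|))) := by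
          refine Finset.sum_le_sum fun k _ => ?_
          have e1 : (4 * (q k + e k) ^ 3 - 4 * q k ^ 3) * w k
              = (12 * q k ^ 2 + 12 * q k * e k + 4 * e k ^ 2) * (e k * w k) := by ring
          rw [e1, abs_mul, abs_mul (e k)]
          have e2 : |12 * q k ^ 2 + 12 * q k * e k + 4 * e k ^ 2| ≤ 24 * q k ^ 2 + 16 * e k ^ 2 := by
            rw [abs_le]
            constructor <;> nlinarith [sq_nonneg (q k + e k), sq_nonneg (q k - e k),
              sq_nonneg (q k), sq_nonneg (e k)]
          have := mul_le_mul_of_nonneg_right e2 (mul_nonneg (abs_nonneg (e k)) (abs_nonneg (w k)))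
          linarith
      _ ≤ _ := by
          rw [Finset.sum_add_distrib, ← Finset.mul_sum, ← Finset.mul_sum]
          nlinarith
  have h5 : (2 * X ^ 7 + 16 * ‖e‖ ^ 2) ≤ 0.58 * X ^ 13 := by
    have : ‖e‖ ^ 2 ≤ X ^ 2 := pow_le_pow_left₀ (norm_nonneg _) heX 2
    have q : ∀ m : ℕ, 2 * X ^ m ≤ X * X ^ m := fun m =>
      mul_le_mul_of_nonneg_right hX (by positivity)
    have p : 0 ≤ X ^ 2 := by positivity
    linarith [q 2, q 3, q 4, q 5, q 6, q 7, q 8, q 9, q 10, q 11, q 12]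
  have h6 : 0.58 * ‖w‖ ^ 4 ≤ 0.58 * X ^ 13 * ‖e‖ * ‖w‖ := by
    have := mul_le_mul_of_nonneg_right h5 (mul_nonneg (norm_nonneg e) (norm_nonneg w))
    have h7 := neg_le_of_abs_le hbound
    linarith
  rcases (norm_nonneg w).eq_or_lt with h | h
  · rw [← h]; simp; positivity
  · refine le_of_mul_le_mul_right ?_ h
    linarith

/-! ### The tolerances -/

section tol

variable {X : ℝ} {z : Vec d} {i : Init}

theorem rpow_quarter_pow_four {t : ℝ} (ht : 0 ≤ t) (m : ℕ) :
    (t ^ (4 * m)) ^ (1 / 4 : ℝ) = t ^ m := by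
  have := Real.pow_rpow_inv_natCast (pow_nonneg ht m) (n := 4) (by norm_num)
  rw [mul_comm, pow_mul]
  convert this using 2
  norm_num

/-- The fourth root of the accuracy is `X⁻¹⁸` and `Q ≤ X⁴`. The upper bound keeps the tolerance far
below `ρ⁻ = X⁻¹⁰`; the lower bound keeps it far above the error of `ApproxAuxMin`. -/
theorem tol_bounds (h : RunBounds A b c X z) (hi : LoopBounds X i) :
    (regressionInstance A b c).tolRho i z
        ≤ (regressionInstance A b c).parQ z * i.epsAam ^ (1 / 4 : ℝ) ∧
      (regressionInstance A b c).parQ z * i.epsAam ^ (1 / 4 : ℝ) ≤ (X ^ 14)⁻¹ ∧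
      (X ^ 37)⁻¹ ≤ (regressionInstance A b c).tolRho i z := by
  have hX := h.two_le
  have hX0 : 0 < X := by linarith
  set t := (X ^ 18)⁻¹ with ht
  have ht0 : 0 < t := by positivity
  have ht1 : t ≤ 1 := inv_le_one_of_one_le₀ (one_le_pow₀ (by linarith))
  have he : i.epsAam ^ (1 / 4 : ℝ) = t := by
    rw [hi.epsAam]
    have : (X ^ 72)⁻¹ = (X⁻¹) ^ (4 * 18) := by rw [inv_pow]
    rw [this, rpow_quarter_pow_four (by positivity), inv_pow]
  have heps : i.epsAam = t ^ 4 := by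
    rw [hi.epsAam, ht, inv_pow, ← pow_mul]
  unfold Instance.tolRho Instance.parQ
  rw [regressionInstance_L, Real.div_rpow (by rw [heps]; positivity) (by norm_num), he]
  have hP : √((regressionInstance A b c).parP z) ≤ X :=
    Real.sqrt_le_iff.2 ⟨hX0.le, h.parP_le⟩
  set p := √((regressionInstance A b c).parP z)
  have hp0 : 0 ≤ p := Real.sqrt_nonneg _
  set ℓ := (24 : ℝ) ^ (1 / 4 : ℝ)
  have hℓ1 : 1 ≤ ℓ := Real.one_le_rpow (by norm_num) (by norm_num)
  have hs : √(12 * i.epsAam / 24) = t ^ 2 / √2 := by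
    have : 12 * i.epsAam / 24 = (t ^ 2) ^ 2 / 2 := by rw [heps]; ring
    rw [this, Real.sqrt_div (by positivity), Real.sqrt_sq (by positivity)]
  rw [hs]
  have h24 : √(24 : ℝ) ≤ 5 := Real.sqrt_le_iff.2 ⟨by norm_num, by norm_num⟩
  have h24' : 4 ≤ √(24 : ℝ) := Real.le_sqrt_of_sq_le (by norm_num)
  have h2 : 1 ≤ √(2 : ℝ) := Real.one_le_sqrt.2 (by norm_num)
  have h2' : √(2 : ℝ) ≤ 2 := Real.sqrt_le_iff.2 ⟨by norm_num, by norm_num⟩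
  refine ⟨?_, ?_, ?_⟩
  · have h1 : t ^ 2 / √2 ≤ t := by
      refine (div_le_self (by positivity) h2).trans ?_
      nlinarith
    have h3 : 1 ≤ 5 / √24 := by rw [one_le_div (by positivity)]; exact h24
    calc _ ≤ 6 * (t / ℓ) * p + 1 * t := by linarith
      _ ≤ 6 * (t / ℓ) * p + 5 / √24 * t := by gcongr
      _ = _ := by ring
  · have h1 : 6 * p / ℓ ≤ 6 * X := by
      refine (div_le_self (by positivity) hℓ1).trans (by linarith)
    have h3 : 5 / √24 ≤ 2 := by rw [div_le_iff₀ (by positivity)]; linarith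
    have h4 : 6 * p / ℓ + 5 / √24 ≤ X ^ 4 := by
      have q : ∀ m : ℕ, 2 * X ^ m ≤ X * X ^ m := fun m =>
        mul_le_mul_of_nonneg_right hX (by positivity)
      linarith [q 1, q 2, q 3]
    calc _ ≤ X ^ 4 * t := mul_le_mul_of_nonneg_right h4 ht0.le
      _ = (X ^ 14)⁻¹ := by rw [ht]; field_simp
  · have h1 : 0 ≤ 6 * (t / ℓ) * p := by positivity
    have h3 : (X ^ 37)⁻¹ ≤ t ^ 2 / √2 := by
      rw [le_div_iff₀ (by positivity), ht, inv_pow, ← pow_mul]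
      have := mul_pow_inv_le hX (C := √2) 1 (by linarith) 36
      norm_num at this ⊢
      linarith
    linarith

end tol

/-! ### `RhoSearch` -/

variable (A b c) in
/-- `‖x̂ - ŷ‖_B²` as a function of `ρ`. -/
def rhoZeta (i : Init) (x v : Vec d) (Ak ρ : ℝ) : ℝ :=
  ‖img A (auxApprox A b c i (rhoPoint A b c x v Ak ρ))‖ ^ 2

theorem normB_auxApprox (i : Init) (x v : Vec d) (Ak ρ : ℝ) :
    (regressionInstance A b c).normB (rhoPoint A b c x v Ak ρ
        + auxApprox A b c i (rhoPoint A b c x v Ak ρ) - rhoPoint A b c x v Ak ρ) ^ 2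
      = rhoZeta A b c i x v Ak ρ := by
  rw [add_sub_cancel_left, normB_eq]; rfl

/-- A bracket of `RhoSearch` cannot be short. -/
theorem rho_gap (hA : (Aᵀ * A).PosDef) {X : ℝ} {z x v : Vec d} {i : Init} {Ak lo hi : ℝ}
    (h : RunBounds A b c X z) (hi' : LoopBounds X i)
    (hx : x ∈ (regressionInstance A b c).setL z) (hv : v ∈ (regressionInstance A b c).setL z)
    (hAk : 0 ≤ Ak) (hlo0 : (X ^ 10)⁻¹ ≤ lo) (hle : lo ≤ hi)
    (hlo : lo ≤ rhoZeta A b c i x v Ak lo - (regressionInstance A b c).tolRho i z)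
    (hhi : hi = (regressionInstance A b c).parP z ∨
      rhoZeta A b c i x v Ak hi + (regressionInstance A b c).tolRho i z ≤ hi) :
    (X ^ 145)⁻¹ ≤ hi - lo := by
  have hX := h.two_le
  have hX0 : 0 < X := by linarith
  by_contra hlt
  push Not at hlt
  have hp : 0 < lo := lt_of_lt_of_le (by positivity) hlo0
  have hy1 := rhoPoint_mem hx hv hAk hp
  have hy2 := rhoPoint_mem hx hv hAk (hp.trans_le hle)
  have hd1 := (abs_le.1 (abs_norm_sq_auxApprox_sub_le hA h hi' hy1))
  have hd2 := (abs_le.1 (abs_norm_sq_auxApprox_sub_le hA h hi' hy2))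
  have hδ := (tol_bounds h hi').2.2
  have p57 := mul_pow_inv_le hX (C := 4) 2 (by norm_num) 55
  have p55 : (X ^ 55)⁻¹ ≤ (X ^ 38)⁻¹ := pow_inv_le hX (by norm_num)
  have p145 : (X ^ 145)⁻¹ ≤ (X ^ 39)⁻¹ := pow_inv_le hX (by norm_num)
  have p36 := mul_pow_inv_le hX (C := 2) 1 (by norm_num) 37
  have p35 := mul_pow_inv_le hX (C := 2) 1 (by norm_num) 38
  have pp : 0 < (X ^ 39)⁻¹ := by positivity
  norm_num at p57 p35 p36
  unfold rhoZeta at hlo hhi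
  set y₁ := rhoPoint A b c x v Ak lo
  set y₂ := rhoPoint A b c x v Ak hi
  rcases hhi with hhi | hhi
  -- At the initial upper end no test has been made. There the contradiction comes from `lo`: its
  -- step has squared length above `lo` by at least the tolerance, yet at most `P` up to `X⁻⁵⁷`.
  · have h1 := h.sq_le_parP _ (auxMin_mem hA hy1) _ hy1
    rw [add_sub_cancel_left] at h1
    linarith
  · have h1 := norm_auxMin_sub_pow_le hA h hy1 hy2
    have h2 := rhoPoint_sub_le (A := A) (b := b) (c := c) (x := x) (v := v) hAk hp hle
    have h3 := h.norm_le hv hx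
    have h4 : 2 * (hi - lo) / lo ≤ 2 * ((X ^ 145)⁻¹ * X ^ 10) := by
      rw [div_le_iff₀ hp]
      have : 1 ≤ X ^ 10 * lo := by
        have := mul_le_mul_of_nonneg_left hlo0 (by positivity : 0 ≤ X ^ 10)
        rwa [mul_inv_cancel₀ (by positivity)] at this
      have := mul_le_mul_of_nonneg_left this (by positivity : 0 ≤ 2 * (X ^ 145)⁻¹)
      nlinarith
    -- The exponents add up to `13 - 145 + 10 + 1 = -121`. The cube root is at most `X⁻⁴⁰`, so the
    -- squared lengths differ by at most `X⁻³⁸`, while the two sign conditions force nearly twice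
    -- the tolerance `≥ X⁻³⁷`.
    have h5 : ‖img A (auxMin A b c y₁) - img A (auxMin A b c y₂)‖ ^ 3 ≤ ((X ^ 40)⁻¹) ^ 3 := by
      calc _ ≤ X ^ 13 * ‖img A (y₁ - y₂)‖ := h1
        _ ≤ X ^ 13 * (2 * ((X ^ 145)⁻¹ * X ^ 10) * X) := by
          refine mul_le_mul_of_nonneg_left (h2.trans ?_) (by positivity)
          exact mul_le_mul h4 h3 (norm_nonneg _) (by positivity)
        _ = 2 * (X ^ (120 + 1))⁻¹ := by field_simp
        _ ≤ (X ^ 120)⁻¹ := mul_pow_inv_le hX 1 (by norm_num) 120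
        _ = _ := by rw [inv_pow, ← pow_mul]
    have h6 : ‖img A (auxMin A b c y₁) - img A (auxMin A b c y₂)‖ ≤ (X ^ 40)⁻¹ :=
      le_of_pow_le_pow_left₀ (by norm_num) (by positivity) h5
    have h7 := (h.modelBounds hA hy1).auxMin_le
    have h8 := (h.modelBounds hA hy2).auxMin_le
    have h9 := (norm_sub_norm_le (img A (auxMin A b c y₁)) (img A (auxMin A b c y₂))).trans h6
    have h10 : ‖img A (auxMin A b c y₁)‖ ^ 2 - ‖img A (auxMin A b c y₂)‖ ^ 2
        ≤ (X ^ 38)⁻¹ := by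
      calc _ = (‖img A (auxMin A b c y₁)‖ + ‖img A (auxMin A b c y₂)‖)
            * (‖img A (auxMin A b c y₁)‖ - ‖img A (auxMin A b c y₂)‖) := by ring
        _ ≤ (‖img A (auxMin A b c y₁)‖ + ‖img A (auxMin A b c y₂)‖) * (X ^ 40)⁻¹ :=
          mul_le_mul_of_nonneg_left h9 (by positivity)
        _ ≤ (2 * X) * (X ^ 40)⁻¹ := by gcongr; linarith
        _ = 2 * (X ^ (38 + 1))⁻¹ := by field_simp
        _ ≤ (X ^ 38)⁻¹ := mul_pow_inv_le hX 1 (by norm_num) 38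
    linarith

/-- Moves `Run.val` across a conditional, so that the unfolding equations of the loops reduce to
`rfl`. -/
theorem Run.ite_val {α : Type} (p : Prop) [Decidable p] (r₁ r₂ : Run d α) {v : α}
    (h : r₂.val = v) : (if p then r₁.val else v) = (if p then r₁ else r₂).val := by
  split_ifs
  · rfl
  · exact h.symm

theorem rhoSearch_succ (i : Init) (z x v : Vec d) (Ak : ℝ) (M : ℕ) (lo hi : ℝ)
    (last : Vec d × ℝ) : ((regressionInstance A b c).rhoSearch i z x v Ak (M + 1) lo hi last).val
      = if rhoZeta A b c i x v Ak ((lo + hi) / 2) + (regressionInstance A b c).tolRho i z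
          < (lo + hi) / 2 then
          ((regressionInstance A b c).rhoSearch i z x v Ak M lo ((lo + hi) / 2)
            (rhoPoint A b c x v Ak ((lo + hi) / 2)
              + auxApprox A b c i (rhoPoint A b c x v Ak ((lo + hi) / 2)),
              (regressionInstance A b c).stepSize Ak ((lo + hi) / 2))).val
        else if (lo + hi) / 2 < rhoZeta A b c i x v Ak ((lo + hi) / 2)
            - (regressionInstance A b c).tolRho i z then
          ((regressionInstance A b c).rhoSearch i z x v Ak M ((lo + hi) / 2) hi
            (rhoPoint A b c x v Ak ((lo + hi) / 2)
              + auxApprox A b c i (rhoPoint A b c x v Ak ((lo + hi) / 2)),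
              (regressionInstance A b c).stepSize Ak ((lo + hi) / 2))).val
        else ((lo + hi) / 2, rhoPoint A b c x v Ak ((lo + hi) / 2)
              + auxApprox A b c i (rhoPoint A b c x v Ak ((lo + hi) / 2)),
              (regressionInstance A b c).stepSize Ak ((lo + hi) / 2)) := by
  rw [← normB_auxApprox]
  refine Eq.trans ?_ (Run.ite_val _ _ _ (Run.ite_val _ _ (pure _) rfl).symm).symm
  rfl

/-- The sign conditions at both ends are invariant and the width halves. Since a valid bracket
cannot be shorter than `X⁻¹⁴⁵`, the search stops before its budget is spent. -/
theorem rhoSearch_spec (hA : (Aᵀ * A).PosDef) {X : ℝ} {z x v : Vec d} {i : Init} {Ak : ℝ}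
    (h : RunBounds A b c X z) (hi' : LoopBounds X i)
    (hx : x ∈ (regressionInstance A b c).setL z) (hv : v ∈ (regressionInstance A b c).setL z)
    (hAk : 0 ≤ Ak) (M : ℕ) : ∀ (lo hi : ℝ) (last : Vec d × ℝ), (X ^ 10)⁻¹ ≤ lo → lo ≤ hi →
    lo ≤ rhoZeta A b c i x v Ak lo - (regressionInstance A b c).tolRho i z →
    (hi = (regressionInstance A b c).parP z ∨
      rhoZeta A b c i x v Ak hi + (regressionInstance A b c).tolRho i z ≤ hi) →
    hi - lo < (X ^ 145)⁻¹ * 2 ^ M →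
    ∃ ρ, (X ^ 10)⁻¹ ≤ ρ ∧
      |ρ - rhoZeta A b c i x v Ak ρ| ≤ (regressionInstance A b c).tolRho i z ∧
      ((regressionInstance A b c).rhoSearch i z x v Ak M lo hi last).val.2
        = (rhoPoint A b c x v Ak ρ + auxApprox A b c i (rhoPoint A b c x v Ak ρ),
          (regressionInstance A b c).stepSize Ak ρ) := by
  induction M with
  | zero =>
    intro lo hi last h0 hle hlo hhi hw
    -- With no iterations left the bracket would be too short, so the default value `last` is never
    -- returned.
    have := rho_gap hA h hi' hx hv hAk h0 hle hlo hhi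
    rw [pow_zero, mul_one] at hw
    exact absurd this (not_le.2 hw)
  | succ M ih =>
    intro lo hi last h0 hle hlo hhi hw
    rw [rhoSearch_succ]
    set m := (lo + hi) / 2 with hm
    rw [pow_succ 2 M] at hw
    split_ifs with h1 h2
    · exact ih lo m _ h0 (by linarith) hlo (Or.inr h1.le) (by linarith)
    · exact ih m hi _ (by linarith) (by linarith) h2.le hhi (by linarith)
    · push Not at h1 h2
      exact ⟨m, by linarith, abs_le.2 ⟨by linarith, by linarith⟩, rfl⟩

end

section

variable {n d : ℕ} {A : Matrix (Fin n) (Fin d) ℝ} {b : Fin n → ℝ} {c : Fin d → ℝ}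

/-! ### Growth of `A_k` -/

/-- Convexity of `t⁵` with weights `p/(p+q)` and `q/(p+q)`. -/
theorem add_pow_five_le {x y p q : ℝ} (hx : 0 ≤ x) (hy : 0 ≤ y) (hp : 0 < p) (hq : 0 < q) :
    (x + y) ^ 5 ≤ (p + q) ^ 4 * (x ^ 5 / p ^ 4 + y ^ 5 / q ^ 4) := by
  have hx' : x * (p + q) / p ∈ Set.Ici (0 : ℝ) := Set.mem_Ici.2 (by positivity)
  have hy' : y * (p + q) / q ∈ Set.Ici (0 : ℝ) := Set.mem_Ici.2 (by positivity)
  have ha : 0 ≤ p / (p + q) := by positivity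
  have hb : 0 ≤ q / (p + q) := by positivity
  have hab : p / (p + q) + q / (p + q) = 1 := by field_simp
  have h := (convexOn_pow (𝕜 := ℝ) 5).2 hx' hy' ha hb hab
  simp only [smul_eq_mul] at h
  have e1 : p / (p + q) * (x * (p + q) / p) + q / (p + q) * (y * (p + q) / q) = x + y := by
    field_simp
  have e2 : p / (p + q) * (x * (p + q) / p) ^ 5 + q / (p + q) * (y * (p + q) / q) ^ 5
      = (p + q) ^ 4 * (x ^ 5 / p ^ 4 + y ^ 5 / q ^ 4) := by
    field_simp
  rw [e1, e2] at h
  exact h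

/-- The two-term Hölder inequality behind the growth of `A_k`. -/
theorem holder_step {Ak a ρ U S α : ℝ} (hA : 0 ≤ Ak) (ha : 0 < a) (hρ : 0 < ρ)
    (haρ : 24 * ρ * a ^ 2 = Ak + a) (hU : 0 ≤ U) (hS : 0 ≤ S) (hSU : S ^ 5 ≤ 9216 * U * Ak ^ 2)
    (hα : 0 ≤ α) (hα5 : α ^ 5 = Ak + a) :
    (S + α) ^ 5 ≤ 9216 * (U + (Ak + a) * ρ ^ 2) * (Ak + a) ^ 2 := by
  set q := 1 / (2 * √(24 * ρ)) with hq
  have hq0 : 0 < q := by positivity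
  have hqsq : q ^ 2 * (96 * ρ) = 1 := by
    rw [hq, div_pow, mul_pow, Real.sq_sqrt (by positivity)]; field_simp; norm_num
  have hq4 : q ^ 4 * (9216 * ρ ^ 2) = 1 := by
    calc q ^ 4 * (9216 * ρ ^ 2) = (q ^ 2 * (96 * ρ)) ^ 2 := by ring
      _ = 1 := by rw [hqsq, one_pow]
  set p := √Ak
  set p' := √(Ak + a)
  have hp : p ^ 2 = Ak := Real.sq_sqrt hA
  have hp' : p' ^ 2 = Ak + a := Real.sq_sqrt (by positivity)
  have hp0 : 0 ≤ p := Real.sqrt_nonneg _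
  have hp'0 : 0 < p' := Real.sqrt_pos.2 (by positivity)
  have hle : p ≤ p' := Real.sqrt_le_sqrt (by linarith)
  have haq : a = 2 * q * p' := by
    have : a ^ 2 = (2 * q * p') ^ 2 := by
      have : (2 * q * p') ^ 2 = 4 * q ^ 2 * (24 * ρ * a ^ 2) := by
        rw [mul_pow, hp', haρ]; ring
      rw [this]; linear_combination -a ^ 2 * hqsq
    exact (pow_left_inj₀ ha.le (by positivity) (by norm_num)).1 this
  -- From `24 ρ a² = A + a`: the difference of squares `p'² - p²` equals `a = 2 q p'`, and `p' + p ≤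
  -- 2 p'`. So the square root of `A` grows by at least `q`.
  have hgrow : p + q ≤ p' := by
    have h1 : (p' - p) * (p' + p) = 2 * q * p' := by rw [← haq]; linear_combination hp' - hp
    by_contra hlt
    push Not at hlt
    nlinarith
  have hα5' : α ^ 5 = 9216 * ((Ak + a) * ρ ^ 2) * q ^ 4 := by
    rw [hα5]; linear_combination -(Ak + a) * hq4
  have hp4 : (p + q) ^ 4 ≤ (Ak + a) ^ 2 := by
    rw [← hp', ← pow_mul]; exact pow_le_pow_left₀ (by positivity) hgrow 4
  have hT : 0 ≤ 9216 * (U + (Ak + a) * ρ ^ 2) := by positivity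
  suffices h : (S + α) ^ 5 ≤ (p + q) ^ 4 * (9216 * (U + (Ak + a) * ρ ^ 2)) by
    refine h.trans ?_
    rw [mul_comm]
    exact mul_le_mul_of_nonneg_left hp4 hT
  rcases hp0.eq_or_lt with h0 | h0
  · have hAk : Ak = 0 := by rw [← hp, ← h0]; norm_num
    have hS0 : S = 0 := by
      rw [hAk] at hSU
      have : S ^ 5 ≤ 0 := by simpa using hSU
      exact pow_eq_zero_iff (by norm_num) |>.1 (le_antisymm this (by positivity))
    rw [hS0, zero_add, hα5', ← h0, zero_add]
    have : 0 ≤ 9216 * U * q ^ 4 := by positivity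
    linarith
  · refine (add_pow_five_le hS hα h0 hq0).trans (mul_le_mul_of_nonneg_left ?_ (by positivity))
    have h1 : S ^ 5 / p ^ 4 ≤ 9216 * U := by
      rw [div_le_iff₀ (by positivity)]
      calc _ ≤ _ := hSU
        _ = _ := by rw [← hp]; ring
    have h2 : α ^ 5 / q ^ 4 = 9216 * ((Ak + a) * ρ ^ 2) := by
      rw [hα5']; field_simp
    rw [h2]; linarith

/-- The growth invariant after `m` steps, where `κ^10 = 576 D²` and `U` is the sum of the
quantities `A_k ρ_k²`. -/
def Growth (κ Ak U : ℝ) (m : ℕ) : Prop :=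
  ∃ T : ℝ, 0 ≤ T ∧ T ^ 10 ≤ 9216 * U * Ak ^ 2 ∧ m ≤ 2 * κ * T

/-- `T²` plays the role of `∑ A_j^{1/5}`, controlled by `holder_step`. The energy bound gives `T' ≤
κ α` for the new summand `α`; since `T'² - T² = α`, the number `T` increases by at least `1/(2κ)`
per iteration. -/
theorem Growth.step {κ Ak a ρ U : ℝ} {m : ℕ} (h : Growth κ Ak U m) (hκ : 0 < κ) (hA : 0 ≤ Ak)
    (ha : 0 < a) (hρ : 0 < ρ) (haρ : 24 * ρ * a ^ 2 = Ak + a) (hU : 0 ≤ U)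
    (hκU : 9216 * (U + (Ak + a) * ρ ^ 2) ≤ κ ^ 10) :
    Growth κ (Ak + a) (U + (Ak + a) * ρ ^ 2) (m + 1) := by
  obtain ⟨T, hT, hTU, hm⟩ := h
  set α := (Ak + a) ^ (1 / 5 : ℝ) with hα
  have hAa : 0 < Ak + a := by positivity
  have hα0 : 0 < α := Real.rpow_pos_of_pos hAa _
  have hα5 : α ^ 5 = Ak + a := by
    rw [hα, ← Real.rpow_natCast, ← Real.rpow_mul hAa.le]; norm_num
  have h1 := holder_step hA ha hρ haρ hU (sq_nonneg T) (by rw [← pow_mul]; exact hTU) hα0.le hα5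
  set T' := √(T ^ 2 + α) with hT'
  have hT'2 : T' ^ 2 = T ^ 2 + α := Real.sq_sqrt (by positivity)
  have hT'0 : 0 < T' := Real.sqrt_pos.2 (by positivity)
  have hT'10 : T' ^ 10 = (T ^ 2 + α) ^ 5 := by rw [← hT'2, ← pow_mul]
  refine ⟨T', hT'0.le, by rw [hT'10]; exact h1, ?_⟩
  have h2 : T' ≤ κ * α := by
    have : T' ^ 10 ≤ (κ * α) ^ 10 := by
      rw [hT'10]
      refine h1.trans ?_
      have : (κ * α) ^ 10 = κ ^ 10 * (Ak + a) ^ 2 := by rw [mul_pow, ← hα5]; ring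
      rw [this]
      exact mul_le_mul_of_nonneg_right hκU (by positivity)
    exact le_of_pow_le_pow_left₀ (by norm_num) (by positivity) this
  have h3 : T ≤ T' := abs_le_of_sq_le_sq' (by rw [hT'2]; linarith) hT'0.le |>.2
  have h4 : (T' - T) * (2 * T') ≥ α := by nlinarith
  have h5 : 1 ≤ 2 * κ * (T' - T) := by
    have : T' ≤ 2 * κ * (T' - T) * T' := by nlinarith
    by_contra hlt
    push Not at hlt
    nlinarith
  push_cast
  linarith

theorem Growth.pow_five_le {κ Ak U : ℝ} {m : ℕ} (h : Growth κ Ak U m) (hκ : 0 < κ)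
    (hA : 0 ≤ Ak) (hκU : 9216 * U ≤ κ ^ 10) : (m : ℝ) ^ 5 ≤ 32 * κ ^ 10 * Ak := by
  obtain ⟨T, hT, hTU, hm⟩ := h
  have h1 : T ^ 5 ≤ κ ^ 5 * Ak := by
    have : (T ^ 5) ^ 2 ≤ (κ ^ 5 * Ak) ^ 2 := by
      calc (T ^ 5) ^ 2 = T ^ 10 := by ring
        _ ≤ 9216 * U * Ak ^ 2 := hTU
        _ ≤ κ ^ 10 * Ak ^ 2 := mul_le_mul_of_nonneg_right hκU (sq_nonneg _)
        _ = _ := by ring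
    exact abs_le_of_sq_le_sq' this (by positivity) |>.2
  calc (m : ℝ) ^ 5 ≤ (2 * κ * T) ^ 5 := pow_le_pow_left₀ (by positivity) hm 5
    _ = 32 * κ ^ 5 * T ^ 5 := by ring
    _ ≤ 32 * κ ^ 5 * (κ ^ 5 * Ak) := mul_le_mul_of_nonneg_left h1 (by positivity)
    _ = _ := by ring

/-! ### The main loop -/

theorem mainLoop_succ (i : Init) (z : Vec d) (k : ℕ) (x : Vec d) (Ak : ℝ) (s : Vec d) :
    ((regressionInstance A b c).mainLoop i z (k + 1) x Ak s).val
      = let v := z - (regressionInstance A b c).B.inverse s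
        let y := rhoPoint A b c x v Ak i.rhoInit
        let out := ((regressionInstance A b c).rhoSearch i z x v Ak i.numRho i.rhoInit
          ((regressionInstance A b c).parP z) (x, 0)).val.2
        if (1 + (regressionInstance A b c).epsFs i z) * rhoZeta A b c i x v Ak i.rhoInit
            < i.rhoInit then y + auxApprox A b c i y
        else if rhoZeta A b c i x v Ak i.rhoInit
            - (regressionInstance A b c).parQ z * i.epsAam ^ (1 / 4 : ℝ) < i.rhoInit then
          y + auxApprox A b c i y
        else ((regressionInstance A b c).mainLoop i z k out.1 (Ak + out.2)
          (s + out.2 • gradient (regression A b c) out.1)).val := by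
  dsimp only
  rw [← normB_auxApprox]
  let rest : Run d (Vec d) := do
    let out ← (regressionInstance A b c).rhoSearch i z x
      (z - (regressionInstance A b c).B.inverse s) Ak i.numRho i.rhoInit
      ((regressionInstance A b c).parP z) (x, 0)
    let g ← gradOracle (regression A b c) out.2.1
    (regressionInstance A b c).mainLoop i z k out.2.1 (Ak + out.2.2) (s + out.2.2 • g)
  refine Eq.trans ?_ (Run.ite_val _ (pure _) _ (Run.ite_val _ (pure _) rest rfl).symm).symm
  rfl

theorem epsFs_nonneg (i : Init) (z : Vec d) (hi : 0 < i.rhoInit) :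
    0 ≤ (regressionInstance A b c).epsFs i z := by
  unfold Instance.epsFs
  refine le_min (div_nonneg (mul_nonneg (mul_nonneg ?_ ?_) hi.le) (mul_nonneg (by norm_num) ?_))
    (by norm_num)
  · rw [regressionInstance_L]; norm_num
  · refine Real.sSup_nonneg ?_
    rintro _ ⟨x, _, y, _, rfl⟩
    exact sq_nonneg _
  · refine Real.sSup_nonneg ?_
    rintro _ ⟨x, _, rfl⟩
    exact sq_nonneg _

/-- The invariant of the main loop after `m` iterations. -/
structure LoopInv (A : Matrix (Fin n) (Fin d) ℝ) (b : Fin n → ℝ) (c : Fin d → ℝ)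
    (z x : Vec d) (κ Ak : ℝ) (s : Vec d) (m : ℕ) : Prop where
  mem : x ∈ (regressionInstance A b c).setL z
  nonneg : 0 ≤ Ak
  energy : ∃ U, 0 ≤ U ∧ Growth κ Ak U m ∧
    Ak * (regression A b c x - regression A b c (regressionInstance A b c).xstar)
      + 1 / 2 * ‖img A (z - (regressionInstance A b c).B.inverse s
        - (regressionInstance A b c).xstar)‖ ^ 2 + 8 * U
      ≤ 1 / 2 * ‖img A (z - (regressionInstance A b c).xstar)‖ ^ 2

/-- An early return has gap at most `1/X` because the step was short. Otherwise both tests failed,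
so the lower end of the search interval satisfies its sign condition and `rhoSearch_spec` and
`lyapunov_step` apply. -/
theorem mainLoop_spec (hA : (Aᵀ * A).PosDef) (hn : 0 < n) {X κ : ℝ} {z : Vec d} {i : Init}
    (h : RunBounds A b c X z) (hi : LoopBounds X i) (hκ : 0 < κ)
    (hκ10 : κ ^ 10 = 576 * ‖img A (z - (regressionInstance A b c).xstar)‖ ^ 2) (k : ℕ) :
    ∀ (x : Vec d) (Ak : ℝ) (s : Vec d) (m : ℕ), LoopInv A b c z x κ Ak s m →
      regression A b c ((regressionInstance A b c).mainLoop i z k x Ak s).val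
          - regression A b c (regressionInstance A b c).xstar ≤ X⁻¹ ∨
        ∃ Ak' s', LoopInv A b c z ((regressionInstance A b c).mainLoop i z k x Ak s).val
          κ Ak' s' (m + k) := by
  have hX := h.two_le
  have hρp : 0 < (X ^ 10)⁻¹ := by positivity
  obtain ⟨tol1, tol2, tol3⟩ := tol_bounds h hi
  have p14 := mul_pow_inv_le hX (C := 10) 4 (by norm_num) 10
  norm_num at p14
  have hδ : (regressionInstance A b c).tolRho i z ≤ (X ^ 10)⁻¹ / 10 := by linarith
  induction k with
  | zero => exact fun x Ak s m hinv => Or.inr ⟨Ak, s, hinv⟩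
  | succ k ih =>
    intro x Ak s m hinv
    rw [mainLoop_succ]
    set xs := (regressionInstance A b c).xstar with hxs
    obtain ⟨hx, hAk, U, hU, hgr, hen⟩ := hinv
    set v := z - (regressionInstance A b c).B.inverse s with hvdef
    have hgap : 0 ≤ regression A b c x - regression A b c xs :=
      sub_nonneg.2 (regression_xstar_le b c hA hn x)
    -- All terms of the energy are nonnegative, so `v` is no farther from `x*` than the starting
    -- point of the run.
    have hv : v ∈ (regressionInstance A b c).setL z := by
      refine mem_setL_of_norm_le hA (abs_le_of_sq_le_sq' ?_ (norm_nonneg _) |>.2)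
      nlinarith [mul_nonneg hAk hgap]
    have hρi := hi.rhoInit
    have hρi0 : 0 < i.rhoInit := by rw [hρi]; exact hρp
    have hy := rhoPoint_mem hx hv hAk hρi0
    have hζ0 : 0 ≤ rhoZeta A b c i x v Ak i.rhoInit := sq_nonneg _
    have hshort : rhoZeta A b c i x v Ak i.rhoInit
        - (regressionInstance A b c).parQ z * i.epsAam ^ (1 / 4 : ℝ) < i.rhoInit →
        regression A b c (rhoPoint A b c x v Ak i.rhoInit
          + auxApprox A b c i (rhoPoint A b c x v Ak i.rhoInit)) - regression A b c xs ≤ X⁻¹ := by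
      intro h1
      refine gap_le_of_short hA h hi hy ?_
      change rhoZeta A b c i x v Ak i.rhoInit ≤ _
      rw [hρi] at h1 ⊢
      linarith
    have hQ : 0 ≤ (regressionInstance A b c).parQ z * i.epsAam ^ (1 / 4 : ℝ) := by
      have : 0 < (X ^ 37)⁻¹ := by positivity
      linarith
    dsimp only
    split_ifs with c1 c2
    · refine Or.inl (hshort ?_)
      have := mul_nonneg (epsFs_nonneg (A := A) (b := b) (c := c) i z hρi0) hζ0
      linarith
    · exact Or.inl (hshort c2)
    · push Not at c2
      have hP : rhoZeta A b c i x v Ak i.rhoInit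
          ≤ (regressionInstance A b c).parP z + (X ^ 57)⁻¹ := by
        have h1 := le_of_abs_le (abs_norm_sq_auxApprox_sub_le hA h hi hy)
        have h2 := h.sq_le_parP _ (auxMin_mem hA hy) _ hy
        rw [add_sub_cancel_left] at h2
        unfold rhoZeta; linarith
      have p57 : (X ^ 57)⁻¹ ≤ (X ^ 37)⁻¹ := pow_inv_le hX (by norm_num)
      obtain ⟨ρ, hρ0, hρζ, hout⟩ := rhoSearch_spec hA h hi hx hv hAk i.numRho i.rhoInit
        ((regressionInstance A b c).parP z) (x, 0) hρi.ge (by linarith) (by linarith)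
        (Or.inl rfl) (by
          have h1 : X ^ 3 ≤ (X ^ 145)⁻¹ * 2 ^ i.numRho := by
            calc X ^ 3 = (X ^ 145)⁻¹ * X ^ 148 := by field_simp
              _ ≤ _ := mul_le_mul_of_nonneg_left hi.rho (by positivity)
          have h2 : X ^ 2 < X ^ 3 := pow_lt_pow_right₀ (by linarith) (by norm_num)
          linarith [h.parP_le])
      rw [hout]
      have hρp' : 0 < ρ := hρp.trans_le hρ0
      have hy' := rhoPoint_mem hx hv hAk hρp'
      have hsm := smul_rhoPoint (A := A) (b := b) (c := c) (x := x) (v := v) hAk hρp'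
      set y' := rhoPoint A b c x v Ak ρ
      have hρ10 : |ρ - ‖img A (auxApprox A b c i y')‖ ^ 2| ≤ ρ / 10 := by
        have : |ρ - ‖img A (auxApprox A b c i y')‖ ^ 2| ≤ _ := hρζ
        linarith
      have hpos := stepSize_pos (A := A) (b := b) (c := c) (Ak := Ak) hρp'
      have hsq := mul_stepSize_sq (A := A) (b := b) (c := c) hAk hρp'
      have hmem' := auxApprox_mem hA h hi hy' hρ0 hρ10
      have hprox := proximal_auxApprox hA h hi hy' hρ0 hρ10
      set x' := y' + auxApprox A b c i y'
      set a := (regressionInstance A b c).stepSize Ak ρ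
      have e : auxApprox A b c i y' = x' - y' := by simp [x']
      rw [e] at hprox hρ10
      have hly := lyapunov_step hA xs x v y' x' hAk hpos hρp' hsq hsm
        (by linarith [(abs_le.1 hρ10).2]) hprox
      have e2 : z - (regressionInstance A b c).B.inverse
          (s + a • gradient (regression A b c) x') - xs
          = v - a • (regressionInstance A b c).B.inverse (gradient (regression A b c) x') - xs := by
        rw [hvdef, map_add, map_smul]; abel
      have hgap' : 0 ≤ regression A b c x' - regression A b c xs :=
        sub_nonneg.2 (regression_xstar_le b c hA hn x')
      have hAa : 0 < Ak + a := by positivity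
      have hstep := ih x' (Ak + a) (s + a • gradient (regression A b c) x') (m + 1)
        ⟨hmem', hAa.le, U + (Ak + a) * ρ ^ 2, by positivity,
          hgr.step hκ hAk hpos hρp' hsq hU (by
            rw [hκ10]
            nlinarith [mul_nonneg hAa.le hgap', sq_nonneg ‖img A (v -
              a • (regressionInstance A b c).B.inverse (gradient (regression A b c) x') - xs)‖]),
          by rw [← hxs, e2]; linarith⟩
      rw [show m + (k + 1) = m + 1 + k by ring]
      exact hstep

/-- One run of `FastQuartic` reaches the target accuracy or contracts the distance to the
minimizer. -/
theorem fastQuartic_spec (hA : (Aᵀ * A).PosDef) (hn : 0 < n) {X : ℝ} {z : Vec d} {i : Init}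
    (h : RunBounds A b c X z) (hi : LoopBounds X i)
    (hz : 0 < ‖img A (z - (regressionInstance A b c).xstar)‖)
    (hN : 2239488 * (n : ℝ) ≤ ((i.numIter + 1 : ℕ) : ℝ) ^ 5) :
    regression A b c ((regressionInstance A b c).fastQuartic i z).val
        - regression A b c (regressionInstance A b c).xstar ≤ X⁻¹ ∨
      3 * ‖img A (((regressionInstance A b c).fastQuartic i z).val
        - (regressionInstance A b c).xstar)‖
          ≤ ‖img A (z - (regressionInstance A b c).xstar)‖ := by
  set D := ‖img A (z - (regressionInstance A b c).xstar)‖ with hD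
  -- The energy gives `8 U ≤ D²/2`, hence `9216 U ≤ 576 D²`.
  set κ := (576 * D ^ 2) ^ (1 / 10 : ℝ) with hκdef
  have hκ : 0 < κ := Real.rpow_pos_of_pos (by positivity) _
  have hκ10 : κ ^ 10 = 576 * D ^ 2 := by
    rw [hκdef, ← Real.rpow_natCast, ← Real.rpow_mul (by positivity)]; norm_num
  have h0 : LoopInv A b c z z κ 0 0 0 :=
    ⟨mem_setL_of_norm_le hA le_rfl, le_rfl, 0, le_rfl, ⟨0, le_rfl, by norm_num, by norm_num⟩, by
      simp⟩
  rcases mainLoop_spec hA hn h hi hκ hκ10 (i.numIter + 1) z 0 0 0 h0 with h1 | ⟨Ak, s, h1⟩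
  · exact Or.inl h1
  · refine Or.inr ?_
    change LoopInv A b c z ((regressionInstance A b c).fastQuartic i z).val κ Ak s _ at h1
    set x := ((regressionInstance A b c).fastQuartic i z).val
    obtain ⟨-, hAk, U, hU, hgr, hen⟩ := h1
    have hgap : 0 ≤ regression A b c x - regression A b c (regressionInstance A b c).xstar :=
      sub_nonneg.2 (regression_xstar_le b c hA hn x)
    have hprod := mul_nonneg hAk hgap
    have hnn := sq_nonneg ‖img A (z - (regressionInstance A b c).B.inverse s
        - (regressionInstance A b c).xstar)‖
    rw [← hD] at hen
    have h5 := hgr.pow_five_le hκ hAk (by rw [hκ10]; linarith)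
    rw [hκ10, zero_add] at h5
    have h6 := norm_pow_four_le_gap b c hA hn x
    set g := regression A b c x - regression A b c (regressionInstance A b c).xstar
    set r := ‖img A (x - (regressionInstance A b c).xstar)‖
    have h7 : Ak * g ≤ 1 / 2 * D ^ 2 := by linarith
    -- The constant is `81 · 3 · 9216`: `81` for the contraction `3⁴`, `3` from the quartic growth
    -- `r⁴ ≤ 3 n g`, and `9216` from `32 · 576 / 2`.
    have h8 : 2239488 * (n : ℝ) * g ≤ 9216 * D ^ 4 := by
      calc 2239488 * (n : ℝ) * g ≤ (32 * (576 * D ^ 2) * Ak) * g :=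
            mul_le_mul_of_nonneg_right (hN.trans h5) hgap
        _ = 18432 * D ^ 2 * (Ak * g) := by ring
        _ ≤ 18432 * D ^ 2 * (1 / 2 * D ^ 2) := mul_le_mul_of_nonneg_left h7 (by positivity)
        _ = _ := by ring
    have h9 : (3 * r) ^ 4 ≤ D ^ 4 := by
      have : (3 * r) ^ 4 = 81 * r ^ 4 := by ring
      rw [this]; linarith
    exact le_of_pow_le_pow_left₀ (by norm_num) hz.le h9

end

section

variable {n d : ℕ} {A : Matrix (Fin n) (Fin d) ℝ} {b : Fin n → ℝ} {c : Fin d → ℝ}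

/-! ### The problem-dependent parameters -/

theorem isCompact_setL (hA : (Aᵀ * A).PosDef) (hn : 0 < n) (z : Vec d) :
    IsCompact ((regressionInstance A b c).setL z) := by
  set S := regressionInstance A b c
  set R := 3 * n * (S.maxF z - regression A b c S.xstar)
  refine (isCompact_img_ball hA S.xstar (max 1 R)).of_isClosed_subset ?_ fun x hx => ?_
  · exact isClosed_le (contDiff_regression A b c).continuous continuous_const
  · have h1 := norm_pow_four_le_gap b c hA hn x
    have hx' := mem_setL_iff.1 hx
    have h2 : ‖img A (x - S.xstar)‖ ^ 4 ≤ R := by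
      refine h1.trans ?_
      have hn' : (0 : ℝ) < n := by exact_mod_cast hn
      exact mul_le_mul_of_nonneg_left (by linarith) (by positivity)
    change ‖img A (x - S.xstar)‖ ≤ max 1 R
    by_contra hlt
    push Not at hlt
    have h3 : 1 < ‖img A (x - S.xstar)‖ := (le_max_left _ _).trans_lt hlt
    have h4 : R < ‖img A (x - S.xstar)‖ := (le_max_right _ _).trans_lt hlt
    have h5 : ‖img A (x - S.xstar)‖ ≤ ‖img A (x - S.xstar)‖ ^ 4 := le_self_pow₀ h3.le (by norm_num)
    linarith

theorem bddAbove_image2 {E : Type*} [TopologicalSpace E] {s : Set E} (hs : IsCompact s)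
    {f : E → E → ℝ} (hf : Continuous (Function.uncurry f)) : BddAbove (Set.image2 f s s) := by
  have := (hs.prod hs).bddAbove_image hf.continuousOn
  rwa [Set.image_uncurry_prod] at this

theorem sq_norm_le_parP (hA : (Aᵀ * A).PosDef) (hn : 0 < n) {z x y : Vec d}
    (hx : x ∈ (regressionInstance A b c).setL z) (hy : y ∈ (regressionInstance A b c).setL z) :
    ‖img A (x - y)‖ ^ 2 ≤ (regressionInstance A b c).parP z := by
  have hb : BddAbove (Set.image2 (fun x y => (regressionInstance A b c).normB (x - y) ^ 2)
      ((regressionInstance A b c).setL z) ((regressionInstance A b c).setL z)) := by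
    refine bddAbove_image2 (isCompact_setL hA hn z) ?_
    simp only [normB_eq]
    fun_prop
  have := le_csSup hb (Set.mem_image2_of_mem hx hy)
  rwa [normB_eq] at this

theorem continuous_normBinv : Continuous (regressionInstance A b c).normBinv := by
  unfold Instance.normBinv
  fun_prop

theorem sq_normBinv_le_parG (hA : (Aᵀ * A).PosDef) (hn : 0 < n) {z x : Vec d}
    (hx : x ∈ (regressionInstance A b c).setL z) :
    (regressionInstance A b c).normBinv (gradient (regression A b c) x) ^ 2
      ≤ (regressionInstance A b c).parG z := by
  refine le_csSup ?_ (Set.mem_image_of_mem _ hx)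
  have hc : Continuous fun x =>
      (regressionInstance A b c).normBinv (gradient (regression A b c) x) ^ 2 :=
    (continuous_normBinv.comp (contDiff_gradient (contDiff_regression A b c)).continuous).pow 2
  exact (isCompact_setL hA hn z).bddAbove_image hc.continuousOn

/-! ### The model -/

theorem model_eq (y x : Vec d) : (regressionInstance A b c).model y x
    = regression A b c y + auxModel A b c y (x - y) := by
  unfold Instance.model Instance.taylor auxModel auxD auxC
  rw [regressionInstance_L, regressionInstance_f, normB_eq, inner_hess, inner_third]
  have h1 : ∑ k, 12 * res A b y k ^ 2 * img A (x - y) k * img A (x - y) k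
      = 2 * ∑ k, 6 * res A b y k ^ 2 * img A (x - y) k ^ 2 := by
    rw [Finset.mul_sum]; exact Finset.sum_congr rfl fun k _ => by ring
  have h2 : ∑ k, 24 * res A b y k * img A (x - y) k * img A (x - y) k * img A (x - y) k
      = 6 * ∑ k, 4 * res A b y k * img A (x - y) k ^ 3 := by
    rw [Finset.mul_sum]; exact Finset.sum_congr rfl fun k _ => by ring
  rw [h1, h2]; ring

theorem auxModel_modelMin_le (hA : (Aᵀ * A).PosDef) (y h : Vec d) :
    auxModel A b c y ((regressionInstance A b c).modelMin y - y) ≤ auxModel A b c y h := by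
  have h1 : ∃ x, ∀ x', (regressionInstance A b c).model y x ≤ (regressionInstance A b c).model y x' :=
    ⟨y + auxMin A b c y, fun x' => by
      rw [model_eq, model_eq, add_sub_cancel_left]
      exact add_le_add le_rfl (auxModel_auxMin_le b c hA y _)⟩
  have h2 := argmin_le h1 (y + h)
  rw [model_eq, model_eq, add_sub_cancel_left] at h2
  exact le_of_add_le_add_left h2

theorem modelMin_mem (hA : (Aᵀ * A).PosDef) {z y : Vec d}
    (hy : y ∈ (regressionInstance A b c).setL z) :
    (regressionInstance A b c).modelMin y ∈ (regressionInstance A b c).setL z := by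
  rw [mem_setL_iff] at hy ⊢
  refine le_trans ?_ hy
  have h1 := regression_add_le_auxModel (A := A) b c y ((regressionInstance A b c).modelMin y - y)
  have h2 := auxModel_modelMin_le (A := A) (b := b) (c := c) hA y 0
  have h3 : auxModel A b c y 0 = 0 := by simp [auxModel]
  rw [add_sub_cancel] at h1
  have h4 : 0 ≤ ‖img A ((regressionInstance A b c).modelMin y - y)‖ ^ 4 := by positivity
  linarith

/-- At `x*` the gradient vanishes, so the model increment is at least `0.29 D ≥ 0` and `h = 0` is
its only minimizer. -/
theorem modelMin_xstar (hA : (Aᵀ * A).PosDef) (hn : 0 < n) :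
    (regressionInstance A b c).modelMin (regressionInstance A b c).xstar
      = (regressionInstance A b c).xstar := by
  set xs := (regressionInstance A b c).xstar
  have h2 := auxModel_modelMin_le (A := A) (b := b) (c := c) hA xs 0
  set h := (regressionInstance A b c).modelMin xs - xs with hh
  have h3 : auxModel A b c xs 0 = 0 := by simp [auxModel]
  have h4 := auxModel_ge (A := A) b c xs h
  rw [gradient_xstar b c hA hn, inner_zero_left] at h4
  have h5 := six_mul_norm_pow_four_le_auxD (res A b xs) (img A h)
  have h6 : ‖img A h‖ ^ 4 ≤ 0 := by linarith
  have h7 : img A h = 0 := by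
    rw [← norm_eq_zero]
    exact pow_eq_zero_iff (by norm_num) |>.1 (le_antisymm h6 (by positivity))
  have h8 : h = 0 := img_injective hA (by simpa using h7)
  exact sub_eq_zero.1 h8

theorem contDiff_gradient_param {E : Type*} [NormedAddCommGroup E] [NormedSpace ℝ E]
    {G : E → Vec d → ℝ} (hG : ContDiff ℝ (⊤ : ℕ∞) (Function.uncurry G)) :
    ContDiff ℝ (⊤ : ℕ∞) (Function.uncurry fun y t => gradient (G y) t) := by
  have h1 : ContDiff ℝ (⊤ : ℕ∞) fun p : E × Vec d => fderiv ℝ (G p.1) p.2 := by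
    refine ContDiff.fderiv (m := (⊤ : ℕ∞)) (f := fun (p : E × Vec d) t => G p.1 t) ?_ contDiff_snd
      (by simp)
    exact hG.comp ((contDiff_fst.comp contDiff_fst).prodMk contDiff_snd)
  exact (InnerProductSpace.toDual ℝ (Vec d)).symm.contDiff.comp h1

theorem contDiff_fderiv_param {E F : Type*} [NormedAddCommGroup E] [NormedSpace ℝ E]
    [NormedAddCommGroup F] [NormedSpace ℝ F]
    {G : E → Vec d → F} (hG : ContDiff ℝ (⊤ : ℕ∞) (Function.uncurry G)) :
    ContDiff ℝ (⊤ : ℕ∞) (Function.uncurry fun y t => fderiv ℝ (G y) t) := by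
  refine ContDiff.fderiv (m := (⊤ : ℕ∞)) (f := fun (p : E × Vec d) t => G p.1 t) ?_ contDiff_snd
    (by simp)
  exact hG.comp ((contDiff_fst.comp contDiff_fst).prodMk contDiff_snd)

theorem contDiff_model :
    ContDiff ℝ (⊤ : ℕ∞) (Function.uncurry (regressionInstance A b c).model) := by
  have h0 := contDiff_regression A b c
  have hg := contDiff_gradient h0
  have hh := contDiff_hess h0
  have ht : ContDiff ℝ (⊤ : ℕ∞) (fderiv ℝ (hess (regression A b c))) := hh.fderiv_right (by simp)
  have e : Function.uncurry (regressionInstance A b c).model = fun p : Vec d × Vec d =>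
      regression A b c p.1 + inner ℝ (gradient (regression A b c) p.1) (p.2 - p.1)
        + 1 / 2 * inner ℝ (hess (regression A b c) p.1 (p.2 - p.1)) (p.2 - p.1)
        + 1 / 6 * inner ℝ (fderiv ℝ (hess (regression A b c)) p.1 (p.2 - p.1) (p.2 - p.1))
          (p.2 - p.1) + 24 / 4 * (‖img A (p.2 - p.1)‖ ^ 2) ^ 2 := by
    funext p
    change (regressionInstance A b c).model p.1 p.2 = _
    unfold Instance.model Instance.taylor
    rw [normB_eq, ← pow_mul]
    rfl
  rw [e]
  have hd : ContDiff ℝ (⊤ : ℕ∞) fun p : Vec d × Vec d => p.2 - p.1 := contDiff_snd.sub contDiff_fst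
  refine ((((h0.comp contDiff_fst).add ((hg.comp contDiff_fst).inner ℝ hd)).add
    (contDiff_const.mul (((hh.comp contDiff_fst).clm_apply hd).inner ℝ hd))).add
    (contDiff_const.mul ((((ht.comp contDiff_fst).clm_apply hd).clm_apply hd).inner ℝ hd))).add
    (contDiff_const.mul ((((img A).contDiff.comp hd).norm_sq ℝ).pow 2))

theorem continuous_fnZ :
    Continuous (Function.uncurry (regressionInstance A b c).fnZ) := by
  have hg := (contDiff_gradient (contDiff_regression A b c)).continuous
  refine continuous_normBinv.comp ((hg.comp continuous_fst).add ?_)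
  simp only [normB_eq]
  fun_prop

theorem bddAbove_image_mul {E : Type*} [TopologicalSpace E] {s : Set E} (hs : IsCompact s)
    {f g h : E → ℝ} (hf : Continuous f) (hg : Continuous g) (hh : Continuous h) (r : ℝ) :
    BddAbove ((fun p => f p * (r * g p * r + h p)) '' s) :=
  hs.bddAbove_image (by fun_prop)

/-- Continuity of `T` is not needed: `T(y)` lies in the level set, so it is replaced by an
independent third variable ranging over that compact set. -/
theorem bddAbove_parW (hA : (Aᵀ * A).PosDef) (hn : 0 < n) (z : Vec d) :
    BddAbove (Set.image2 (fun x y =>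
      (regressionInstance A b c).fnZ x y * (regressionInstance A b c).fnW x y)
      ((regressionInstance A b c).setL z) ((regressionInstance A b c).setL z)) := by
  have hc := isCompact_setL (b := b) (c := c) hA hn z
  have h1 := contDiff_gradient_param (contDiff_model (A := A) (b := b) (c := c))
  have h2 := contDiff_fderiv_param h1
  have h3 := (contDiff_fderiv_param h2).continuous
  have h2 := h2.continuous
  have hp : Continuous fun p : Vec d × Vec d × Vec d => (p.2.1, p.2.2) := by fun_prop
  have hh : Continuous fun p : Vec d × Vec d × Vec d =>
      hess ((regressionInstance A b c).model p.2.1) p.2.2 := h2.comp hp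
  have ht : Continuous fun p : Vec d × Vec d × Vec d =>
      third ((regressionInstance A b c).model p.2.1) p.2.2 (p.1 - p.2.2) :=
    (h3.comp hp).clm_apply (by fun_prop)
  have hz := continuous_fnZ (A := A) (b := b) (c := c)
  have hn1 : Continuous fun p : Vec d × Vec d × Vec d =>
      ‖hess ((regressionInstance A b c).model p.2.1) p.2.2
        + (1 / 2 : ℝ) • third ((regressionInstance A b c).model p.2.1) p.2.2 (p.1 - p.2.2)‖ :=
    (hh.add (ht.const_smul (1 / 2 : ℝ))).norm
  have hn2 : Continuous fun p : Vec d × Vec d × Vec d =>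
      (regressionInstance A b c).L * (regressionInstance A b c).normB (p.1 - p.2.2) ^ 2 := by
    simp only [normB_eq]
    fun_prop
  have hF := bddAbove_image_mul (hc.prod (hc.prod hc)) (hz.comp (by fun_prop :
    Continuous fun p : Vec d × Vec d × Vec d => (p.1, p.2.1))) hn1 hn2
    ‖(regressionInstance A b c).B.inverse‖
  obtain ⟨C, hC⟩ := hF
  refine ⟨C, ?_⟩
  rintro _ ⟨x, hx, y, hy, rfl⟩
  have h := hC (Set.mem_image_of_mem _
    (Set.mk_mem_prod hx (Set.mk_mem_prod hy (modelMin_mem hA hy))))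
  beta_reduce at h ⊢
  unfold Instance.fnW
  exact h

/-! ### Bounds in terms of `Z / ε` -/

theorem xstar_mem (hA : (Aᵀ * A).PosDef) (z : Vec d) :
    (regressionInstance A b c).xstar ∈ (regressionInstance A b c).setL z :=
  mem_setL_of_norm_le hA (by rw [sub_self, map_zero, norm_zero]; exact norm_nonneg _)

theorem gap_le (hA : (Aᵀ * A).PosDef) (z : Vec d) : regression A b c z
    - regression A b c (regressionInstance A b c).xstar
      ≤ (regressionInstance A b c).normBinv (gradient (regression A b c) z)
        * ‖img A (z - (regressionInstance A b c).xstar)‖ := by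
  have h1 := inner_gradient_le A b c z (regressionInstance A b c).xstar
  have h2 := abs_inner_le_normBinv b c hA (gradient (regression A b c) z)
    (z - (regressionInstance A b c).xstar)
  rw [← neg_sub z, inner_neg_right] at h1
  linarith [le_of_abs_le h2]

section bounds

variable (hA : (Aᵀ * A).PosDef) (hn : 0 < n) {z : Vec d} {ε : ℝ}

include hA hn

/-- The pair `(z, x*)` is inserted into the maximum defining `W`. Convexity gives `Z(z, x*) D ≥ ε`,
and `T(x*) = x*` gives `W(z, x*) ≥ 24 D²`. This product bound is what later controls the diameter.
-/
theorem parV_ge (hε : 0 ≤ ε) (hgap : ε ≤ regression A b c z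
      - regression A b c (regressionInstance A b c).xstar)
    (hD : 0 < ‖img A (z - (regressionInstance A b c).xstar)‖) :
    ε * ‖img A (z - (regressionInstance A b c).xstar)‖ * (regressionInstance A b c).parP z
      ≤ (regressionInstance A b c).parV z := by
  have hz : z ∈ (regressionInstance A b c).setL z := mem_setL_of_norm_le hA le_rfl
  have hW : (regressionInstance A b c).fnZ z (regressionInstance A b c).xstar
      * (regressionInstance A b c).fnW z (regressionInstance A b c).xstar
      ≤ (regressionInstance A b c).parW z :=
    le_csSup (bddAbove_parW hA hn z) (Set.mem_image2_of_mem hz (xstar_mem hA z))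
  have hP := (sq_nonneg _).trans (sq_norm_le_parP (b := b) (c := c) hA hn hz hz)
  set S := regressionInstance A b c with hS
  set D := ‖img A (z - S.xstar)‖ with hDdef
  have hfW : 24 * D ^ 2 ≤ S.fnW z S.xstar := by
    unfold Instance.fnW
    rw [hS, modelMin_xstar hA hn, normB_eq, regressionInstance_L]
    exact le_add_of_nonneg_left (by positivity)
  have hfZ : ε ≤ S.fnZ z S.xstar * D := by
    have h1 := le_of_abs_le (abs_inner_le_normBinv b c hA
      (gradient S.f z + (S.L * S.normB (z - S.xstar) ^ 2) • S.B (z - S.xstar)) (z - S.xstar))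
    refine le_trans ?_ h1
    rw [inner_add_left, real_inner_smul_left]
    have h2 : inner ℝ (S.B (z - S.xstar)) (z - S.xstar) = D ^ 2 := by
      rw [hDdef, ← real_inner_self_eq_norm_sq, ← inner_gram]; rfl
    have h3 := inner_gradient_le A b c z S.xstar
    rw [← neg_sub z, inner_neg_right] at h3
    have h4 : 0 ≤ S.L * S.normB (z - S.xstar) ^ 2 * D ^ 2 := by
      have : S.L = 24 := rfl
      rw [this]; positivity
    rw [h2]
    change ε ≤ inner ℝ (gradient (regression A b c) z) (z - S.xstar) + _
    linarith
  have hfZ0 : 0 ≤ S.fnZ z S.xstar := Real.sqrt_nonneg _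
  have h5 : 24 * ε * D ≤ S.parW z := by
    refine le_trans ?_ hW
    calc 24 * ε * D = ε * (24 * D) := by ring
      _ ≤ (S.fnZ z S.xstar * D) * (24 * D) := mul_le_mul_of_nonneg_right hfZ (by positivity)
      _ = S.fnZ z S.xstar * (24 * D ^ 2) := by ring
      _ ≤ _ := mul_le_mul_of_nonneg_left hfW hfZ0
  unfold Instance.parV
  have hL : S.L ^ (1 / 4 : ℝ) ≤ 24 := by
    rw [hS, regressionInstance_L]
    calc (24 : ℝ) ^ (1 / 4 : ℝ) ≤ (24 : ℝ) ^ (1 : ℝ) :=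
          Real.rpow_le_rpow_of_exponent_le (by norm_num) (by norm_num)
      _ = 24 := Real.rpow_one _
  have hL0 : 0 < S.L ^ (1 / 4 : ℝ) := by
    rw [hS, regressionInstance_L]; positivity
  rw [le_div_iff₀ hL0]
  have hεDP : 0 ≤ ε * D * S.parP z := by positivity
  calc ε * D * S.parP z * S.L ^ (1 / 4 : ℝ) ≤ ε * D * S.parP z * 24 :=
        mul_le_mul_of_nonneg_left hL hεDP
    _ ≤ 6 * (24 * ε * D) * S.parP z := by linarith
    _ ≤ _ := by gcongr

/-- The Hessian at the minimizer is bounded by the gradients on the level set. -/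
theorem hess_xstar_le {g : ℝ} (hD : 0 < ‖img A (z - (regressionInstance A b c).xstar)‖)
    (hg : ∀ y ∈ (regressionInstance A b c).setL z, ∀ v,
      |inner ℝ (gradient (regression A b c) y) v| ≤ g * ‖img A v‖) (h : Vec d) :
    ∑ k, 12 * res A b (regressionInstance A b c).xstar k ^ 2 * img A h k ^ 2
      ≤ 2 * (g / ‖img A (z - (regressionInstance A b c).xstar)‖) * ‖img A h‖ ^ 2 := by
  set xs := (regressionInstance A b c).xstar with hxs
  set D := ‖img A (z - xs)‖ with hDdef
  rcases (norm_nonneg (img A h)).eq_or_lt with h0 | h0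
  · have : img A h = 0 := norm_eq_zero.1 h0.symm
    simp [this]
  set t := D / ‖img A h‖ with ht
  have ht0 : 0 < t := div_pos hD h0
  have hn1 : ‖img A (t • h)‖ = D := by
    rw [map_smul, norm_smul, Real.norm_of_nonneg ht0.le, ht]; field_simp
  -- The two antipodal points at distance `D` from `x*` lie in the level set, where convexity bounds
  -- each increase of `f` by `g D`. In the sum of the increases the cubic terms cancel, leaving `t²`
  -- times the Hessian form plus a nonnegative quartic.
  have m1 : xs + t • h ∈ (regressionInstance A b c).setL z :=
    mem_setL_of_norm_le hA (by rw [← hxs, add_sub_cancel_left, hn1])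
  have m2 : xs + -(t • h) ∈ (regressionInstance A b c).setL z :=
    mem_setL_of_norm_le hA (by rw [← hxs, add_sub_cancel_left, map_neg, norm_neg, hn1])
  have g1 := le_of_abs_le (hg _ m1 (t • h))
  have g2 := le_of_abs_le (hg _ m2 (-(t • h)))
  rw [map_neg, norm_neg, hn1] at g2
  rw [hn1] at g1
  have c1 := inner_gradient_le A b c (xs + t • h) xs
  have c2 := inner_gradient_le A b c (xs + -(t • h)) xs
  have e1 : xs - (xs + t • h) = -(t • h) := by abel
  have e2 : xs - (xs + -(t • h)) = -(-(t • h)) := by abel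
  rw [e1, inner_neg_right] at c1
  rw [e2, inner_neg_right _ (-(t • h))] at c2
  have f1 := regression_add A b c xs (t • h)
  have f2 := regression_add A b c xs (-(t • h))
  rw [hxs, gradient_xstar b c hA hn, ← hxs, inner_zero_left] at f1 f2
  have s : ∑ k, (6 * res A b xs k ^ 2 * img A (t • h) k ^ 2
        + 4 * res A b xs k * img A (t • h) k ^ 3 + img A (t • h) k ^ 4)
      + ∑ k, (6 * res A b xs k ^ 2 * img A (-(t • h)) k ^ 2
        + 4 * res A b xs k * img A (-(t • h)) k ^ 3 + img A (-(t • h)) k ^ 4)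
      = t ^ 2 * ∑ k, 12 * res A b xs k ^ 2 * img A h k ^ 2
        + ∑ k, 2 * (t * img A h k) ^ 4 := by
    rw [← Finset.sum_add_distrib, Finset.mul_sum, ← Finset.sum_add_distrib]
    refine Finset.sum_congr rfl fun k _ => ?_
    simp only [map_neg, map_smul, PiLp.neg_apply, PiLp.smul_apply, smul_eq_mul]
    ring
  have s2 : 0 ≤ ∑ k, 2 * (t * img A h k) ^ 4 := Finset.sum_nonneg fun k _ => by positivity
  have h1 : t ^ 2 * ∑ k, 12 * res A b xs k ^ 2 * img A h k ^ 2 ≤ 2 * (g * D) := by linarith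
  have h2 : 2 * (g / D) * ‖img A h‖ ^ 2 = 2 * (g * D) / t ^ 2 := by
    rw [ht]; field_simp
  rw [h2, le_div_iff₀ (by positivity)]
  linarith

/-- A gap above `ε` prevents the distance `D` to `x*` from being too small relative to `X`; the
entries `G` and `V` of `Z` then suffice. The Hessian is bounded at `x*` first and transported by the
diameter. -/
theorem RunBounds.of_gap (hε : 0 < ε) (hgap : ε < regression A b c z
      - regression A b c (regressionInstance A b c).xstar) :
    RunBounds A b c (2 + (regressionInstance A b c).parZ z / ε) z ∧
      (2 + (regressionInstance A b c).parZ z / ε)⁻¹ ≤ ε := by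
  have hz : z ∈ (regressionInstance A b c).setL z := mem_setL_of_norm_le hA le_rfl
  have hD : 0 < ‖img A (z - (regressionInstance A b c).xstar)‖ := by
    by_contra hlt
    have h0 : ‖img A (z - (regressionInstance A b c).xstar)‖ = 0 :=
      le_antisymm (not_lt.1 hlt) (norm_nonneg _)
    have := gap_le (A := A) (b := b) (c := c) hA z
    rw [h0, mul_zero] at this
    linarith
  have hV := parV_ge hA hn hε.le hgap.le hD
  have hZV : (regressionInstance A b c).parV z ≤ (regressionInstance A b c).parZ z := by
    unfold Instance.parZ; simp
  have hZL : 24 ≤ (regressionInstance A b c).parZ z := by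
    have : (regressionInstance A b c).L ≤ (regressionInstance A b c).parZ z := by
      unfold Instance.parZ; simp
    exact this
  have hZG : (regressionInstance A b c).parG z ≤ (regressionInstance A b c).parZ z := by
    unfold Instance.parZ; simp
  set D := ‖img A (z - (regressionInstance A b c).xstar)‖ with hDdef
  set Z := (regressionInstance A b c).parZ z
  set X := 2 + Z / ε with hXdef
  have hX : 2 ≤ X := le_add_of_nonneg_right (by positivity)
  have hX0 : 0 < X := by linarith
  have hεX : Z ≤ ε * X := by
    rw [hXdef, mul_add, mul_div_cancel₀ _ hε.ne']; linarith
  set g := √((regressionInstance A b c).parG z)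
  have hG : ∀ y ∈ (regressionInstance A b c).setL z,
      (regressionInstance A b c).normBinv (gradient (regression A b c) y) ≤ g := fun y hy =>
    Real.le_sqrt_of_sq_le (sq_normBinv_le_parG hA hn hy)
  have hg2 : g ^ 2 ≤ ε * X := by
    have := sq_normBinv_le_parG (b := b) (c := c) hA hn hz
    rw [Real.sq_sqrt ((sq_nonneg _).trans this)]
    linarith
  have hg0 : 0 ≤ g := Real.sqrt_nonneg _
  have hgD : ε < g * D := hgap.trans_le ((gap_le hA z).trans
    (mul_le_mul_of_nonneg_right (hG z hz) hD.le))
  have hgpos : 0 < g := by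
    by_contra hlt
    have : g = 0 := le_antisymm (not_lt.1 hlt) hg0
    rw [this, zero_mul] at hgD
    linarith
  -- Dividing `g² ≤ ε X` by `ε < g D` gives `g ≤ X D`. Together with `1 ≤ ε X` this yields `X D ≥
  -- 1`, and then `D P ≤ X`, which comes from `V`, becomes `P ≤ X²`.
  have hgDX : g ≤ X * D := by
    have h1 : g * g ≤ g * (X * D) := by
      calc g * g = g ^ 2 := by ring
        _ ≤ ε * X := hg2
        _ ≤ (g * D) * X := mul_le_mul_of_nonneg_right hgD.le hX0.le
        _ = _ := by ring
    exact le_of_mul_le_mul_left h1 hgpos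
  have hεX1 : 1 ≤ ε * X := by linarith
  have hXD : 1 ≤ X * D := by
    have h1 : 1 ≤ (X * D) ^ 2 := by
      calc 1 ≤ ε * X := hεX1
        _ ≤ (g * D) * X := mul_le_mul_of_nonneg_right hgD.le hX0.le
        _ ≤ ((X * D) * D) * X := by gcongr
        _ = _ := by ring
    by_contra hlt
    push Not at hlt
    have : (X * D) ^ 2 < 1 := pow_lt_one₀ (by positivity) hlt (by norm_num)
    linarith
  have hP0 : D ^ 2 ≤ (regressionInstance A b c).parP z :=
    sq_norm_le_parP hA hn hz (xstar_mem hA z)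
  set P := (regressionInstance A b c).parP z
  have hPnn : 0 ≤ P := (sq_nonneg D).trans hP0
  have hDP : D * P ≤ X := by
    have : ε * (D * P) ≤ ε * X := by linarith
    exact le_of_mul_le_mul_left this hε
  have hP : P ≤ X ^ 2 := by
    calc P = 1 * P := (one_mul P).symm
      _ ≤ (X * D) * P := mul_le_mul_of_nonneg_right hXD hPnn
      _ = X * (D * P) := by ring
      _ ≤ X * X := mul_le_mul_of_nonneg_left hDP hX0.le
      _ = _ := by ring
  have hDX : D ≤ X := abs_le_of_sq_le_sq' (hP0.trans hP) hX0.le |>.2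
  have hgX : g ≤ X ^ 2 := by
    calc g ≤ X * D := hgDX
      _ ≤ X * X := mul_le_mul_of_nonneg_left hDX hX0.le
      _ = _ := by ring
  have hgrad : ∀ y ∈ (regressionInstance A b c).setL z, ∀ v,
      |inner ℝ (gradient (regression A b c) y) v| ≤ g * ‖img A v‖ := fun y hy v =>
    (abs_inner_le_normBinv b c hA _ v).trans
      (mul_le_mul_of_nonneg_right (hG y hy) (norm_nonneg _))
  refine ⟨⟨hX, fun x hx y hy => sq_norm_le_parP hA hn hx hy, hP, fun y hy h => ?_,
    fun y hy v => (hgrad y hy v).trans (mul_le_mul_of_nonneg_right hgX (norm_nonneg _))⟩, ?_⟩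
  · have h1 := hess_xstar_le hA hn hD hgrad h
    rw [← hDdef] at h1
    have h2 := sum_sq_mul_sq_le (img A (y - (regressionInstance A b c).xstar)) (img A h)
    have h3 := sq_norm_le_parP hA hn hy (xstar_mem hA z)
    have h4 : ∑ k, 12 * res A b y k ^ 2 * img A h k ^ 2
        ≤ 2 * ∑ k, 12 * res A b (regressionInstance A b c).xstar k ^ 2 * img A h k ^ 2
          + 24 * ∑ k, img A (y - (regressionInstance A b c).xstar) k ^ 2 * img A h k ^ 2 := by
      rw [Finset.mul_sum, Finset.mul_sum, ← Finset.sum_add_distrib]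
      refine Finset.sum_le_sum fun k _ => ?_
      have e := res_add A b (regressionInstance A b c).xstar
        (y - (regressionInstance A b c).xstar) k
      rw [add_sub_cancel] at e
      rw [e]
      nlinarith [mul_nonneg (sq_nonneg (res A b (regressionInstance A b c).xstar k
        - img A (y - (regressionInstance A b c).xstar) k)) (sq_nonneg (img A h k))]
    have h5 : g / D ≤ X := by rw [div_le_iff₀ hD]; exact hgDX
    have h6 := mul_le_mul_of_nonneg_right h5 (sq_nonneg ‖img A h‖)
    have h7 := mul_le_mul_of_nonneg_right (h3.trans hP) (sq_nonneg ‖img A h‖)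
    have h8 : 4 * X + 24 * X ^ 2 ≤ X ^ 7 := by
      have q : ∀ m : ℕ, 2 * X ^ m ≤ X * X ^ m := fun m =>
        mul_le_mul_of_nonneg_right hX (by positivity)
      linarith [q 1, q 2, q 3, q 4, q 5, q 6]
    have h9 := mul_le_mul_of_nonneg_right h8 (sq_nonneg ‖img A h‖)
    linarith
  · rw [inv_le_comm₀ hX0 hε, ← one_div, div_le_iff₀ hε]
    linarith

end bounds

end

section

variable {n d : ℕ} {A : Matrix (Fin n) (Fin d) ℝ} {b : Fin n → ℝ} {c : Fin d → ℝ}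

/-! ### Oracle calls -/

/-- The run `r` makes at most `m` oracle calls, and its systems satisfy `Q`. -/
def Run.Within {α : Type} (Q : Op d → Prop) (m : ℕ) (r : Run d α) : Prop :=
  r.gradCalls + r.solverCalls ≤ m ∧ ∀ M ∈ r.systems, Q M

theorem Run.Within.mono {α : Type} {Q : Op d → Prop} {m m' : ℕ} {r : Run d α}
    (h : r.Within Q m) (hm : m ≤ m') : r.Within Q m' :=
  ⟨h.1.trans hm, h.2⟩

theorem Run.within_pure {α : Type} (Q : Op d → Prop) (a : α) :
    (pure a : Run d α).Within Q 0 :=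
  ⟨le_rfl, fun _ h => absurd h List.not_mem_nil⟩

theorem Run.Within.bind {α β : Type} {Q : Op d → Prop} {m m' : ℕ} {r : Run d α}
    {k : α → Run d β} (hr : r.Within Q m) (hk : (k r.val).Within Q m') :
    (r >>= k).Within Q (m + m') := by
  refine ⟨?_, fun M hM => ?_⟩
  · have h1 := hr.1
    have h2 := hk.1
    change (r.gradCalls + (k r.val).gradCalls) + (r.systems ++ (k r.val).systems).length ≤ m + m'
    rw [List.length_append]
    unfold Run.solverCalls at h1 h2
    omega
  · rcases List.mem_append.1 (show M ∈ r.systems ++ (k r.val).systems from hM) with h | h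
    · exact hr.2 M h
    · exact hk.2 M h

theorem within_gradOracle (Q : Op d → Prop) (f : Vec d → ℝ) (x : Vec d) :
    (gradOracle f x).Within Q 1 :=
  ⟨le_rfl, fun _ h => absurd h List.not_mem_nil⟩

theorem within_linSolve {Q : Op d → Prop} {M : Op d} (hM : Q M) (r : Vec d) :
    (linSolve M r).Within Q 1 :=
  ⟨le_rfl, fun M' h => by
    rw [show (linSolve M r).systems = [M] from rfl, List.mem_singleton] at h
    exact h ▸ hM⟩

/-- The matrices `Aᵀ D A` with `D` diagonal and positive. -/
def IsWeightedGram (A : Matrix (Fin n) (Fin d) ℝ) (M : Op d) : Prop :=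
  ∃ w : Fin n → ℝ, (∀ k, 0 < w k) ∧ M = weightedGram A w

theorem isWeightedGram_B : IsWeightedGram A (regressionInstance A b c).B :=
  ⟨fun _ => 1, fun _ => one_pos, (weightedGram_one A).symm⟩

theorem isWeightedGram_dualMatrix (y : Vec d) {t : ℝ} (ht : 0 < t) :
    IsWeightedGram A ((regressionInstance A b c).dualMatrix y t) :=
  ⟨_, fun _ => by positivity, dualMatrix_eq b c y t⟩

theorem dualSearch_val_pos (y g : Vec d) (J : ℕ) : ∀ lo hi : ℝ, 0 ≤ lo → lo < hi →
    0 < ((regressionInstance A b c).dualSearch y g J lo hi).val := by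
  induction J with
  | zero => exact fun lo hi h0 h1 => h0.trans_lt h1
  | succ J ih =>
    intro lo hi h0 h1
    rw [dualSearch_succ]
    split_ifs
    · exact ih _ _ h0 (by linarith)
    · exact ih _ _ (by linarith) (by linarith)

theorem within_dualSearch (y g : Vec d) (J : ℕ) : ∀ lo hi : ℝ, 0 ≤ lo → lo < hi →
    ((regressionInstance A b c).dualSearch y g J lo hi).Within (IsWeightedGram A) J := by
  induction J with
  | zero => exact fun lo hi _ _ => Run.within_pure _ _
  | succ J ih =>
    intro lo hi h0 h1
    refine Run.Within.mono (m := 1 + J) (Run.Within.bind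
      (within_linSolve (isWeightedGram_dualMatrix y (by linarith)) g) ?_) (by omega)
    split_ifs
    · exact ih _ _ h0 (by linarith)
    · exact ih _ _ (by linarith) (by linarith)

/-- Besides the `J` bisection solves there are four gradients, the solve for `‖g‖_{B⁻¹}` and the
final solve. Positivity of `t` makes every weight positive. -/
theorem within_auxStep (hA : (Aᵀ * A).PosDef) (J : ℕ) (y h : Vec d) :
    ((regressionInstance A b c).auxStep J y h).Within (IsWeightedGram A) (J + 6) := by
  refine Run.Within.mono (m := 1 + (1 + (1 + (1 + (1 + (J + (1 + 0))))))) ?_ (by omega)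
  refine (within_gradOracle _ _ _).bind ((within_gradOracle _ _ _).bind
    ((within_gradOracle _ _ _).bind ((within_gradOracle _ _ _).bind
    ((within_linSolve isWeightedGram_B _).bind
    ((within_dualSearch _ _ _ _ _ le_rfl ?_).bind
    ((within_linSolve (isWeightedGram_dualMatrix _ ?_) _).bind (Run.within_pure _ _)))))))
  · exact dualUpper_pos b c hA _
  · exact dualSearch_val_pos _ _ _ _ _ le_rfl (dualUpper_pos b c hA _)

theorem within_auxIter (hA : (Aᵀ * A).PosDef) (J : ℕ) (y : Vec d) (K : ℕ) :
    ((regressionInstance A b c).auxIter J y K).Within (IsWeightedGram A) (K * (J + 6)) := by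
  induction K with
  | zero => exact (Run.within_pure _ _).mono (by omega)
  | succ K ih => exact (ih.bind (within_auxStep hA J y _)).mono (by rw [Nat.succ_mul])

theorem within_approxAuxMin (hA : (Aᵀ * A).PosDef) (i : Init) (y : Vec d) :
    ((regressionInstance A b c).approxAuxMin i y).Within (IsWeightedGram A)
      (i.numAux * (i.numDual + 6)) :=
  (within_auxIter hA i.numDual y i.numAux).bind (Run.within_pure _ _)

theorem within_rhoSearch (hA : (Aᵀ * A).PosDef) (i : Init) (z x v : Vec d) (Ak : ℝ) (M : ℕ) :
    ∀ (lo hi : ℝ) (last : Vec d × ℝ),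
      ((regressionInstance A b c).rhoSearch i z x v Ak M lo hi last).Within (IsWeightedGram A)
        (M * (i.numAux * (i.numDual + 6))) := by
  induction M with
  | zero => exact fun lo hi last => (Run.within_pure _ _).mono (by omega)
  | succ M ih =>
    intro lo hi last
    refine Run.Within.mono ((within_approxAuxMin hA i _).bind ?_)
      (by rw [Nat.succ_mul, add_comm])
    split_ifs
    · exact ih _ _ _
    · exact ih _ _ _
    · exact (Run.within_pure _ _).mono (by omega)

/-- A bound for the number of oracle calls in one iteration of the main loop. -/
def Init.callsPerIter (i : Init) : ℕ :=
  2 + (i.numRho + 1) * (i.numAux * (i.numDual + 6))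

theorem within_mainLoop (hA : (Aᵀ * A).PosDef) (i : Init) (z : Vec d) (k : ℕ) :
    ∀ (x : Vec d) (Ak : ℝ) (s : Vec d),
      ((regressionInstance A b c).mainLoop i z k x Ak s).Within (IsWeightedGram A)
        (k * i.callsPerIter) := by
  induction k with
  | zero => exact fun x Ak s => (Run.within_pure _ _).mono (by omega)
  | succ k ih =>
    intro x Ak s
    refine Run.Within.mono ((within_linSolve isWeightedGram_B _).bind
      ((within_approxAuxMin hA i _).bind
      (m' := i.numRho * (i.numAux * (i.numDual + 6)) + (1 + k * i.callsPerIter)) ?_)) ?_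
    · split_ifs
      · exact (Run.within_pure _ _).mono (by omega)
      · exact (Run.within_pure _ _).mono (by omega)
      · exact (within_rhoSearch hA i _ _ _ _ _ _ _ _).bind
          ((within_gradOracle _ _ _).bind (ih _ _ _))
    · rw [Nat.succ_mul]
      unfold Init.callsPerIter
      rw [Nat.succ_mul]
      omega

theorem within_restarted (hA : (Aᵀ * A).PosDef) (i : Init) (r : ℕ) : ∀ x : Vec d,
    ((regressionInstance A b c).restarted i r x).Within (IsWeightedGram A)
      (r * ((i.numIter + 1) * i.callsPerIter)) := by
  induction r with
  | zero => exact fun x => (Run.within_pure _ _).mono (by omega)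
  | succ r ih =>
    intro x
    refine Run.Within.mono ((within_mainLoop hA i x _ x 0 0).bind (ih _)) ?_
    rw [Nat.succ_mul r, add_comm]

/-! ### Restarts -/

/-- This is why the contraction factor is three: for `x` in the new set `K`, `‖x - z‖ ≤ 2 D' + D' +
D ≤ 2 D`, so the sets `K` are nested. -/
theorem maxF_le_maxF (hA : (Aᵀ * A).PosDef) {z z' : Vec d}
    (hz : 3 * ‖img A (z' - (regressionInstance A b c).xstar)‖
      ≤ ‖img A (z - (regressionInstance A b c).xstar)‖) :
    (regressionInstance A b c).maxF z' ≤ (regressionInstance A b c).maxF z := by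
  refine csSup_le_csSup (bddAbove_image_setK hA z)
    ⟨_, Set.mem_image_of_mem _ (mem_setK_iff (x := z') |>.2 ?_)⟩ (Set.image_mono fun x hx => ?_)
  · rw [sub_self, map_zero, norm_zero]; positivity
  · rw [mem_setK_iff] at hx ⊢
    have e : x - z = (x - z') + ((z' - (regressionInstance A b c).xstar)
        - (z - (regressionInstance A b c).xstar)) := by abel
    rw [e, map_add, map_sub (img A) (z' - _) (z - _)]
    have h1 := norm_add_le (img A (x - z')) (img A (z' - (regressionInstance A b c).xstar)
      - img A (z - (regressionInstance A b c).xstar))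
    have h2 := norm_sub_le (img A (z' - (regressionInstance A b c).xstar))
      (img A (z - (regressionInstance A b c).xstar))
    linarith

theorem RunBounds.of_contract (hA : (Aᵀ * A).PosDef) (hn : 0 < n) {X : ℝ} {z z' : Vec d}
    (h : RunBounds A b c X z)
    (hz : 3 * ‖img A (z' - (regressionInstance A b c).xstar)‖
      ≤ ‖img A (z - (regressionInstance A b c).xstar)‖) : RunBounds A b c X z' := by
  have hL : ∀ x ∈ (regressionInstance A b c).setL z', x ∈ (regressionInstance A b c).setL z :=
    fun x hx => mem_setL_iff.2 ((mem_setL_iff.1 hx).trans (maxF_le_maxF hA hz))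
  have hz' : z' ∈ (regressionInstance A b c).setL z' := mem_setL_of_norm_le hA le_rfl
  refine ⟨h.two_le, fun x hx y hy => sq_norm_le_parP hA hn hx hy, ?_,
    fun y hy => h.hess_le y (hL y hy), fun y hy => h.grad_le y (hL y hy)⟩
  refine csSup_le ⟨_, Set.mem_image2_of_mem hz' hz'⟩ ?_
  rintro _ ⟨x, hx, y, hy, rfl⟩
  beta_reduce
  rw [normB_eq]
  exact (h.sq_le_parP x (hL x hx) y (hL y hy)).trans h.parP_le

/-- While the gap exceeds `ε`, each run contracts the distance to `x*`, and the gap is at most `X²`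
times that distance. The number `r` of runs is the first one to reach the accuracy, since an early
return carries no information for later runs. -/
theorem exists_restarted_le (hA : (Aᵀ * A).PosDef) (hn : 0 < n) {X ε : ℝ} {i : Init}
    (hi : LoopBounds X i) (hX : X⁻¹ ≤ ε)
    (hN : 2239488 * (n : ℝ) ≤ ((i.numIter + 1 : ℕ) : ℝ) ^ 5) (m : ℕ) :
    ∀ z : Vec d, RunBounds A b c X z →
      ε < regression A b c z - regression A b c (regressionInstance A b c).xstar →
      X ^ 2 * ‖img A (z - (regressionInstance A b c).xstar)‖ ≤ ε * 3 ^ m →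
      ∃ r, 1 ≤ r ∧ r ≤ m ∧
        regression A b c ((regressionInstance A b c).restarted i r z).val
          - regression A b c (regressionInstance A b c).xstar ≤ ε := by
  have hgap : ∀ z : Vec d, RunBounds A b c X z →
      regression A b c z - regression A b c (regressionInstance A b c).xstar
        ≤ X ^ 2 * ‖img A (z - (regressionInstance A b c).xstar)‖ := fun z h => by
    have h1 := inner_gradient_le A b c z (regressionInstance A b c).xstar
    have h2 := le_of_abs_le (h.grad_le z (mem_setL_of_norm_le hA le_rfl)
      (z - (regressionInstance A b c).xstar))
    rw [← neg_sub z, inner_neg_right] at h1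
    linarith
  induction m with
  | zero =>
    intro z h h1 h2
    rw [pow_zero, mul_one] at h2
    linarith [hgap z h]
  | succ m ih =>
    intro z h h1 h2
    by_cases h3 : regression A b c ((regressionInstance A b c).fastQuartic i z).val
        - regression A b c (regressionInstance A b c).xstar ≤ ε
    · exact ⟨1, le_rfl, by omega, h3⟩
    · have hX0 : 0 < X := by linarith [h.two_le]
      have hε : 0 < ε := (inv_pos.2 hX0).trans_le hX
      have hz : 0 < ‖img A (z - (regressionInstance A b c).xstar)‖ :=
        pos_of_mul_pos_right (hε.trans (h1.trans_le (hgap z h))) (by positivity)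
      rcases fastQuartic_spec hA hn h hi hz hN with h4 | h4
      · exact absurd (h4.trans hX) h3
      · obtain ⟨r, hr1, hr2, hr3⟩ := ih _ (h.of_contract hA hn h4) (not_le.1 h3) (by
          rw [pow_succ (3 : ℝ)] at h2
          have := mul_le_mul_of_nonneg_left h4 (sq_nonneg X)
          linarith)
        exact ⟨r + 1, by omega, by omega, hr3⟩

theorem rhoSearch_numRuns (S : Instance d) (i : Init) (r : ℕ) (z x v : Vec d) (Ak : ℝ) (M : ℕ) :
    ∀ (lo hi : ℝ) (last : Vec d × ℝ),
      S.rhoSearch { i with numRuns := r } z x v Ak M lo hi last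
        = S.rhoSearch i z x v Ak M lo hi last := by
  induction M with
  | zero => exact fun lo hi last => rfl
  | succ M ih =>
    intro lo hi last
    unfold Instance.rhoSearch
    simp only [ih]
    rfl

theorem mainLoop_numRuns (S : Instance d) (i : Init) (r : ℕ) (z : Vec d) (k : ℕ) :
    ∀ (x : Vec d) (Ak : ℝ) (s : Vec d), S.mainLoop { i with numRuns := r } z k x Ak s
      = S.mainLoop i z k x Ak s := by
  induction k with
  | zero => exact fun x Ak s => rfl
  | succ k ih =>
    intro x Ak s
    unfold Instance.mainLoop
    simp only [ih, rhoSearch_numRuns]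
    rfl

/-- The field `numRuns` only sets the number of repetitions, so it may be filled in after `r` is
known. -/
theorem restarted_numRuns (S : Instance d) (i : Init) (r s : ℕ) : ∀ z : Vec d,
    S.restarted { i with numRuns := r } s z = S.restarted i s z := by
  induction s with
  | zero => exact fun z => rfl
  | succ s ih =>
    intro z
    unfold Instance.restarted Instance.fastQuartic
    simp only [ih, mainLoop_numRuns]

/-! ### The initialization -/

theorem exists_two_pow_ge {X : ℝ} (hX : 2 ≤ X) :
    ∃ l : ℕ, 1 ≤ l ∧ X ≤ 2 ^ l ∧ (l : ℝ) ≤ 3 * Real.log X := by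
  have hl2 := Real.log_two_gt_d9
  have hlX : Real.log 2 ≤ Real.log X := Real.log_le_log (by norm_num) hX
  have hq : 1 ≤ Real.log X / Real.log 2 := by
    rw [le_div_iff₀ (by linarith)]; linarith
  refine ⟨⌈Real.log X / Real.log 2⌉₊, Nat.one_le_ceil_iff.2 (by linarith), ?_, ?_⟩
  · have h1 := Nat.le_ceil (Real.log X / Real.log 2)
    rw [div_le_iff₀ (by linarith)] at h1
    rw [← Real.log_le_log_iff (by linarith) (by positivity), Real.log_pow]
    exact h1
  · have h1 := Nat.ceil_lt_add_one (by linarith : 0 ≤ Real.log X / Real.log 2)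
    have h2 : Real.log X / Real.log 2 ≤ 3 / 2 * Real.log X := by
      rw [div_le_iff₀ (by linarith)]
      nlinarith
    linarith

theorem exists_pow_five_ge {n : ℕ} (hn : 0 < n) : ∃ N : ℕ,
    2239488 * (n : ℝ) ≤ ((N + 1 : ℕ) : ℝ) ^ 5 ∧
      ((N + 1 : ℕ) : ℝ) ≤ 20 * (n : ℝ) ^ (1 / 5 : ℝ) := by
  have hn1 : (1 : ℝ) ≤ n := by exact_mod_cast hn
  set q := (n : ℝ) ^ (1 / 5 : ℝ) with hq
  have hq1 : 1 ≤ q := Real.one_le_rpow hn1 (by norm_num)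
  have hq5 : q ^ 5 = n := by
    rw [hq, ← Real.rpow_natCast, ← Real.rpow_mul (by positivity)]; norm_num
  have hc : 0 < ⌈19 * q⌉₊ := Nat.ceil_pos.2 (by positivity)
  -- `19⁵ = 2476099` exceeds `2239488`; the loop runs `N + 1` times, hence the shift by one.
  refine ⟨⌈19 * q⌉₊ - 1, ?_, ?_⟩ <;> rw [Nat.sub_add_cancel hc]
  · calc 2239488 * (n : ℝ) ≤ (19 * q) ^ 5 := by rw [mul_pow, hq5]; linarith
      _ ≤ _ := pow_le_pow_left₀ (by positivity) (Nat.le_ceil _) 5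
  · linarith [Nat.ceil_lt_add_one (by positivity : 0 ≤ 19 * q)]

/-- The initialization for starting points at which the gap exceeds the target accuracy. -/
def initOf (X : ℝ) (l N r : ℕ) : Init where
  rhoInit := (X ^ 10)⁻¹
  epsAam := (X ^ 72)⁻¹
  numIter := N
  numAux := 1750 * l
  numRho := 148 * l
  numDual := 310 * l
  numRuns := r

theorem loopBounds_initOf {X : ℝ} (hX : 2 ≤ X) {l : ℕ} (hl : X ≤ 2 ^ l) (N r : ℕ) :
    LoopBounds X (initOf X l N r) := by
  have hX0 : 0 ≤ X := by linarith
  have hp : ∀ m : ℕ, X ^ m ≤ 2 ^ (m * l) := fun m => by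
    rw [mul_comm, pow_mul]; exact pow_le_pow_left₀ hX0 hl m
  refine ⟨hp 310, ?_, hp 148, rfl, rfl⟩
  change X ^ 250 * 0.9 ^ (1750 * l) ≤ 1
  -- Seven steps halve the error, since `0.9⁷ < 1/2`, and `1750 = 7 · 250`.
  have e : (0.9 : ℝ) ^ (1750 * l) = ((0.9 ^ 7) ^ l) ^ 250 := by
    rw [← pow_mul, ← pow_mul]; congr 1; ring
  rw [e, ← mul_pow]
  refine pow_le_one₀ (by positivity) ?_
  calc X * (0.9 ^ 7) ^ l ≤ 2 ^ l * (1 / 2) ^ l :=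
        mul_le_mul hl (pow_le_pow_left₀ (by norm_num) (by norm_num) l) (by positivity)
          (by positivity)
    _ = 1 := by rw [← mul_pow]; norm_num

theorem callsPerIter_initOf (X : ℝ) {l : ℕ} (hl : 1 ≤ l) (N r : ℕ) :
    (initOf X l N r).callsPerIter ≤ 10 ^ 8 * l ^ 3 := by
  change 2 + (148 * l + 1) * (1750 * l * (310 * l + 6)) ≤ _
  have h1 : 148 * l + 1 ≤ 149 * l := by omega
  have h2 : 310 * l + 6 ≤ 316 * l := by omega
  have h3 : 1 ≤ l ^ 3 := Nat.one_le_pow _ _ hl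
  calc 2 + (148 * l + 1) * (1750 * l * (310 * l + 6))
      ≤ 2 + (149 * l) * (1750 * l * (316 * l)) := by gcongr
    _ = 2 + 82397000 * l ^ 3 := by ring
    _ ≤ _ := by omega

theorem parP_nonneg (z : Vec d) : 0 ≤ (regressionInstance A b c).parP z := by
  refine Real.sSup_nonneg ?_
  rintro _ ⟨x, _, y, _, rfl⟩
  exact sq_nonneg _

/-- The initialization for starting points that are good enough. -/
def trivialInit (ρ : ℝ) : Init where
  rhoInit := ρ
  epsAam := 1 / 4
  numIter := 0
  numAux := 0
  numRho := 0
  numDual := 0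
  numRuns := 1

/-- With no auxiliary iterations `ApproxAuxMin` returns its argument, so the step length is `0` and
the first test returns `y⁻`, which is `z` because `v₀ = x₀ = z`. -/
theorem solve_trivialInit {ρ : ℝ} (hρ : 0 < ρ) (z : Vec d) :
    ((regressionInstance A b c).solve (trivialInit ρ) z).val = z := by
  change ((regressionInstance A b c).mainLoop (trivialInit ρ) z (0 + 1) z 0 0).val = z
  have hv : rhoPoint A b c z (z - (regressionInstance A b c).B.inverse 0) 0 ρ = z := by
    unfold rhoPoint Instance.mixPoint
    rw [map_zero, sub_zero, ← add_smul, sub_add_cancel, one_smul]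
  have hx : ∀ y, auxApprox A b c (trivialInit ρ) y = 0 := fun y => rfl
  rw [mainLoop_succ]
  dsimp only
  rw [if_pos]
  · rw [hx, add_zero]; exact hv
  · unfold rhoZeta
    rw [hx, map_zero, norm_zero]
    change (1 + _) * (0 : ℝ) ^ 2 < ρ
    simpa using hρ

theorem exists_init_of_gap_le (hA : (Aᵀ * A).PosDef) {z : Vec d} {ε : ℝ}
    (hε : 0 < ε) (hgap : regression A b c z
      - regression A b c (regressionInstance A b c).xstar ≤ ε) :
    ∃ i : Init, i.Valid (regressionInstance A b c) z ε ∧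
      regression A b c ((regressionInstance A b c).solve i z).val
        - regression A b c (regressionInstance A b c).xstar ≤ ε ∧
      ((regressionInstance A b c).solve i z).Within (IsWeightedGram A) 2 := by
  have hP := parP_nonneg (A := A) (b := b) (c := c) z
  set P := (regressionInstance A b c).parP z with hPdef
  -- The summand `1` keeps the quotient meaningful when `P = 0`.
  set ρ := min (1 / 4) (ε / (48 * P + 1)) with hρdef
  have hρ : 0 < ρ := lt_min (by norm_num) (by positivity)
  refine ⟨trivialInit ρ, ⟨le_rfl, hρ, ?_, ?_, ?_, ?_⟩, ?_, ?_⟩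
  · exact (min_le_left _ _).trans_lt (by norm_num)
  · rw [regressionInstance_L]
    change 2 * 24 * P * ρ ≤ ε
    have h1 : ρ ≤ ε / (48 * P + 1) := min_le_right _ _
    rw [le_div_iff₀ (by positivity)] at h1
    linarith
  · change (0 : ℝ) < 1 / 4; norm_num
  · change (1 / 4 : ℝ) < 1 / 2; norm_num
  · rw [solve_trivialInit hρ]; exact hgap
  · exact (within_restarted hA (trivialInit ρ) 1 z).mono (by
      change 1 * ((0 + 1) * (2 + (0 + 1) * (0 * (0 + 6)))) ≤ 2
      norm_num)

theorem exists_init_of_lt_gap (hA : (Aᵀ * A).PosDef) (hn : 0 < n) {z : Vec d} {ε : ℝ}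
    (hε : 0 < ε) (hgap : ε < regression A b c z
      - regression A b c (regressionInstance A b c).xstar) :
    ∃ (i : Init) (m : ℕ), i.Valid (regressionInstance A b c) z ε ∧
      regression A b c ((regressionInstance A b c).solve i z).val
        - regression A b c (regressionInstance A b c).xstar ≤ ε ∧
      ((regressionInstance A b c).solve i z).Within (IsWeightedGram A) m ∧
      (m : ℝ) ≤ 10 ^ 12 * (n : ℝ) ^ (1 / 5 : ℝ)
        * Real.log (2 + (regressionInstance A b c).parZ z / ε) ^ 4 := by
  obtain ⟨hR, hXε⟩ := RunBounds.of_gap hA hn hε hgap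
  set X := 2 + (regressionInstance A b c).parZ z / ε
  have hX := hR.two_le
  have hX0 : 0 < X := by linarith
  obtain ⟨l, hl1, hl2, hl3⟩ := exists_two_pow_ge hX
  obtain ⟨N, hN1, hN2⟩ := exists_pow_five_ge hn
  have hzX : ‖img A (z - (regressionInstance A b c).xstar)‖ ≤ X :=
    hR.norm_le (mem_setL_of_norm_le hA le_rfl) (xstar_mem hA z)
  have hεX : 1 ≤ ε * X := by
    rwa [inv_le_comm₀ hX0 hε, ← one_div, div_le_iff₀ hε, mul_comm] at hXε
  -- Four factors of `X`: two from the gradient bound, one from the distance, one from `1/ε ≤ X`.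
  -- This fixes the budget of `4 l` runs.
  have hm : X ^ 2 * ‖img A (z - (regressionInstance A b c).xstar)‖ ≤ ε * 3 ^ (4 * l) := by
    calc X ^ 2 * ‖img A (z - (regressionInstance A b c).xstar)‖ ≤ X ^ 2 * X := by gcongr
      _ = 1 * X ^ 3 := by ring
      _ ≤ (ε * X) * X ^ 3 := by gcongr
      _ = ε * X ^ 4 := by ring
      _ ≤ ε * (3 ^ l) ^ 4 := by
        gcongr
        exact hl2.trans (pow_le_pow_left₀ (by norm_num) (by norm_num) l)
      _ = _ := by rw [← pow_mul, mul_comm l]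
  obtain ⟨r, hr1, hr2, hr3⟩ := exists_restarted_le hA hn (i := initOf X l N 0)
    (loopBounds_initOf hX hl2 N 0) hXε hN1 (4 * l) z hR hgap hm
  refine ⟨initOf X l N r, r * ((N + 1) * (initOf X l N r).callsPerIter),
    ⟨hr1, ?_, ?_, ?_, ?_, ?_⟩, ?_, within_restarted hA (initOf X l N r) r z, ?_⟩
  · change 0 < (X ^ 10)⁻¹; positivity
  · change (X ^ 10)⁻¹ < 1 / 2
    have := mul_pow_inv_le hX (C := 4) 2 (by norm_num) 8
    have h8 : (X ^ 8)⁻¹ ≤ 1 := inv_le_one_of_one_le₀ (one_le_pow₀ (by linarith))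
    norm_num at this
    linarith
  · rw [regressionInstance_L]
    change 2 * 24 * (regressionInstance A b c).parP z * (X ^ 10)⁻¹ ≤ ε
    have := mul_pow_inv_le hX (C := 48) 7 (by norm_num) 1
    norm_num at this
    calc 2 * 24 * (regressionInstance A b c).parP z * (X ^ 10)⁻¹
        ≤ 2 * 24 * X ^ 2 * (X ^ 10)⁻¹ := by gcongr; exact hR.parP_le
      _ = 48 * (X ^ 8)⁻¹ := by field_simp; norm_num
      _ ≤ X⁻¹ := this
      _ ≤ ε := hXε
  · change 0 < (X ^ 72)⁻¹; positivity
  · change (X ^ 72)⁻¹ < 1 / 2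
    have := mul_pow_inv_le hX (C := 4) 2 (by norm_num) 70
    have h8 : (X ^ 70)⁻¹ ≤ 1 := inv_le_one_of_one_le₀ (one_le_pow₀ (by linarith))
    norm_num at this
    linarith
  · have e := restarted_numRuns (regressionInstance A b c) (initOf X l N 0) r r z
    rw [← e] at hr3
    exact hr3
  · have h1 := callsPerIter_initOf X hl1 N r
    have h1' : ((initOf X l N r).callsPerIter : ℝ) ≤ 10 ^ 8 * l ^ 3 := by exact_mod_cast h1
    have h2' : (r : ℝ) ≤ 4 * l := by exact_mod_cast hr2
    have hlog : 0 ≤ Real.log X := Real.log_nonneg (by linarith)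
    rw [Nat.cast_mul, Nat.cast_mul]
    -- Runs, iterations per run and calls per iteration multiply; with `l ≤ 3 log X` the constant is
    -- `4 · 20 · 10⁸ · 3⁴ = 648 · 10⁹`.
    calc (r : ℝ) * (((N + 1 : ℕ) : ℝ) * ((initOf X l N r).callsPerIter : ℝ))
        ≤ (4 * l) * ((20 * (n : ℝ) ^ (1 / 5 : ℝ)) * (10 ^ 8 * l ^ 3)) := by gcongr
      _ = 8 * 10 ^ 9 * (n : ℝ) ^ (1 / 5 : ℝ) * (l : ℝ) ^ 4 := by ring
      _ ≤ 8 * 10 ^ 9 * (n : ℝ) ^ (1 / 5 : ℝ) * (3 * Real.log X) ^ 4 := by gcongr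
      _ = 648 * 10 ^ 9 * ((n : ℝ) ^ (1 / 5 : ℝ) * Real.log X ^ 4) := by ring
      _ ≤ 10 ^ 12 * ((n : ℝ) ^ (1 / 5 : ℝ) * Real.log X ^ 4) := by gcongr; norm_num
      _ = _ := by ring

theorem two_le_calls (hn : 0 < n) (z : Vec d) {ε : ℝ} (hε : 0 < ε) :
    2 ≤ 10 ^ 12 * (n : ℝ) ^ (1 / 5 : ℝ)
      * Real.log (2 + (regressionInstance A b c).parZ z / ε) ^ 4 := by
  have hZ : 24 ≤ (regressionInstance A b c).parZ z := by
    have : (regressionInstance A b c).L ≤ (regressionInstance A b c).parZ z := by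
      unfold Instance.parZ; simp
    exact this
  have hn1 : (1 : ℝ) ≤ n := by exact_mod_cast hn
  have hq1 : (1 : ℝ) ≤ (n : ℝ) ^ (1 / 5 : ℝ) := Real.one_le_rpow hn1 (by norm_num)
  have hl : 1 / 2 ≤ Real.log (2 + (regressionInstance A b c).parZ z / ε) := by
    have h1 : Real.log 2 ≤ Real.log (2 + (regressionInstance A b c).parZ z / ε) :=
      Real.log_le_log (by norm_num) (le_add_of_nonneg_right (by positivity))
    linarith [Real.log_two_gt_d9]
  calc (2 : ℝ) ≤ 10 ^ 12 * 1 * (1 / 2) ^ 4 := by norm_num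
    _ ≤ _ := by gcongr

end

end

end FastQuartic

/-! ### The main theorem -/

theorem mainTheorem4 :
    ∃ (C : ℝ) (p : ℕ), ∀ (n d : ℕ) (A : Matrix (Fin n) (Fin d) ℝ) (b : Fin n → ℝ)
      (c : Fin d → ℝ), 0 < n → (Aᵀ * A).PosDef →
      IsMinOn (FastQuartic.regression A b c) Set.univ
        (FastQuartic.regressionInstance A b c).xstar ∧
      ∀ (x₀ : FastQuartic.Vec d) (ε : ℝ), 0 < ε →
        ∃ i : FastQuartic.Init,
          i.Valid (FastQuartic.regressionInstance A b c) x₀ ε ∧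
          FastQuartic.regression A b c
              ((FastQuartic.regressionInstance A b c).solve i x₀).val
            - FastQuartic.regression A b c (FastQuartic.regressionInstance A b c).xstar ≤ ε ∧
          ((((FastQuartic.regressionInstance A b c).solve i x₀).gradCalls
              + ((FastQuartic.regressionInstance A b c).solve i x₀).solverCalls : ℕ) : ℝ)
            ≤ C * (n : ℝ) ^ (1 / 5 : ℝ)
              * Real.log (2 + (FastQuartic.regressionInstance A b c).parZ x₀ / ε) ^ p ∧
          ∀ M ∈ ((FastQuartic.regressionInstance A b c).solve i x₀).systems,
            ∃ w : Fin n → ℝ, (∀ k, 0 < w k) ∧ M = FastQuartic.weightedGram A w := by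
  refine ⟨10 ^ 12, 4, fun n d A b c hn hA => ⟨fun y _ =>
    FastQuartic.regression_xstar_le b c hA hn y, fun x₀ ε hε => ?_⟩⟩
  rcases le_or_gt (FastQuartic.regression A b c x₀ - FastQuartic.regression A b c
    (FastQuartic.regressionInstance A b c).xstar) ε with hgap | hgap
  · obtain ⟨i, h1, h2, h3, h4⟩ := FastQuartic.exists_init_of_gap_le hA hε hgap
    exact ⟨i, h1, h2, (Nat.cast_le.2 h3).trans (by
      exact_mod_cast FastQuartic.two_le_calls hn x₀ hε), h4⟩
  · obtain ⟨i, m, h1, h2, ⟨h3, h4⟩, h5⟩ := FastQuartic.exists_init_of_lt_gap hA hn hε hgap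
    exact ⟨i, h1, h2, (Nat.cast_le.2 h3).trans h5, h4⟩
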